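/- **Setting (martingale decision making).** Let $d\ge 1$. One observes inputs $u_t\in\mathbb R^{d_u}$, covariates $z_t\in\mathbb R^{d}$ and responses $$y_t=\langle\theta,z_t\rangle+w_t,\qquad w_t\mid\mathcal F_{t-1}\sim\mathcal N(0,\sigma_w^2),\qquad u_t,z_t\ \text{are}\ \mathcal F_{t-1}\text{-measurable},\quad y_t\ \text{is}\ \mathcal F_t\text{-measurable},$$ with law $P_\theta$ and expectation $\mathbb E_\theta$ under the model $\theta\in\mathbb R^d$; $\tau=(u_t,z_t,y_t)_{t\le T}$ is the trajectory, and the exploration policy satisfies $\mathbb E_\theta[\sum_{t\le T}\|u_t\|^2]\le T\gamma^2$. Put $\Sigma_T=\sum_{t\le T}z_tz_t^\top$ and $\Gamma_T(\theta)=\frac1T\mathbb E_\theta[\Sigma_T]$ (second moments are assumed finite wherever $\Gamma_T$ is used). For losses $J_\theta:\mathbb R^{d_a}\to\mathbb R$ let $R(a;\theta)=J_\theta(a)-\inf_{a'}J_\theta(a')$, let $a_{\rm opt}(\theta)$ be a minimizer of $J_\theta$, and let $\mathcal H=\nabla^2_\theta R(a_{\rm opt}(\theta);\theta_\star)|_{\theta=\theta_\star}$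 and $\Phi_T=\mathrm{tr}(\mathcal H\,\Gamma_T(\theta_\star)^{-1})$. **Smooth loss.** There are $r>0$, $\mu>0$, $L_{R1},L_{R2},L_{R3},L_{a1},L_{a2},L_{a3},L_{\rm hess}$ such that for all $\theta,a$ with $\|\theta-\theta_\star\|\le r$ and $\|a-a_{\rm opt}(\theta_\star)\|\le L_{a1}r$: $R(a';\theta)\ge\frac\mu2\|a'-a_{\rm opt}(\theta)\|^2$ for all $a'\in\mathbb R^{d_a}$; $R(\cdot;\theta)$ and $a_{\rm opt}$ are three times differentiable at $a$ and at $\theta$; $\|\nabla_a^iR(a;\theta)\|_{\rm op}\le L_{Ri}$ $(i=1,2,3)$; $\|\nabla^i a_{\rm opt}(\theta)\|_{\rm op}\le L_{ai}$ $(i=1,2)$ and $\|\nabla^3a_{\rm opt}(\theta)[v,v,v]\|\le L_{a3}$ for unit $v$; and $\nabla_a^2R(a;\cdot)$ is $L_{\rm hess}$-Lipschitz on the ball $\|\theta-\theta_\star\|\le r$. Put $L_{\rm quad}=\frac16(L_{R3}L_{a1}^3+3L_{R2}L_{a2}L_{a1}+L_{R1}L_{a3})$. There are universal constants $c_1,c_2,c_3,c_4>0$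 such that the following two statements hold for every such problem and every horizon $T$. **1. Upper bound for certainty equivalence.** Let $\delta\in(0,1/2)$, $\underline\lambda,C_{\rm con},\alpha>0$, $\bar\Gamma_T\succeq0$, and suppose that under $\theta_\star$ * for every $T\ge T_{\rm se}$, with probability at least $1-\delta/4$: $\lambda_{\min}(\Sigma_T)\ge\underline\lambda T$ and $\Sigma_T\preceq T\bar\Gamma_T$; * for every $T\ge T_{\rm con}$, with probability at least $1-\delta/4$: $\|\Sigma_T-\mathbb E_{\theta_\star}\Sigma_T\|_{\rm op}\le C_{\rm con}T^{-\alpha}\lambda_{\min}(\mathbb E_{\theta_\star}\Sigma_T)$. Let $D=\log\frac1\delta+d+\log\det(\bar\Gamma_T/\underline\lambda+I)$ and let $\hat\theta_{\rm ls}$ be any minimizer of $\sum_{t\le T}(y_t-\langle\theta,z_t\rangle)^2$. If $T>\max\{T_{\rm con},T_{\rm se},(4C_{\rm con})^{1/\alpha},\,c_1\sigma_w^2D/(\underline\lambda r^2)\}$, then with probability at least $1-\delta$ under $\theta_\star$ $$R(a_{\rm opt}(\hat\theta_{\rm ls});\theta_\star)\le5\sigma_w^2\log\tfrac{24d}{\delta}\cdot\frac{\Phi_T}{T}+\frac{c_2L_{\rm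 quad}\,\sigma_w^3D^{3/2}}{\underline\lambda^{3/2}\,T^{3/2}}+\frac{c_3\sigma_w^2C_{\rm con}^2\,d\,\mathrm{tr}(\mathcal H)\log\frac d\delta}{\underline\lambda\,T^{1+2\alpha}} .$$ **2. Lower bound for every decision rule.** Suppose that the conditional law of $(u_t,z_t)$ given the past trajectory does not depend on $\theta$ (the model acts on the trajectory only through the responses $y_t$), and that for some $\underline\lambda,r_{\rm cov},L_{\rm cov},C_{\rm cov},c_{\rm cov},\alpha>0$ one has $\lambda_{\min}(\Gamma_T(\theta_\star))\ge\underline\lambda$ and, whenever $\|\theta-\theta_\star\|\le r_{\rm cov}$, $$\Gamma_T(\theta)\preceq c_{\rm cov}\Gamma_T(\theta_\star)+\big(L_{\rm cov}\|\theta-\theta_\star\|+C_{\rm cov}T^{-\alpha}\big)I .$$ If $$\underline\lambda T\ge\max\Big\{\big(\tfrac{80d}{r^2}\big)^{6/5},\big(\tfrac{\sigma_w^2L_{R2}}{5\mu}\big)^{6},\big(\tfrac{8L_{\rm cov}\sqrt{5d}}{\underline\lambda}\big)^{12/5},\big(\tfrac{8C_{\rm cov}}{\underline\lambda^{1-\alpha}}\big)^{1/\alpha},\big(\tfrac{5d}{r_{\rm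 cov}^2}\big)^{6/5}\Big\},$$ then with $\mathcal B_T=\{\theta:\|\theta-\theta_\star\|^2\le5d/(\underline\lambda T)^{5/6}\}$ the local minimax risk satisfies $$\inf_{\mathsf{dec}}\ \sup_{\theta\in\mathcal B_T}\mathbb E_\theta\big[R(\mathsf{dec}(\tau);\theta)\big]\ \ge\ \frac{\sigma_w^2}{1+2c_{\rm cov}}\cdot\frac{\Phi_T}{T}-\frac{C_{\rm lb}}{(\underline\lambda T)^{5/4}},$$ the infimum being over all measurable maps from trajectories to decisions, where $$C_{\rm lb}=c_4\Big((L_{a1}L_{a2}L_{R2}+L_{a1}^3L_{R3}+L_{a1}^2L_{\rm hess})\,d^{3/2}+d\,\sigma_w^5L_{a1}^2L_{R2}\,(L_{R2}/\mu)^{3/2}\Big).$$ -/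

import Mathlib

open MeasureTheory ProbabilityTheory
open scoped NNReal ENNReal

noncomputable section

namespace MDM

/-- Euclidean space `ℝⁿ` with the 2-norm. -/
abbrev Vec (n : ℕ) : Type := EuclideanSpace ℝ (Fin n)

/-! ### Linear algebra -/

/-- The smallest eigenvalue of a symmetric matrix, as the minimum of the Rayleigh quotient
over the unit sphere. -/
def lamMin {d : ℕ} (M : Matrix (Fin d) (Fin d) ℝ) : ℝ :=
  ⨅ x : Metric.sphere (0 : Vec d) 1,
    inner ℝ (x : Vec d) (Matrix.toEuclideanCLM (𝕜 := ℝ) M (x : Vec d))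

/-- The operator norm of a matrix for the Euclidean norm. -/
def opNorm {d : ℕ} (M : Matrix (Fin d) (Fin d) ℝ) : ℝ :=
  ‖Matrix.toEuclideanCLM (n := Fin d) (𝕜 := ℝ) M‖

/-- The Loewner order `A ⪯ B`. -/
def LoewnerLE {d : ℕ} (A B : Matrix (Fin d) (Fin d) ℝ) : Prop := (B - A).PosSemidef

/-! ### The decision problem -/

section Decision

variable {d dₐ : ℕ}

/-- The excess risk `R(a; θ) = J_θ(a) - inf_{a'} J_θ(a')`. -/
def excessRisk (J : Vec d → Vec dₐ → ℝ) (a : Vec dₐ) (θ : Vec d) : ℝ :=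
  J θ a - ⨅ a', J θ a'

/-- `f` is three times differentiable at `x`: it is twice continuously differentiable near `x`
and its second derivative is differentiable at `x`. -/
def ThriceDifferentiableAt {E F : Type*} [NormedAddCommGroup E] [NormedSpace ℝ E]
    [NormedAddCommGroup F] [NormedSpace ℝ F] (f : E → F) (x : E) : Prop :=
  ContDiffAt ℝ 2 f x ∧ DifferentiableAt ℝ (iteratedFDeriv ℝ 2 f) x

/-- The constants of smooth decision making: the radius `r`, the growth constant `μ`, the bounds
`LR i`, `La i` on the derivatives of order `i` of the excess risk in the decision and of the
optimal decision in the model, and the Lipschitz constant `Lhess` of the Hessian of the risk. -/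
structure SmoothConstants where
  r : ℝ
  μ : ℝ
  LR1 : ℝ
  LR2 : ℝ
  LR3 : ℝ
  La1 : ℝ
  La2 : ℝ
  La3 : ℝ
  Lhess : ℝ

/-- The constant of the cubic error in the quadratic approximation of the risk. -/
def SmoothConstants.Lquad (S : SmoothConstants) : ℝ :=
  (S.LR3 * S.La1 ^ 3 + 3 * S.LR2 * S.La2 * S.La1 + S.LR1 * S.La3) / 6

/-- Smooth decision making around the model `θ₀`, for the loss `J` and the plug-in optimal
decision `aopt`. -/
structure SmoothDecision (J : Vec d → Vec dₐ → ℝ) (aopt : Vec d → Vec dₐ) (θ₀ : Vec d)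
    (S : SmoothConstants) : Prop where
  r_pos : 0 < S.r
  μ_pos : 0 < S.μ
  /-- `aopt θ` minimizes the loss `J_θ`. -/
  optimal : ∀ θ, ‖θ - θ₀‖ ≤ S.r → ∀ a, J θ (aopt θ) ≤ J θ a
  /-- Quadratic growth over all decisions; it makes the minimizer unique. -/
  growth : ∀ θ, ‖θ - θ₀‖ ≤ S.r → ∀ a, S.μ / 2 * ‖a - aopt θ‖ ^ 2 ≤ excessRisk J a θ
  risk_diff : ∀ θ a, ‖θ - θ₀‖ ≤ S.r → ‖a - aopt θ₀‖ ≤ S.La1 * S.r →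
    ThriceDifferentiableAt (fun a' => excessRisk J a' θ) a
  risk_bound₁ : ∀ θ a, ‖θ - θ₀‖ ≤ S.r → ‖a - aopt θ₀‖ ≤ S.La1 * S.r →
    ‖iteratedFDeriv ℝ 1 (fun a' => excessRisk J a' θ) a‖ ≤ S.LR1
  risk_bound₂ : ∀ θ a, ‖θ - θ₀‖ ≤ S.r → ‖a - aopt θ₀‖ ≤ S.La1 * S.r →
    ‖iteratedFDeriv ℝ 2 (fun a' => excessRisk J a' θ) a‖ ≤ S.LR2
  risk_bound₃ : ∀ θ a, ‖θ - θ₀‖ ≤ S.r → ‖a - aopt θ₀‖ ≤ S.La1 * S.r →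
    ‖iteratedFDeriv ℝ 3 (fun a' => excessRisk J a' θ) a‖ ≤ S.LR3
  opt_diff : ∀ θ, ‖θ - θ₀‖ ≤ S.r → ThriceDifferentiableAt aopt θ
  opt_bound₁ : ∀ θ, ‖θ - θ₀‖ ≤ S.r → ‖iteratedFDeriv ℝ 1 aopt θ‖ ≤ S.La1
  opt_bound₂ : ∀ θ, ‖θ - θ₀‖ ≤ S.r → ‖iteratedFDeriv ℝ 2 aopt θ‖ ≤ S.La2
  opt_bound₃ : ∀ θ, ‖θ - θ₀‖ ≤ S.r → ∀ v : Vec d, ‖v‖ = 1 →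
    ‖iteratedFDeriv ℝ 3 aopt θ (fun _ => v)‖ ≤ S.La3
  hess_lipschitz : ∀ θ θ' a, ‖θ - θ₀‖ ≤ S.r → ‖θ' - θ₀‖ ≤ S.r → ‖a - aopt θ₀‖ ≤ S.La1 * S.r →
    ‖iteratedFDeriv ℝ 2 (fun a' => excessRisk J a' θ) a
      - iteratedFDeriv ℝ 2 (fun a' => excessRisk J a' θ') a‖ ≤ S.Lhess * ‖θ - θ'‖

/-- The model-task Hessian: the Hessian at `θ = θ₀` of `θ ↦ R(aopt(θ); θ₀)`. -/
def taskHessian (J : Vec d → Vec dₐ → ℝ) (aopt : Vec d → Vec dₐ) (θ₀ : Vec d) :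
    Matrix (Fin d) (Fin d) ℝ :=
  Matrix.of fun i j => iteratedFDeriv ℝ 2 (fun θ => excessRisk J (aopt θ) θ₀) θ₀
    ![EuclideanSpace.single i 1, EuclideanSpace.single j 1]

end Decision

/-! ### Martingale observations -/

section Observations

variable {Ω : Type*} [mΩ : MeasurableSpace Ω] {d dᵤ : ℕ}

/-- A trajectory `(u_t, z_t, y_t)` of length `T`: inputs, covariates and responses. -/
abbrev Traj (d dᵤ T : ℕ) : Type := Fin T → Vec dᵤ × Vec d × ℝ

/-- Inputs `u`, covariates `z` and scalar responses `y`, adapted to a filtration. Time is counted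
from `0`: the input and the covariate of step `t` are known before the noise of step `t` is drawn,
i.e. are measurable for `ℱ t`, and the response of step `t` is measurable for `ℱ (t + 1)`. -/
structure Observations (Ω : Type*) [mΩ : MeasurableSpace Ω] (d dᵤ : ℕ) where
  ℱ : Filtration ℕ mΩ
  u : ℕ → Ω → Vec dᵤ
  z : ℕ → Ω → Vec d
  y : ℕ → Ω → ℝ
  u_meas : ∀ t, Measurable[ℱ t] (u t)
  z_meas : ∀ t, Measurable[ℱ t] (z t)
  y_meas : ∀ t, Measurable[ℱ (t + 1)] (y t)

namespace Observations

variable (X : Observations Ω d dᵤ)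

/-- The noise `w_t = y_t - ⟨θ, z_t⟩` under the model `θ`. -/
def noise (θ : Vec d) (t : ℕ) (ω : Ω) : ℝ := X.y t ω - inner ℝ θ (X.z t ω)

/-- The trajectory of the first `T` steps. -/
def traj (T : ℕ) (ω : Ω) : Traj d dᵤ T := fun t => (X.u t ω, X.z t ω, X.y t ω)

/-- `P` is a law of the observations under the model `θ`: one has `y_t = ⟨θ, z_t⟩ + w_t`, where,
conditionally on `ℱ t`, the noise `w_t` has the law `N(0, σ²)`. -/
structure IsLaw (σ : ℝ≥0) (θ : Vec d) (P : Measure Ω) : Prop where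
  prob : IsProbabilityMeasure P
  noise_law : ∀ t, P.map (X.noise θ t) = gaussianReal 0 (σ ^ 2)
  noise_indep : ∀ t, Indep (X.ℱ t) (MeasurableSpace.comap (X.noise θ t) inferInstance) P

/-- The exploration policy and the mechanism that produces the covariates do not know the model:
there is, at each step, a conditional law of the next input and covariate given the past
trajectory that is the same for all `θ`. -/
def SameExploration (P : Vec d → Measure Ω) : Prop :=
  ∀ t : ℕ, ∃ κ : Kernel (Traj d dᵤ t) (Vec dᵤ × Vec d), IsMarkovKernel κ ∧
    ∀ θ, (P θ).map (fun ω => (X.traj t ω, (X.u t ω, X.z t ω))) = ((P θ).map (X.traj t)) ⊗ₘ κ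

/-- The power constraint `E[∑_{t < T} ‖u_t‖²] ≤ T γ²`. -/
def PowerBound (P : Measure Ω) (T : ℕ) (γ : ℝ) : Prop :=
  ∫⁻ ω, ENNReal.ofReal (∑ t ∈ Finset.range T, ‖X.u t ω‖ ^ 2) ∂P ≤ ENNReal.ofReal (T * γ ^ 2)

/-- The random covariance `Σ_T = ∑_{t < T} z_t z_tᵀ`. -/
def cov (T : ℕ) (ω : Ω) : Matrix (Fin d) (Fin d) ℝ :=
  Matrix.of fun i j => ∑ t ∈ Finset.range T, X.z t ω i * X.z t ω j

/-- The expected covariance `E[Σ_T]`. -/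
def meanCov (P : Measure Ω) (T : ℕ) : Matrix (Fin d) (Fin d) ℝ :=
  Matrix.of fun i j => ∫ ω, X.cov T ω i j ∂P

/-- The average expected covariance `Γ_T = E[Σ_T] / T`. -/
def Gam (P : Measure Ω) (T : ℕ) : Matrix (Fin d) (Fin d) ℝ := (T : ℝ)⁻¹ • X.meanCov P T

/-- The idealized risk `Φ_T = tr(H Γ_T⁻¹)`. -/
def idealRisk (H : Matrix (Fin d) (Fin d) ℝ) (P : Measure Ω) (T : ℕ) : ℝ :=
  (H * (X.Gam P T)⁻¹).trace

/-- Regularity of the exploration policy for the upper bound, with failure probability `ε`: for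
every horizon `T ≥ Tse` the covariates are sufficiently excited with probability at least `1 - ε`,
and for every horizon `T ≥ Tcon` they have concentrated around their mean with probability at
least `1 - ε`. The second moments are finite, so that the mean exists. -/
structure PolicyRegular (P : Measure Ω) (ε lam : ℝ) (Gbar : ℕ → Matrix (Fin d) (Fin d) ℝ)
    (Tse Tcon Ccon α : ℝ) : Prop where
  lam_pos : 0 < lam
  Gbar_psd : ∀ T, (Gbar T).PosSemidef
  Ccon_pos : 0 < Ccon
  α_pos : 0 < α
  square_integrable : ∀ t, MemLp (X.z t) 2 P
  excited : ∀ T : ℕ, Tse ≤ T →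
    P {ω | ¬ (lam * T ≤ lamMin (X.cov T ω) ∧ LoewnerLE (X.cov T ω) ((T : ℝ) • Gbar T))}
      ≤ ENNReal.ofReal ε
  concentrated : ∀ T : ℕ, Tcon ≤ T →
    P {ω | ¬ (opNorm (X.cov T ω - X.meanCov P T)
        ≤ Ccon / (T : ℝ) ^ α * lamMin (X.meanCov P T))} ≤ ENNReal.ofReal ε

/-- Sufficient excitation and smooth response of the covariance at the horizon `T`, the regularity
of the exploration policy for the lower bound. -/
structure SmoothResponse (P : Vec d → Measure Ω) (θ₀ : Vec d) (T : ℕ)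
    (lam rcov Lcov Ccov ccov α : ℝ) : Prop where
  lam_pos : 0 < lam
  rcov_pos : 0 < rcov
  Lcov_pos : 0 < Lcov
  Ccov_pos : 0 < Ccov
  ccov_pos : 0 < ccov
  α_pos : 0 < α
  square_integrable : ∀ θ, ‖θ - θ₀‖ ≤ rcov → ∀ t < T, MemLp (X.z t) 2 (P θ)
  excited : lam ≤ lamMin (X.Gam (P θ₀) T)
  response : ∀ θ, ‖θ - θ₀‖ ≤ rcov →
    LoewnerLE (X.Gam (P θ) T)
      (ccov • X.Gam (P θ₀) T + (Lcov * ‖θ - θ₀‖ + Ccov / (T : ℝ) ^ α) • 1)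

/-- The local minimax risk over the set `B` of models: the infimum over the measurable decision
rules of the worst expected excess risk. -/
def minimaxRisk {dₐ : ℕ} (P : Vec d → Measure Ω) (J : Vec d → Vec dₐ → ℝ) (T : ℕ)
    (B : Set (Vec d)) : ℝ≥0∞ :=
  ⨅ (dec : Traj d dᵤ T → Vec dₐ) (_ : Measurable dec),
    ⨆ θ ∈ B, ∫⁻ ω, ENNReal.ofReal (excessRisk J (dec (X.traj T ω)) θ) ∂(P θ)

end Observations

/-- `θhat` is a least-squares estimator: on every trajectory it minimizes
`∑_t (y_t - ⟨θ, z_t⟩)²`. -/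
def IsLeastSquares {T : ℕ} (θhat : Traj d dᵤ T → Vec d) : Prop :=
  ∀ (τ : Traj d dᵤ T) (θ : Vec d),
    ∑ t, ((τ t).2.2 - inner ℝ (θhat τ) (τ t).2.1) ^ 2
      ≤ ∑ t, ((τ t).2.2 - inner ℝ θ (τ t).2.1) ^ 2

end Observations

/-- The complexity `log(1/δ) + d + log det(Γ̄/λ + I)`. -/
def logComplexity {d : ℕ} (δ lam : ℝ) (Gbar : Matrix (Fin d) (Fin d) ℝ) : ℝ :=
  Real.log (1 / δ) + d + Real.log (lam⁻¹ • Gbar + 1).det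

/-- The constant of the lower-order term of the lower bound, up to a universal factor. -/
def lowerConst (d : ℕ) (σ : ℝ) (S : SmoothConstants) : ℝ :=
  (S.La1 * S.La2 * S.LR2 + S.La1 ^ 3 * S.LR3 + S.La1 ^ 2 * S.Lhess) * (d : ℝ) ^ (3 / 2 : ℝ)
    + d * σ ^ 5 * S.La1 ^ 2 * S.LR2 * (S.LR2 / S.μ) ^ (3 / 2 : ℝ)

end MDM

end

/-!
For the upper bound, least squares solves the normal equations `Σ_T (θhat - θ₀) = ∑_t w_t z_t`, and
`exp (⟨v, ∑_t w_t z_t⟩ - σ² ⟨v, Σ_T v⟩ / 2)` has mean at most `1` for every `v`. Where `Σ_T` is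
close to its mean `E`, it can be replaced with `5/4 E` in the exponent, and mixing over a Gaussian
`v` bounds the noise in the norm of `E⁻¹`; hence `θhat` lies in the ball where the risk is smooth.
There `R(aopt(θ); θ₀)` is the quadratic form of `H / 2` up to a cubic error. In a decomposition
`H = ∑_i k_i k_iᵀ`, the quadratic form of the error is, up to concentration, a sum of `d` squared
sub-Gaussian variables `⟨E⁻¹ k_i, ∑_t w_t z_t⟩`, whose variance proxies add up to a multiple of
`σ² tr (H E⁻¹) = σ² Φ_T / T`.

For the lower bound, the expected covariance is, up to the factor `1 / σ²`, the Fisher information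
of the experiment, because only the Gaussian responses depend on the model. The van Trees inequality
for the prior proportional to `(ρ² - ‖η‖²)³` on a ball of radius `ρ` bounds the Bayes risk for the
quadratic loss that approximates the excess risk around `θ₀`. The direction in which the inequality
is applied, the derivative of `aopt` times `Γ_T⁻¹`, turns this bound into the multiple
`σ² / (1 + 2 ccov)` of `Φ_T / T`, and quadratic growth disposes of the decisions far from `aopt θ₀`.
-/

namespace MDM

/-! ### Quadratic forms of matrices -/

section LinearAlgebra

open scoped MatrixOrder in
lemma exists_eq_sum_vecMulVec {n : Type*} [Fintype n] {M : Matrix n n ℝ} (hM : M.PosSemidef) :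
    ∃ k : n → EuclideanSpace ℝ n, M = ∑ i, Matrix.vecMulVec (k i) (k i) := by
  classical
  obtain ⟨K, rfl⟩ := CStarAlgebra.nonneg_iff_eq_star_mul_self.1 hM.nonneg
  refine ⟨fun i => WithLp.toLp 2 (K i), ?_⟩
  ext i j
  simp [Matrix.mul_apply, Matrix.sum_apply, Matrix.vecMulVec_apply]

variable {n : Type*} [Fintype n]

lemma inner_eq_sum (x y : EuclideanSpace ℝ n) : inner ℝ x y = ∑ i, x i * y i := by
  simp [PiLp.inner_apply, mul_comm]

variable [DecidableEq n] {M : Matrix n n ℝ}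

/-- The operator on Euclidean space given by a square matrix. -/
noncomputable abbrev op (M : Matrix n n ℝ) : EuclideanSpace ℝ n →L[ℝ] EuclideanSpace ℝ n :=
  Matrix.toEuclideanCLM (n := n) (𝕜 := ℝ) M

lemma inner_op_eq_sum (M : Matrix n n ℝ) (x y : EuclideanSpace ℝ n) :
    inner ℝ x (op M y) = ∑ i, ∑ j, M i j * (x i * y j) := by
  rw [Matrix.inner_toEuclideanCLM]
  simp only [dotProduct, Matrix.mulVec, Finset.mul_sum]
  exact Finset.sum_congr rfl fun i _ => Finset.sum_congr rfl fun j _ => by ring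

lemma inner_op_conjTranspose (M : Matrix n n ℝ) (x y : EuclideanSpace ℝ n) :
    inner ℝ x (op M.conjTranspose y) = inner ℝ (op M x) y := by
  have h : op M.conjTranspose = (op M).adjoint := map_star _ M
  rw [h, ContinuousLinearMap.adjoint_inner_right]

lemma inner_op_comm (hM : M.IsHermitian) (x y : EuclideanSpace ℝ n) :
    inner ℝ x (op M y) = inner ℝ (op M x) y := by
  rw [← inner_op_conjTranspose, hM]

lemma op_one_apply (x : EuclideanSpace ℝ n) : op (1 : Matrix n n ℝ) x = x := by
  simp [op]

lemma op_mul_apply (M N : Matrix n n ℝ) (x : EuclideanSpace ℝ n) :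
    op (M * N) x = op M (op N x) := by
  simp [op]

lemma op_add_apply (M N : Matrix n n ℝ) (x : EuclideanSpace ℝ n) :
    op (M + N) x = op M x + op N x := by
  simp [op]

lemma op_sub_apply (M N : Matrix n n ℝ) (x : EuclideanSpace ℝ n) :
    op (M - N) x = op M x - op N x := by
  simp [op]

lemma op_smul_apply (c : ℝ) (M : Matrix n n ℝ) (x : EuclideanSpace ℝ n) :
    op (c • M) x = c • op M x := by
  simp [op]

lemma op_op_inv (hM : IsUnit M.det) (x : EuclideanSpace ℝ n) : op M (op M⁻¹ x) = x := by
  rw [← op_mul_apply, Matrix.mul_nonsing_inv _ hM, op_one_apply]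

lemma op_inv_op (hM : IsUnit M.det) (x : EuclideanSpace ℝ n) : op M⁻¹ (op M x) = x := by
  rw [← op_mul_apply, Matrix.nonsing_inv_mul _ hM, op_one_apply]

lemma inner_op_nonneg (hM : M.PosSemidef) (x : EuclideanSpace ℝ n) : 0 ≤ inner ℝ x (op M x) := by
  rw [Matrix.inner_toEuclideanCLM]
  simpa using hM.dotProduct_mulVec_nonneg x.ofLp

lemma two_mul_inner_le_inner_op_add_inner_op_inv (hM : M.PosDef) (x y : EuclideanSpace ℝ n) :
    2 * inner ℝ x y ≤ inner ℝ x (op M x) + inner ℝ y (op M⁻¹ y) := by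
  have h := inner_op_nonneg hM.posSemidef (x - op M⁻¹ y)
  rw [map_sub, op_op_inv hM.det_pos.ne'.isUnit, inner_sub_left, inner_sub_right, inner_sub_right,
    ← inner_op_comm hM.inv.isHermitian, op_inv_op hM.det_pos.ne'.isUnit,
    ← inner_op_comm hM.inv.isHermitian, real_inner_comm x y] at h
  linarith

lemma inner_op_vecMulVec (k x y : EuclideanSpace ℝ n) :
    inner ℝ x (op (Matrix.vecMulVec k k) y) = inner ℝ k x * inner ℝ k y := by
  rw [inner_op_eq_sum, inner_eq_sum, inner_eq_sum, Finset.sum_mul_sum]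
  exact Finset.sum_congr rfl fun i _ => Finset.sum_congr rfl fun j _ => by
    rw [Matrix.vecMulVec_apply]; ring

lemma trace_vecMulVec_mul (k : EuclideanSpace ℝ n) (M : Matrix n n ℝ) :
    (Matrix.vecMulVec k k * M).trace = inner ℝ k (op M k) := by
  rw [Matrix.vecMulVec_mul, Matrix.trace_vecMulVec, Matrix.inner_toEuclideanCLM, dotProduct_comm,
    Matrix.dotProduct_mulVec]

section RankOneSum

variable {ι : Type*} [Fintype ι] (k : ι → EuclideanSpace ℝ n)

lemma inner_op_sum_vecMulVec (x y : EuclideanSpace ℝ n) :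
    inner ℝ x (op (∑ i, Matrix.vecMulVec (k i) (k i)) y)
      = ∑ i, inner ℝ (k i) x * inner ℝ (k i) y := by
  simp only [op, map_sum, sum_apply, inner_sum]
  exact Finset.sum_congr rfl fun i _ => inner_op_vecMulVec (k i) x y

lemma trace_sum_vecMulVec_mul (M : Matrix n n ℝ) :
    ((∑ i, Matrix.vecMulVec (k i) (k i)) * M).trace = ∑ i, inner ℝ (k i) (op M (k i)) := by
  simp only [Finset.sum_mul, Matrix.trace_sum, trace_vecMulVec_mul]

omit [DecidableEq n] in
lemma trace_sum_vecMulVec :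
    (∑ i, Matrix.vecMulVec (k i) (k i)).trace = ∑ i, ‖k i‖ ^ 2 := by
  simp only [Matrix.trace_sum, Matrix.trace_vecMulVec, dotProduct, ← inner_eq_sum,
    real_inner_self_eq_norm_sq]

end RankOneSum

-- With `M = Kᴴ K`, the whitening map is `K⁻¹`.
lemma exists_whitening (hM : M.PosDef) :
    ∃ W : EuclideanSpace ℝ n →L[ℝ] EuclideanSpace ℝ n,
      (∀ x, inner ℝ (W x) (op M (W x)) = ‖x‖ ^ 2) ∧
      ∀ x, ‖W.adjoint x‖ ^ 2 = inner ℝ x (op M⁻¹ x) := by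
  obtain ⟨K, rfl⟩ : ∃ K : Matrix n n ℝ, M = K.conjTranspose * K := by
    open scoped MatrixOrder in
    exact CStarAlgebra.nonneg_iff_eq_star_mul_self.mp hM.posSemidef.nonneg
  have hK : IsUnit K.det := by
    have := hM.det_pos.ne'
    rw [Matrix.det_mul] at this
    exact (right_ne_zero_of_mul this).isUnit
  have hadj : (op K⁻¹).adjoint = op K.conjTranspose⁻¹ := by
    rw [← Matrix.conjTranspose_nonsing_inv]
    exact (map_star _ _).symm
  refine ⟨op K⁻¹, fun x => ?_, fun x => ?_⟩
  · rw [op_mul_apply, inner_op_conjTranspose, op_op_inv hK, real_inner_self_eq_norm_sq]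
  · rw [Matrix.mul_inv_rev, op_mul_apply, ← ContinuousLinearMap.adjoint_inner_left, hadj,
      real_inner_self_eq_norm_sq]

lemma one_le_det_add_one (hM : M.PosSemidef) : 1 ≤ (M + 1).det := by
  have hdet : (M + 1).det = ∏ i, (hM.isHermitian.eigenvalues i + 1) := by
    have h := congrArg (Polynomial.eval (-1)) hM.isHermitian.charpoly_eq
    rw [Matrix.eval_charpoly, Polynomial.eval_prod] at h
    have hneg : Matrix.scalar n (-1 : ℝ) - M = -(M + 1) := by
      rw [map_neg, map_one]; abel
    rw [hneg, Matrix.det_neg] at h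
    have hfac : ∏ i, Polynomial.eval (-1) (Polynomial.X
          - Polynomial.C (RCLike.ofReal (hM.isHermitian.eigenvalues i) : ℝ))
        = (-1) ^ Fintype.card n * ∏ i, (hM.isHermitian.eigenvalues i + 1) := by
      rw [← Finset.card_univ, ← Finset.prod_const, ← Finset.prod_mul_distrib]
      refine Finset.prod_congr rfl fun i _ => ?_
      simp only [Polynomial.eval_sub, Polynomial.eval_X, Polynomial.eval_C,
        RCLike.ofReal_real_eq_id, id]
      ring
    rw [hfac] at h
    exact mul_left_cancel₀ (pow_ne_zero _ (by norm_num)) h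
  rw [hdet]
  exact Finset.one_le_prod fun i _ => le_add_of_nonneg_left (hM.eigenvalues_nonneg i)

end LinearAlgebra

section LoewnerOrder

variable {d : ℕ} {M N : Matrix (Fin d) (Fin d) ℝ}

lemma inner_op_le_of_loewnerLE (h : LoewnerLE M N) (x : Vec d) :
    inner ℝ x (op M x) ≤ inner ℝ x (op N x) := by
  have := inner_op_nonneg h x
  rw [op_sub_apply, inner_sub_right] at this
  linarith

lemma abs_inner_op_le (M : Matrix (Fin d) (Fin d) ℝ) (x y : Vec d) :
    |inner ℝ x (op M y)| ≤ opNorm M * (‖x‖ * ‖y‖) := by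
  calc |inner ℝ x (op M y)| ≤ ‖x‖ * ‖op M y‖ := abs_real_inner_le_norm x (op M y)
    _ ≤ ‖x‖ * (opNorm M * ‖y‖) := by gcongr; exact (op M).le_opNorm y
    _ = opNorm M * (‖x‖ * ‖y‖) := by ring

lemma lamMin_mul_le (M : Matrix (Fin d) (Fin d) ℝ) (x : Vec d) :
    lamMin M * ‖x‖ ^ 2 ≤ inner ℝ x (op M x) := by
  rcases eq_or_ne x 0 with rfl | hx
  · simp
  have hx' : 0 < ‖x‖ := norm_pos_iff.2 hx
  have hbdd : BddBelow (Set.range fun y : Metric.sphere (0 : Vec d) 1 =>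
      inner ℝ (y : Vec d) (op M (y : Vec d))) := by
    refine ⟨-opNorm M, ?_⟩
    rintro _ ⟨y, rfl⟩
    have h := abs_inner_op_le M y y
    rw [norm_eq_of_mem_sphere, mul_one, mul_one] at h
    exact neg_le_of_abs_le h
  have h : lamMin M ≤ ‖x‖⁻¹ * (‖x‖⁻¹ * inner ℝ x (op M x)) := by
    have := ciInf_le hbdd ⟨‖x‖⁻¹ • x, by simp [norm_smul, hx'.ne']⟩
    simpa [lamMin, inner_smul_left, inner_smul_right] using this
  calc lamMin M * ‖x‖ ^ 2 ≤ ‖x‖⁻¹ * (‖x‖⁻¹ * inner ℝ x (op M x)) * ‖x‖ ^ 2 := by gcongr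
    _ = inner ℝ x (op M x) := by field_simp

lemma posDef_of_lamMin_pos (hM : M.IsHermitian) (h : 0 < lamMin M) : M.PosDef := by
  refine Matrix.PosDef.of_dotProduct_mulVec_pos hM fun x hx => ?_
  have hx' : 0 < ‖WithLp.toLp 2 x‖ := norm_pos_iff.2 (by simpa using hx)
  have hpos : 0 < lamMin M * ‖WithLp.toLp 2 x‖ ^ 2 := by positivity
  have hle := lamMin_mul_le M (WithLp.toLp 2 x)
  rw [Matrix.inner_toEuclideanCLM] at hle
  simpa using hpos.trans_le hle

lemma eq_of_opNorm_sub_nonpos (h : opNorm (M - N) ≤ 0) : M = N := by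
  have h0 : op (M - N) = 0 := norm_le_zero_iff.1 h
  have hinj := (Matrix.toEuclideanCLM (n := Fin d) (𝕜 := ℝ)).injective
  exact sub_eq_zero.1 ((map_eq_zero_iff _ hinj).1 h0)

end LoewnerOrder

/-! ### Gaussian noise conditionally on the past -/

section GaussianIntegrals

lemma lintegral_exp_gaussianReal (v : ℝ≥0) (a : ℝ) :
    ∫⁻ w, ENNReal.ofReal (Real.exp (a * w - v / 2 * a ^ 2)) ∂(gaussianReal 0 v) = 1 := by
  have hint : Integrable (fun w => Real.exp (a * w - v / 2 * a ^ 2)) (gaussianReal 0 v) := by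
    simp_rw [Real.exp_sub]
    exact (integrable_exp_mul_gaussianReal a).div_const _
  have hmgf : ∫ w, Real.exp (a * w) ∂(gaussianReal 0 v) = Real.exp (v * a ^ 2 / 2) := by
    simpa [mgf] using congrFun (mgf_fun_id_gaussianReal (μ := 0) (v := v)) a
  rw [← ofReal_integral_eq_lintegral_ofReal hint (ae_of_all _ fun _ => (Real.exp_pos _).le)]
  simp_rw [Real.exp_sub, integral_div, hmgf]
  rw [← Real.exp_sub]
  simp [show (v : ℝ) * a ^ 2 / 2 - v / 2 * a ^ 2 = 0 by ring]

lemma lintegral_sq_gaussianReal (v : ℝ≥0) (a b : ℝ) :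
    ∫⁻ w, ENNReal.ofReal ((a + b * w) ^ 2) ∂(gaussianReal 0 v)
      = ENNReal.ofReal (a ^ 2) + ENNReal.ofReal (v * b ^ 2) := by
  have hL2 : MemLp (fun w : ℝ => w) 2 (gaussianReal 0 v) := memLp_id_gaussianReal 2
  have hint : Integrable (fun w : ℝ => w) (gaussianReal 0 v) := hL2.integrable (by norm_num)
  have hvar : ∫ w, w ^ 2 ∂(gaussianReal 0 v) = v := by
    have h := variance_eq_sub hL2
    rw [variance_fun_id_gaussianReal, integral_id_gaussianReal] at h
    simpa using h.symm
  have hexpand : (fun w : ℝ => (a + b * w) ^ 2)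
      = fun w => a ^ 2 + (2 * a * b * w + b ^ 2 * w ^ 2) := by
    ext w; ring
  have hrest : Integrable (fun w : ℝ => 2 * a * b * w + b ^ 2 * w ^ 2) (gaussianReal 0 v) :=
    (hint.const_mul (2 * a * b)).add (hL2.integrable_sq.const_mul (b ^ 2))
  rw [← ENNReal.ofReal_add (by positivity) (by positivity),
    ← ofReal_integral_eq_lintegral_ofReal _ (ae_of_all _ fun _ => sq_nonneg _), hexpand,
    integral_add (integrable_const _) hrest, integral_add (hint.const_mul _)
    (hL2.integrable_sq.const_mul _), integral_const_mul, integral_const_mul, hvar,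
    integral_id_gaussianReal]
  · simp only [integral_const, probReal_univ, one_smul, mul_zero, zero_add]
    ring_nf
  · rw [hexpand]
    exact (integrable_const _).add hrest

end GaussianIntegrals

namespace Observations

variable {Ω : Type*} [mΩ : MeasurableSpace Ω] {d dᵤ : ℕ}

section Basic

variable (X : Observations Ω d dᵤ) (θ v x y : Vec d) (t T : ℕ)

/-- The martingale `∑_{t < T} w_t z_t`, the right-hand side of the normal equations. -/
noncomputable def noiseSum (ω : Ω) : Vec d := ∑ t ∈ Finset.range T, X.noise θ t ω • X.z t ω

lemma noiseSum_succ (ω : Ω) :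
    X.noiseSum θ (T + 1) ω = X.noiseSum θ T ω + X.noise θ T ω • X.z T ω :=
  Finset.sum_range_succ _ _

lemma inner_noiseSum (ω : Ω) :
    inner ℝ v (X.noiseSum θ T ω)
      = ∑ t ∈ Finset.range T, inner ℝ v (X.z t ω) * X.noise θ t ω := by
  simp only [noiseSum, inner_sum, inner_smul_right, mul_comm]

lemma cov_eq_sum_vecMulVec (ω : Ω) :
    X.cov T ω = ∑ t : Fin T, Matrix.vecMulVec (X.z t ω) (X.z t ω) := by
  ext i j
  simp [cov, Matrix.sum_apply, Matrix.vecMulVec_apply, Finset.sum_range]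

lemma inner_op_cov (ω : Ω) :
    inner ℝ x (op (X.cov T ω) y)
      = ∑ t ∈ Finset.range T, inner ℝ x (X.z t ω) * inner ℝ y (X.z t ω) := by
  simp only [cov_eq_sum_vecMulVec, inner_op_sum_vecMulVec, Finset.sum_range, real_inner_comm]

lemma inner_op_cov_self (ω : Ω) :
    inner ℝ x (op (X.cov T ω) x) = ∑ t ∈ Finset.range T, inner ℝ x (X.z t ω) ^ 2 := by
  simp only [inner_op_cov, sq]

lemma inner_op_cov_self_nonneg (ω : Ω) : 0 ≤ inner ℝ x (op (X.cov T ω) x) := by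
  rw [inner_op_cov_self]
  positivity

lemma inner_op_cov_self_succ (ω : Ω) :
    inner ℝ x (op (X.cov (T + 1) ω) x)
      = inner ℝ x (op (X.cov T ω) x) + inner ℝ x (X.z T ω) ^ 2 := by
  simp only [inner_op_cov_self, Finset.sum_range_succ]

lemma measurable_z : Measurable (X.z t) := (X.z_meas t).mono (X.ℱ.le t) le_rfl

lemma measurable_noise_succ : Measurable[X.ℱ (t + 1)] (X.noise θ t) := by
  have hz : Measurable[X.ℱ (t + 1)] (X.z t) := (X.z_meas t).mono (X.ℱ.mono t.le_succ) le_rfl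
  have hy := X.y_meas t
  unfold noise
  fun_prop

lemma measurable_noise : Measurable (X.noise θ t) :=
  (X.measurable_noise_succ θ t).mono (X.ℱ.le _) le_rfl

lemma measurable_traj : Measurable[X.ℱ t] (X.traj t) := by
  refine @measurable_pi_lambda Ω (Fin t) _ (X.ℱ t) _ _ fun s => ?_
  have hu := (X.u_meas s).mono (X.ℱ.mono s.2.le) le_rfl
  have hz := (X.z_meas s).mono (X.ℱ.mono s.2.le) le_rfl
  have hy := (X.y_meas s).mono (X.ℱ.mono s.2) le_rfl
  exact hu.prodMk (hz.prodMk hy)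

lemma measurable_noiseSum : Measurable[X.ℱ T] (X.noiseSum θ T) := by
  refine Finset.measurable_sum _ fun t ht => ?_
  have ht := Finset.mem_range.1 ht
  have hz : Measurable[X.ℱ T] (X.z t) := (X.z_meas t).mono (X.ℱ.mono ht.le) le_rfl
  have hw : Measurable[X.ℱ T] (X.noise θ t) :=
    (X.measurable_noise_succ θ t).mono (X.ℱ.mono ht) le_rfl
  exact hw.smul hz

lemma measurable_inner_op_cov_self :
    Measurable[X.ℱ T] fun ω => inner ℝ x (op (X.cov T ω) x) := by
  simp only [inner_op_cov_self]
  refine Finset.measurable_sum _ fun t ht => ?_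
  have hz : Measurable[X.ℱ T] (X.z t) :=
    (X.z_meas t).mono (X.ℱ.mono (Finset.mem_range.1 ht).le) le_rfl
  fun_prop

end Basic

section MeanCovariance

variable {X : Observations Ω d dᵤ} {P : Measure Ω} {T : ℕ}

lemma isHermitian_meanCov (X : Observations Ω d dᵤ) (P : Measure Ω) (T : ℕ) :
    (X.meanCov P T).IsHermitian := by
  ext i j
  simp [meanCov, cov, mul_comm]

lemma integrable_cov (hz : ∀ t < T, MemLp (X.z t) 2 P) (i j : Fin d) :
    Integrable (fun ω => X.cov T ω i j) P := by
  simp only [cov, Matrix.of_apply]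
  refine integrable_finsetSum _ fun t ht => ?_
  have hcoord : ∀ i, MemLp (fun ω => X.z t ω i) 2 P := fun i =>
    (hz t (Finset.mem_range.1 ht)).mono
      (by have := X.measurable_z t; fun_prop : Measurable fun ω => X.z t ω i).aestronglyMeasurable
      (ae_of_all _ fun ω => PiLp.norm_apply_le _ i)
  exact (hcoord i).integrable_mul (hcoord j)

lemma integrable_inner_op_cov (hz : ∀ t < T, MemLp (X.z t) 2 P) (x y : Vec d) :
    Integrable (fun ω => inner ℝ x (op (X.cov T ω) y)) P := by
  simp only [inner_op_eq_sum]
  exact integrable_finsetSum _ fun i _ => integrable_finsetSum _ fun j _ =>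
    (integrable_cov hz i j).mul_const _

lemma inner_op_meanCov (hz : ∀ t < T, MemLp (X.z t) 2 P) (x y : Vec d) :
    inner ℝ x (op (X.meanCov P T) y) = ∫ ω, inner ℝ x (op (X.cov T ω) y) ∂P := by
  have hint : ∀ i j, Integrable (fun ω => X.cov T ω i j * (x i * y j)) P :=
    fun i j => (integrable_cov hz i j).mul_const _
  simp only [inner_op_eq_sum]
  rw [integral_finsetSum _ fun i _ => integrable_finsetSum _ fun j _ => hint i j]
  refine Finset.sum_congr rfl fun i _ => ?_
  rw [integral_finsetSum _ fun j _ => hint i j]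
  exact Finset.sum_congr rfl fun j _ => (integral_mul_const _ _).symm

lemma inner_op_meanCov_self_nonneg (hz : ∀ t < T, MemLp (X.z t) 2 P) (x : Vec d) :
    0 ≤ inner ℝ x (op (X.meanCov P T) x) := by
  rw [inner_op_meanCov hz]
  exact integral_nonneg fun ω => X.inner_op_cov_self_nonneg x T ω

end MeanCovariance

section Law

variable {X : Observations Ω d dᵤ} {σ : ℝ≥0} {θ : Vec d} {P : Measure Ω}

lemma IsLaw.lintegral_noise (h : X.IsLaw σ θ P) (t : ℕ) {β : Type*}
    [MeasurableSpace β] {Y : Ω → β} (hY : Measurable[X.ℱ t] Y) {F : β × ℝ → ℝ≥0∞}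
    (hF : Measurable F) :
    ∫⁻ ω, F (Y ω, X.noise θ t ω) ∂P = ∫⁻ ω, ∫⁻ w, F (Y ω, w) ∂(gaussianReal 0 (σ ^ 2)) ∂P := by
  have := h.prob
  have hY' : Measurable Y := hY.mono (X.ℱ.le t) le_rfl
  have hw := X.measurable_noise θ t
  have hind : IndepFun Y (X.noise θ t) P := by
    rw [IndepFun_iff_Indep]
    exact indep_of_indep_of_le_left (h.noise_indep t) hY.comap_le
  have hmap := (indepFun_iff_map_prod_eq_prod_map_map hY'.aemeasurable hw.aemeasurable).1 hind
  rw [h.noise_law t] at hmap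
  rw [← lintegral_map (f := F) (g := fun ω => (Y ω, X.noise θ t ω)) hF (hY'.prodMk hw), hmap,
    lintegral_prod _ hF.aemeasurable,
    lintegral_map (f := fun b => ∫⁻ w, F (b, w) ∂(gaussianReal 0 (σ ^ 2)))
      hF.lintegral_prod_right' hY']

lemma IsLaw.lintegral_exp (h : X.IsLaw σ θ P) (v : Vec d) (T : ℕ) :
    ∫⁻ ω, ENNReal.ofReal (Real.exp (inner ℝ v (X.noiseSum θ T ω)
      - σ ^ 2 / 2 * inner ℝ v (op (X.cov T ω) v))) ∂P = 1 := by
  have := h.prob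
  induction T with
  | zero => simp [noiseSum, inner_op_cov_self]
  | succ T ih =>
    have hS := X.measurable_noiseSum θ T
    have hQ := X.measurable_inner_op_cov_self v T
    have hz := X.z_meas T
    have hY : Measurable[X.ℱ T] fun ω => (inner ℝ v (X.noiseSum θ T ω)
          - σ ^ 2 / 2 * inner ℝ v (op (X.cov T ω) v), inner ℝ v (X.z T ω)) :=
      .prodMk (by fun_prop) (by fun_prop)
    have hstep := h.lintegral_noise T hY
      (F := fun p => ENNReal.ofReal
        (Real.exp (p.1.1 + (p.1.2 * p.2 - ((σ ^ 2 : ℝ≥0) : ℝ) / 2 * p.1.2 ^ 2)))) (by fun_prop)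
    simp only [Real.exp_add, ENNReal.ofReal_mul (Real.exp_pos _).le,
      lintegral_const_mul' _ _ ENNReal.ofReal_ne_top, lintegral_exp_gaussianReal, mul_one,
      ih] at hstep
    rw [← hstep]
    refine lintegral_congr fun ω => ?_
    rw [← ENNReal.ofReal_mul (Real.exp_pos _).le, ← Real.exp_add, noiseSum_succ,
      inner_op_cov_self_succ, inner_add_right, inner_smul_right]
    push_cast
    ring_nf

-- The increments of the martingale are orthogonal.
lemma IsLaw.lintegral_sq (h : X.IsLaw σ θ P) (v : Vec d) (c : ℝ) (T : ℕ) :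
    ∫⁻ ω, ENNReal.ofReal ((c + inner ℝ v (X.noiseSum θ T ω)) ^ 2) ∂P
      = ENNReal.ofReal (c ^ 2) + ENNReal.ofReal (σ ^ 2) *
        ∫⁻ ω, ENNReal.ofReal (inner ℝ v (op (X.cov T ω) v)) ∂P := by
  have := h.prob
  induction T with
  | zero => simp [noiseSum, inner_op_cov_self]
  | succ T ih =>
    have hS := X.measurable_noiseSum θ T
    have hz := X.z_meas T
    have hz' := X.measurable_z T
    have hY : Measurable[X.ℱ T] fun ω =>
        (c + inner ℝ v (X.noiseSum θ T ω), inner ℝ v (X.z T ω)) :=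
      .prodMk (by fun_prop) (by fun_prop)
    have hstep := h.lintegral_noise T hY
      (F := fun p => ENNReal.ofReal ((p.1.1 + p.1.2 * p.2) ^ 2)) (by fun_prop)
    simp only [noiseSum_succ, inner_add_right, inner_smul_right, ← add_assoc,
      inner_op_cov_self_succ, mul_comm (X.noise θ T _)]
    rw [hstep]
    simp_rw [lintegral_sq_gaussianReal, ENNReal.ofReal_add (X.inner_op_cov_self_nonneg v T _)
      (sq_nonneg _), ENNReal.ofReal_mul (NNReal.coe_nonneg (σ ^ 2))]
    rw [lintegral_add_right _ (by fun_prop), lintegral_add_right _ (by fun_prop), ih,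
      lintegral_const_mul' _ _ (by simp), mul_add, add_assoc, NNReal.coe_pow]

end Law

end Observations

/-! ### Deviations of sub-Gaussian vectors -/

section Tails

variable {Ω E F : Type*} [MeasurableSpace Ω] {P : Measure Ω}
  [NormedAddCommGroup E] [InnerProductSpace ℝ E] [FiniteDimensional ℝ E] [MeasurableSpace E]
  [BorelSpace E] [NormedAddCommGroup F] [InnerProductSpace ℝ F] [FiniteDimensional ℝ F]
  [MeasurableSpace F] [BorelSpace F]

lemma measure_le_exp_neg {f : Ω → ℝ≥0∞} (hf : AEMeasurable f P) {K : ℝ≥0∞}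
    (hK : ∫⁻ ω, f ω ∂P ≤ K) (hK₀ : K ≠ 0) (hK_top : K ≠ ∞) (ℓ : ℝ) {A : Set Ω}
    (hA : ∀ ω ∈ A, K * ENNReal.ofReal (Real.exp ℓ) ≤ f ω) :
    P A ≤ ENNReal.ofReal (Real.exp (-ℓ)) := by
  have hmarkov : K * (ENNReal.ofReal (Real.exp ℓ) * P A) ≤ K * 1 := by
    rw [mul_one, ← mul_assoc]
    exact (mul_le_mul_right (measure_mono hA) _).trans
      ((mul_meas_ge_le_lintegral₀ hf (K * ENNReal.ofReal (Real.exp ℓ))).trans hK)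
  rw [Real.exp_neg, ENNReal.ofReal_inv_of_pos (Real.exp_pos _), ENNReal.le_inv_iff_mul_le, mul_comm]
  exact (ENNReal.mul_le_mul_iff_right hK₀ hK_top).1 hmarkov

lemma measure_lt_le_of_forall_gt {f : Ω → ℝ} {p : Ω → Prop} {c : ℝ} {K : ℝ≥0∞}
    (h : ∀ c' > c, P {ω | p ω ∧ c' ≤ f ω} ≤ K) : P {ω | p ω ∧ c < f ω} ≤ K := by
  obtain ⟨u, hu, huc, hlim⟩ := exists_seq_strictAnti_tendsto c
  have hunion : {ω | p ω ∧ c < f ω} = ⋃ n, {ω | p ω ∧ u n ≤ f ω} := by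
    ext ω
    simp only [Set.mem_ofPred_eq, Set.mem_iUnion]
    refine ⟨fun ⟨hp, hc⟩ => ?_, fun ⟨n, hp, hn⟩ => ⟨hp, (huc n).trans_le hn⟩⟩
    obtain ⟨n, hn⟩ := (hlim.eventually_lt_const hc).exists
    exact ⟨n, hp, hn.le⟩
  have hmono : Monotone fun n => {ω | p ω ∧ u n ≤ f ω} :=
    fun m n hmn ω hω => ⟨hω.1, (hu.antitone hmn).trans hω.2⟩
  rw [hunion, hmono.measure_iUnion]
  exact iSup_le fun n => h _ (huc n)

lemma lintegral_exp_inner_sub_mul_sq_norm {b : ℝ} (hb : 0 < b) (w : E) :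
    ∫⁻ v : E, ENNReal.ofReal (Real.exp (inner ℝ v w - b * ‖v‖ ^ 2))
      = ENNReal.ofReal ((Real.pi / b) ^ (Module.finrank ℝ E / 2 : ℝ)
          * Real.exp (‖w‖ ^ 2 / (4 * b))) := by
  have hcentred : ∫⁻ v : E, ENNReal.ofReal (Real.exp (-b * ‖v‖ ^ 2))
      = ENNReal.ofReal ((Real.pi / b) ^ (Module.finrank ℝ E / 2 : ℝ)) := by
    have hval := GaussianFourier.integral_rexp_neg_mul_sq_norm (V := E) hb
    have hint : Integrable fun v : E => Real.exp (-b * ‖v‖ ^ 2) := by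
      refine not_imp_comm.1 integral_undef (ne_of_gt ?_)
      rw [hval]
      positivity
    rw [← ofReal_integral_eq_lintegral_ofReal hint (ae_of_all _ fun _ => (Real.exp_pos _).le), hval]
  rw [ENNReal.ofReal_mul (by positivity), ← hcentred,
    ← lintegral_sub_right_eq_self (fun v : E => ENNReal.ofReal (Real.exp (-b * ‖v‖ ^ 2)))
      ((2 * b)⁻¹ • w), ← lintegral_mul_const' _ _ ENNReal.ofReal_ne_top]
  refine lintegral_congr fun v => ?_
  rw [← ENNReal.ofReal_mul (Real.exp_pos _).le, ← Real.exp_add, norm_sub_sq_real,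
    real_inner_smul_right, norm_smul, mul_pow, Real.norm_eq_abs, sq_abs]
  congr 2
  field_simp
  ring

lemma mul_two_rpow_half_le {a s : ℝ} (ha : 0 ≤ a) (hs : 0 ≤ s) :
    (a * 2) ^ (s / 2) ≤ a ^ (s / 2) * Real.exp s := by
  have hexp : Real.exp s = Real.exp 2 ^ (s / 2) := by rw [← Real.exp_mul]; congr 1; ring
  rw [hexp, ← Real.mul_rpow ha (Real.exp_pos _).le]
  gcongr
  linarith [Real.add_one_le_exp (2 : ℝ)]

/-- The vector `N` is sub-Gaussian relative to the random quadratic form `Q`, its variance proxy,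
which may depend on `N`: this is the canonical assumption of the theory of self-normalized
processes. The form `Q ω` is encoded as a function that is homogeneous of degree two. -/
structure IsSubgaussianPair (N : Ω → E) (Q : Ω → E → ℝ) (P : Measure Ω) : Prop where
  measurable_left : Measurable N
  measurable_right : Measurable (Function.uncurry Q)
  map_smul : ∀ ω (c : ℝ) v, Q ω (c • v) = c ^ 2 * Q ω v
  lintegral_exp_le :
    ∀ v, ∫⁻ ω, ENNReal.ofReal (Real.exp (inner ℝ v (N ω) - Q ω v / 2)) ∂P ≤ 1

namespace IsSubgaussianPair

variable {N : Ω → E} {Q : Ω → E → ℝ} {b ℓ : ℝ}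

lemma comp_clm (h : IsSubgaussianPair N Q P) (W : F →L[ℝ] E) :
    IsSubgaussianPair (fun ω => W.adjoint (N ω)) (fun ω v => Q ω (W v)) P where
  measurable_left := W.adjoint.measurable.comp h.measurable_left
  measurable_right := h.measurable_right.comp
    (measurable_fst.prodMk (W.measurable.comp measurable_snd))
  map_smul ω c v := by rw [W.map_smul, h.map_smul]
  lintegral_exp_le v := by
    simp only [ContinuousLinearMap.adjoint_inner_right]
    exact h.lintegral_exp_le (W v)

lemma measurable_exp (h : IsSubgaussianPair N Q P) : Measurable fun p : Ω × E =>
    ENNReal.ofReal (Real.exp (inner ℝ p.2 (N p.1) - Q p.1 p.2 / 2)) := by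
  have hN := h.measurable_left
  have hQ : Measurable fun p : Ω × E => Q p.1 p.2 := h.measurable_right
  fun_prop

lemma measure_two_mul_le_inner (h : IsSubgaussianPair N Q P) {v : E} (hv : b ≤ 2 * ℓ) :
    P {ω | Q ω v ≤ b ∧ 2 * ℓ ≤ inner ℝ v (N ω)} ≤ ENNReal.ofReal (Real.exp (-ℓ)) := by
  refine measure_le_exp_neg (h.measurable_exp.comp (measurable_id.prodMk
    measurable_const)).aemeasurable (h.lintegral_exp_le v) one_ne_zero ENNReal.one_ne_top ℓ ?_
  rintro ω ⟨hQ, hN⟩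
  rw [one_mul]
  refine ENNReal.ofReal_le_ofReal (Real.exp_le_exp.2 ?_)
  simp only [id]
  linarith

lemma measure_lt_inner_sq_le (h : IsSubgaussianPair N Q P) (v : E) (hb : 0 ≤ b) (hℓ : 0 < ℓ) :
    P {ω | Q ω v ≤ b ∧ 2 * b * ℓ < inner ℝ v (N ω) ^ 2}
      ≤ 2 * ENNReal.ofReal (Real.exp (-ℓ)) := by
  refine measure_lt_le_of_forall_gt fun c hc => ?_
  have hc₀ : 0 < c := hc.trans_le' (by positivity)
  set s := 2 * ℓ / √c with hs
  have hs_sq : s ^ 2 * b ≤ 2 * ℓ := by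
    rw [hs, div_pow, Real.sq_sqrt hc₀.le, div_mul_eq_mul_div, div_le_iff₀ hc₀]
    nlinarith
  have hside : ∀ e : ℝ, P {ω | Q ω ((s * e) • v) ≤ s ^ 2 * b
      ∧ 2 * ℓ ≤ inner ℝ ((s * e) • v) (N ω)} ≤ ENNReal.ofReal (Real.exp (-ℓ)) :=
    fun e => h.measure_two_mul_le_inner hs_sq
  rw [two_mul]
  refine (measure_mono ?_).trans ((measure_union_le _ _).trans
    (add_le_add (hside 1) (hside (-1))))
  rintro ω ⟨hQ, hN⟩
  have hQ' : ∀ e : ℝ, e ^ 2 = 1 → Q ω ((s * e) • v) ≤ s ^ 2 * b := fun e he => by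
    rw [h.map_smul, mul_pow, he, mul_one]
    gcongr
  have hlarge : 2 * ℓ ≤ s * |inner ℝ v (N ω)| := by
    rw [hs, div_mul_eq_mul_div, le_div_iff₀ (Real.sqrt_pos.2 hc₀)]
    gcongr
    exact Real.sqrt_le_iff.2 ⟨abs_nonneg _, by rwa [sq_abs]⟩
  rcases abs_cases (inner ℝ v (N ω)) with ⟨habs, _⟩ | ⟨habs, _⟩
  · exact Or.inl ⟨hQ' 1 (by norm_num), by rw [real_inner_smul_left, mul_one, ← habs]; exact hlarge⟩
  · refine Or.inr ⟨hQ' (-1) (by norm_num), ?_⟩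
    rw [real_inner_smul_left]
    rw [habs] at hlarge
    linarith

lemma lintegral_lintegral_exp_le [SFinite P] (h : IsSubgaussianPair N Q P) (ν : Measure E)
    [SFinite ν] :
    ∫⁻ ω, ∫⁻ v, ENNReal.ofReal (Real.exp (inner ℝ v (N ω) - Q ω v / 2)) ∂ν ∂P
      ≤ ν Set.univ := by
  rw [lintegral_lintegral_swap h.measurable_exp.aemeasurable]
  exact (lintegral_mono h.lintegral_exp_le).trans_eq (by simp)

-- The method of mixtures, with the centred Gaussian prior of variance `1 / b`.
lemma measure_le_norm_sq_le [SFinite P] (h : IsSubgaussianPair N Q P) (hb : 0 < b) :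
    P {ω | (∀ v, Q ω v ≤ b * ‖v‖ ^ 2) ∧ 4 * b * (Module.finrank ℝ E + ℓ) ≤ ‖N ω‖ ^ 2}
      ≤ ENNReal.ofReal (Real.exp (-ℓ)) := by
  set n := (Module.finrank ℝ E : ℝ)
  have hprior : Measurable fun v : E => ENNReal.ofReal (Real.exp (-(b / 2 * ‖v‖ ^ 2))) := by
    fun_prop
  set ν : Measure E := volume.withDensity
    fun v => ENNReal.ofReal (Real.exp (-(b / 2 * ‖v‖ ^ 2))) with hν
  have hν_univ : ν Set.univ = ENNReal.ofReal ((Real.pi / (b / 2)) ^ (n / 2)) := by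
    rw [hν, withDensity_apply _ .univ, Measure.restrict_univ]
    simpa using lintegral_exp_inner_sub_mul_sq_norm (half_pos hb) (0 : E)
  refine measure_le_exp_neg h.measurable_exp.lintegral_prod_right'.aemeasurable
    (h.lintegral_lintegral_exp_le ν) ?_ (hν_univ ▸ ENNReal.ofReal_ne_top) ℓ ?_
  · rw [hν_univ, ne_eq, ENNReal.ofReal_eq_zero, not_le]
    positivity
  rintro ω ⟨hQ, hN⟩
  have hmix : ENNReal.ofReal ((Real.pi / b) ^ (n / 2) * Real.exp (‖N ω‖ ^ 2 / (4 * b)))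
      ≤ ∫⁻ v, ENNReal.ofReal (Real.exp (inner ℝ v (N ω) - Q ω v / 2)) ∂ν := by
    have hdensity := lintegral_withDensity_eq_lintegral_mul (volume : Measure E) hprior
      (g := fun v => ENNReal.ofReal (Real.exp (inner ℝ v (N ω) - Q ω v / 2)))
      (h.measurable_exp.comp measurable_prodMk_left)
    rw [← lintegral_exp_inner_sub_mul_sq_norm hb, hν, hdensity]
    refine lintegral_mono fun v => ?_
    simp only [Pi.mul_apply]
    rw [← ENNReal.ofReal_mul (Real.exp_pos _).le, ← Real.exp_add]
    refine ENNReal.ofReal_le_ofReal (Real.exp_le_exp.2 ?_)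
    linarith [hQ v]
  refine le_trans ?_ hmix
  rw [hν_univ, ← ENNReal.ofReal_mul (by positivity)]
  refine ENNReal.ofReal_le_ofReal ?_
  calc (Real.pi / (b / 2)) ^ (n / 2) * Real.exp ℓ
      = (Real.pi / b * 2) ^ (n / 2) * Real.exp ℓ := by congr 2; field_simp
    _ ≤ (Real.pi / b) ^ (n / 2) * Real.exp n * Real.exp ℓ := by
      gcongr
      exact mul_two_rpow_half_le (by positivity) (by positivity)
    _ = (Real.pi / b) ^ (n / 2) * Real.exp (n + ℓ) := by rw [mul_assoc, ← Real.exp_add]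
    _ ≤ _ := by
      gcongr
      rw [le_div_iff₀ (by positivity)]
      linarith

lemma measure_lt_norm_sq_le [SFinite P] (h : IsSubgaussianPair N Q P) (hb : 0 ≤ b) (hℓ : 0 < ℓ) :
    P {ω | (∀ v, Q ω v ≤ b * ‖v‖ ^ 2) ∧ 4 * b * (Module.finrank ℝ E + ℓ) < ‖N ω‖ ^ 2}
      ≤ ENNReal.ofReal (Real.exp (-ℓ)) := by
  refine measure_lt_le_of_forall_gt fun c hc => ?_
  set n := (Module.finrank ℝ E : ℝ)
  have hn : 0 < n + ℓ := by positivity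
  have hbc : b < c / (4 * (n + ℓ)) := by
    rw [lt_div_iff₀ (by positivity)]
    linarith
  refine (measure_mono ?_).trans (h.measure_le_norm_sq_le (ℓ := ℓ) (hb.trans_lt hbc))
  rintro ω ⟨hQ, hN⟩
  refine ⟨fun v => (hQ v).trans (by gcongr), hN.trans_eq' ?_⟩
  change c = 4 * (c / (4 * (n + ℓ))) * (n + ℓ)
  field_simp

lemma measure_lt_inner_op_inv_le {ι : Type*} [Fintype ι] [DecidableEq ι] [SFinite P]
    {N : Ω → EuclideanSpace ℝ ι} {Q : Ω → EuclideanSpace ℝ ι → ℝ} (h : IsSubgaussianPair N Q P)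
    {M : Matrix ι ι ℝ} (hM : M.PosDef) (hb : 0 ≤ b) (hℓ : 0 < ℓ) :
    P {ω | (∀ v, Q ω v ≤ b * inner ℝ v (op M v)) ∧
        4 * b * (Fintype.card ι + ℓ) < inner ℝ (N ω) (op M⁻¹ (N ω))}
      ≤ ENNReal.ofReal (Real.exp (-ℓ)) := by
  obtain ⟨W, hWM, hW⟩ := exists_whitening hM
  refine (measure_mono ?_).trans ((h.comp_clm W).measure_lt_norm_sq_le hb hℓ)
  rintro ω ⟨hQ, hN⟩
  refine ⟨fun v => hWM v ▸ hQ (W v), ?_⟩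
  rwa [finrank_euclideanSpace, hW]

end IsSubgaussianPair

end Tails

/-! ### Least squares and the plug-in error -/

section LeastSquares

variable {d : ℕ}

lemma IsLeastSquares.op_cov_sub_eq_noiseSum {Ω : Type*} [MeasurableSpace Ω] {dᵤ T : ℕ}
    {θhat : Traj d dᵤ T → Vec d} (h : IsLeastSquares θhat) (X : Observations Ω d dᵤ) (θ : Vec d)
    (ω : Ω) : op (X.cov T ω) (θhat (X.traj T ω) - θ) = X.noiseSum θ T ω := by
  set τ := X.traj T ω
  have hloss : ∀ θ, ∑ t, ((τ t).2.2 - inner ℝ θ (τ t).2.1) ^ 2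
      = ∑ t ∈ Finset.range T, (X.y t ω - inner ℝ θ (X.z t ω)) ^ 2 := fun θ =>
    (Finset.sum_range fun t => (X.y t ω - inner ℝ θ (X.z t ω)) ^ 2).symm
  refine ext_inner_left ℝ fun x => ?_
  set p := ∑ t ∈ Finset.range T, (X.y t ω - inner ℝ (θhat τ) (X.z t ω)) * inner ℝ x (X.z t ω)
    with hp
  have hmin : ∀ s : ℝ, 0 ≤ (∑ t ∈ Finset.range T, inner ℝ x (X.z t ω) ^ 2) * (s * s)
      + -2 * p * s + 0 := fun s => by
    have hs := h τ (θhat τ + s • x)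
    rw [hloss, hloss, ← sub_nonneg, ← Finset.sum_sub_distrib] at hs
    refine hs.trans_eq ?_
    rw [hp, Finset.sum_mul, Finset.mul_sum, Finset.sum_mul, ← Finset.sum_add_distrib, add_zero]
    refine Finset.sum_congr rfl fun t _ => ?_
    rw [inner_add_left, real_inner_smul_left]
    ring
  have hzero : p = 0 := by
    have hdiscrim := discrim_le_zero hmin
    rw [discrim] at hdiscrim
    nlinarith
  rw [X.inner_op_cov, X.inner_noiseSum, ← sub_eq_zero, ← Finset.sum_sub_distrib, ← neg_eq_zero,
    ← hzero, hp, ← Finset.sum_neg_distrib]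
  refine Finset.sum_congr rfl fun t _ => ?_
  rw [inner_sub_left, Observations.noise]
  ring

section Concentrated

variable {M E : Matrix (Fin d) (Fin d) ℝ} {ε : ℝ}

lemma abs_inner_op_sub_inner_op_le (hcon : opNorm (M - E) ≤ ε * lamMin E) (hε : 0 ≤ ε)
    (x : Vec d) : |inner ℝ x (op M x) - inner ℝ x (op E x)| ≤ ε * inner ℝ x (op E x) := by
  have h := abs_inner_op_le (M - E) x x
  rw [op_sub_apply, inner_sub_right, ← sq] at h
  calc |inner ℝ x (op M x) - inner ℝ x (op E x)| ≤ opNorm (M - E) * ‖x‖ ^ 2 := h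
    _ ≤ ε * lamMin E * ‖x‖ ^ 2 := by gcongr
    _ ≤ ε * inner ℝ x (op E x) := by
      rw [mul_assoc]
      gcongr
      exact lamMin_mul_le E x

lemma inner_op_le_one_add_mul_inner_op (hcon : opNorm (M - E) ≤ ε * lamMin E) (hε : 0 ≤ ε)
    (x : Vec d) : inner ℝ x (op M x) ≤ (1 + ε) * inner ℝ x (op E x) := by
  linarith [(abs_le.1 (abs_inner_op_sub_inner_op_le hcon hε x)).2]

lemma inner_op_le_inner_op_inv (hE : E.PosDef) (hcon : opNorm (M - E) ≤ ε * lamMin E)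
    (hε : 0 ≤ ε) (hε' : ε ≤ 1 / 4) (x : Vec d) :
    inner ℝ x (op M x) ≤ 4 / 3 * inner ℝ (op M x) (op E⁻¹ (op M x)) := by
  have hclose := (abs_le.1 (abs_inner_op_sub_inner_op_le hcon hε x)).1
  have hyoung := two_mul_inner_le_inner_op_add_inner_op_inv hE x ((4 / 3 : ℝ) • op M x)
  have hpos := inner_op_nonneg hE.posSemidef x
  rw [map_smul, inner_smul_right, inner_smul_right, real_inner_smul_left] at hyoung
  nlinarith

lemma norm_op_inv_op_sub_le (hE : E.PosDef) (hlam : 0 < lamMin E)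
    (hcon : opNorm (M - E) ≤ ε * lamMin E) (x : Vec d) :
    ‖op E⁻¹ (op M x) - x‖ ≤ ε * ‖x‖ := by
  set y := op E⁻¹ (op M x) - x with hy
  have hEy : op E y = op (M - E) x := by
    rw [hy, map_sub, op_op_inv hE.det_pos.ne'.isUnit, op_sub_apply]
  have h : lamMin E * ‖y‖ ^ 2 ≤ ε * lamMin E * (‖y‖ * ‖x‖) :=
    calc lamMin E * ‖y‖ ^ 2 ≤ inner ℝ y (op (M - E) x) := hEy ▸ lamMin_mul_le E y
      _ ≤ opNorm (M - E) * (‖y‖ * ‖x‖) := (le_abs_self _).trans (abs_inner_op_le _ _ _)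
      _ ≤ ε * lamMin E * (‖y‖ * ‖x‖) := by gcongr
  rcases (norm_nonneg y).eq_or_lt with hy₀ | hy₀
  · have hε : 0 ≤ ε := nonneg_of_mul_nonneg_left ((norm_nonneg _).trans hcon) hlam
    rw [← hy₀]
    positivity
  · refine le_of_mul_le_mul_left ?_ (mul_pos hlam hy₀)
    linarith

lemma inner_op_sum_vecMulVec_le_plugin (hE : E.PosDef) (hlam : 0 < lamMin E)
    (hcon : opNorm (M - E) ≤ ε * lamMin E) {ι : Type*} [Fintype ι] (k : ι → Vec d) (x : Vec d) :
    inner ℝ x (op (∑ i, Matrix.vecMulVec (k i) (k i)) x)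
      ≤ 2 * ∑ i, inner ℝ (op E⁻¹ (k i)) (op M x) ^ 2 + 2 * (∑ i, ‖k i‖ ^ 2) * (ε * ‖x‖) ^ 2 := by
  set y := op E⁻¹ (op M x) - x with hy
  have hterm : ∀ i, inner ℝ (k i) x * inner ℝ (k i) x
      ≤ 2 * inner ℝ (op E⁻¹ (k i)) (op M x) ^ 2 + 2 * (‖k i‖ ^ 2 * (ε * ‖x‖) ^ 2) := fun i => by
    have hsplit : inner ℝ (k i) x = inner ℝ (op E⁻¹ (k i)) (op M x) - inner ℝ (k i) y := by
      rw [← inner_op_comm hE.isHermitian.inv, hy, inner_sub_right]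
      ring
    have hbound : inner ℝ (k i) y ^ 2 ≤ ‖k i‖ ^ 2 * (ε * ‖x‖) ^ 2 := by
      rw [← sq_abs, ← mul_pow]
      gcongr
      exact (abs_real_inner_le_norm _ _).trans
        (mul_le_mul_of_nonneg_left (norm_op_inv_op_sub_le hE hlam hcon x) (norm_nonneg _))
    rw [hsplit]
    nlinarith [sq_nonneg (inner ℝ (op E⁻¹ (k i)) (op M x) + inner ℝ (k i) y)]
  rw [inner_op_sum_vecMulVec]
  refine (Finset.sum_le_sum fun i _ => hterm i).trans_eq ?_
  rw [Finset.sum_add_distrib, ← Finset.mul_sum, ← Finset.mul_sum, ← Finset.sum_mul, mul_assoc]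

end Concentrated

end LeastSquares

/-! ### Taylor expansions -/

section Taylor

lemma le_of_hasDerivAt_le {f f' B B' : ℝ → ℝ}
    (hf : ∀ s ∈ Set.Icc (0 : ℝ) 1, HasDerivAt f (f' s) s) (hB : ∀ s, HasDerivAt B (B' s) s)
    (h₀ : f 0 ≤ B 0) (h : ∀ s ∈ Set.Icc (0 : ℝ) 1, f' s ≤ B' s) {s : ℝ}
    (hs : s ∈ Set.Icc (0 : ℝ) 1) : f s ≤ B s :=
  image_le_of_deriv_right_le_deriv_boundary
    (fun s hs => (hf s hs).continuousAt.continuousWithinAt)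
    (fun s hs => (hf s (Set.Ico_subset_Icc_self hs)).hasDerivWithinAt) h₀
    (fun s _ => (hB s).continuousAt.continuousWithinAt)
    (fun s _ => (hB s).hasDerivWithinAt) (fun s hs => h s (Set.Ico_subset_Icc_self hs)) hs

lemma le_taylor_two {g g₁ g₂ g₃ : ℝ → ℝ} {C : ℝ}
    (h₀ : ∀ s ∈ Set.Icc (0 : ℝ) 1, HasDerivAt g (g₁ s) s)
    (h₁ : ∀ s ∈ Set.Icc (0 : ℝ) 1, HasDerivAt g₁ (g₂ s) s)
    (h₂ : ∀ s ∈ Set.Icc (0 : ℝ) 1, HasDerivAt g₂ (g₃ s) s)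
    (h₃ : ∀ s ∈ Set.Icc (0 : ℝ) 1, g₃ s ≤ C) :
    g 1 ≤ g 0 + g₁ 0 + g₂ 0 / 2 + C / 6 := by
  have hpow : ∀ (n : ℕ) (c s : ℝ), HasDerivAt (fun s => c * s ^ n) (c * (n * s ^ (n - 1))) s :=
    fun n c s => (hasDerivAt_pow n s).const_mul c
  have bound₂ : ∀ s ∈ Set.Icc (0 : ℝ) 1, g₂ s ≤ g₂ 0 + C * s ^ 1 := fun s =>
    le_of_hasDerivAt_le h₂ (fun s => (hpow 1 C s).const_add _) (by simp) (by simpa using h₃)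
  have bound₁ : ∀ s ∈ Set.Icc (0 : ℝ) 1, g₁ s ≤ g₁ 0 + (g₂ 0 * s ^ 1 + C / 2 * s ^ 2) := fun s =>
    le_of_hasDerivAt_le h₁ (fun s => ((hpow 1 _ s).add (hpow 2 _ s)).const_add _) (by simp)
      fun s hs => (bound₂ s hs).trans_eq (by simp; ring)
  have bound₀ : g 1 ≤ g 0 + (g₁ 0 * 1 ^ 1 + (g₂ 0 / 2 * 1 ^ 2 + C / 6 * 1 ^ 3)) :=
    le_of_hasDerivAt_le h₀
      (fun s => ((hpow 1 _ s).add ((hpow 2 _ s).add (hpow 3 _ s))).const_add _) (by simp)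
      (fun s hs => (bound₁ s hs).trans_eq (by simp; ring)) (Set.right_mem_Icc.2 zero_le_one)
  linarith

lemma nonneg_of_isLocalMin_of_hasDerivAt {g g₁ : ℝ → ℝ} {m : ℝ} (hmin : IsLocalMin g 0)
    (h₀ : ∀ᶠ s in nhds 0, HasDerivAt g (g₁ s) s) (h₁ : HasDerivAt g₁ m 0) : 0 ≤ m := by
  by_contra! hm
  have hderiv : deriv (-g) =ᶠ[nhds 0] -g₁ := h₀.mono fun s hs => hs.neg.deriv
  have hmax : IsLocalMin (-g) 0 := by
    refine isLocalMin_of_deriv_deriv_pos ?_ ?_ h₀.self_of_nhds.neg.continuousAt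
    · rw [hderiv.deriv_eq, h₁.neg.deriv]
      exact neg_pos.2 hm
    · rw [hderiv.self_of_nhds, Pi.neg_apply, hmin.hasDerivAt_eq_zero h₀.self_of_nhds, neg_zero]
  have hconst : g =ᶠ[nhds 0] fun _ => g 0 := by
    filter_upwards [hmax, hmin] with s hs hs'
    exact le_antisymm (neg_le_neg_iff.1 hs) hs'
  have hg₁ : g₁ =ᶠ[nhds 0] fun _ => 0 := by
    filter_upwards [h₀, hconst.eventuallyEq_nhds] with s hs hc
    rw [← hs.deriv, hc.deriv_eq, deriv_const]
  exact hm.ne (h₁.unique ((hasDerivAt_const 0 (0 : ℝ)).congr_of_eventuallyEq hg₁))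

end Taylor

section ThriceDifferentiable

set_option maxSynthPendingDepth 3

variable {E F : Type*} [NormedAddCommGroup E] [NormedSpace ℝ E]
  [NormedAddCommGroup F] [NormedSpace ℝ F] {f : E → F} {x v : E}

lemma norm_fderiv_fderiv (f : E → F) (x : E) :
    ‖fderiv ℝ (fderiv ℝ f) x‖ = ‖iteratedFDeriv ℝ 2 f x‖ := by
  rw [← norm_iteratedFDeriv_fderiv, norm_iteratedFDeriv_one]

lemma norm_fderiv_fderiv_fderiv (f : E → F) (x : E) :
    ‖fderiv ℝ (fderiv ℝ (fderiv ℝ f)) x‖ = ‖iteratedFDeriv ℝ 3 f x‖ := by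
  rw [← norm_iteratedFDeriv_fderiv, norm_fderiv_fderiv]

namespace ThriceDifferentiableAt

lemma differentiableAt (h : ThriceDifferentiableAt f x) : DifferentiableAt ℝ f x :=
  h.1.differentiableAt two_ne_zero

lemma differentiableAt_fderiv (h : ThriceDifferentiableAt f x) :
    DifferentiableAt ℝ (fderiv ℝ f) x :=
  (h.1.fderiv_right (m := 1) (by norm_num)).differentiableAt one_ne_zero

lemma differentiableAt_fderiv_fderiv (h : ThriceDifferentiableAt f x) :
    DifferentiableAt ℝ (fderiv ℝ (fderiv ℝ f)) x := by
  have h₂ := h.2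
  have succ_eq : ∀ n : ℕ, iteratedFDeriv ℝ (n + 1) f = _ := fun n =>
    funext fun x => iteratedFDeriv_succ_eq_comp_right
  have one_eq : iteratedFDeriv ℝ 1 (fderiv ℝ f) = _ :=
    funext fun x => iteratedFDeriv_succ_eq_comp_right
  rwa [succ_eq, LinearIsometryEquiv.comp_differentiableAt_iff, one_eq,
    LinearIsometryEquiv.comp_differentiableAt_iff, iteratedFDeriv_zero_eq_comp,
    LinearIsometryEquiv.comp_differentiableAt_iff] at h₂

lemma differentiableAt_iteratedFDeriv (h : ThriceDifferentiableAt f x) {n : ℕ} (hn : n ≤ 2) :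
    DifferentiableAt ℝ (iteratedFDeriv ℝ n f) x := by
  rcases hn.eq_or_lt with rfl | hn
  · exact h.2
  · exact h.1.differentiableAt_iteratedFDeriv (mod_cast hn)

end ThriceDifferentiableAt

lemma hasDerivAt_add_smul (x v : E) (s : ℝ) : HasDerivAt (fun s : ℝ => x + s • v) v s := by
  simpa using ((hasDerivAt_id s).smul_const v).const_add x

lemma ThriceDifferentiableAt.hasDerivAt_iteratedFDeriv_add_smul {n : ℕ} {s : ℝ}
    (h : ThriceDifferentiableAt f (x + s • v)) (hn : n ≤ 2) :
    HasDerivAt (fun s : ℝ => iteratedFDeriv ℝ n f (x + s • v) fun _ => v)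
      (iteratedFDeriv ℝ (n + 1) f (x + s • v) fun _ => v) s := by
  have hcurve := (h.differentiableAt_iteratedFDeriv hn).hasFDerivAt.comp_hasDerivAt s
    (hasDerivAt_add_smul x v s)
  exact (ContinuousMultilinearMap.apply ℝ (fun _ : Fin n => E) F
    fun _ => v).hasFDerivAt.comp_hasDerivAt s hcurve

lemma norm_iteratedFDeriv_apply_const_le {n : ℕ} {C : ℝ} (h : ‖iteratedFDeriv ℝ n f x‖ ≤ C)
    (v : E) : ‖iteratedFDeriv ℝ n f x fun _ => v‖ ≤ C * ‖v‖ ^ n := by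
  simpa using (iteratedFDeriv ℝ n f x).le_of_opNorm_le h fun _ => v

lemma norm_apply_const_le_of_unit {n : ℕ} [NeZero n]
    (M : ContinuousMultilinearMap ℝ (fun _ : Fin n => E) F) {C : ℝ}
    (h : ∀ v : E, ‖v‖ = 1 → ‖M fun _ => v‖ ≤ C) (v : E) : ‖M fun _ => v‖ ≤ C * ‖v‖ ^ n := by
  rcases eq_or_ne v 0 with rfl | hv
  · rw [M.map_coord_zero (0 : Fin n) rfl, norm_zero, norm_zero, zero_pow (NeZero.ne n), mul_zero]
  · have hv₀ : 0 < ‖v‖ := norm_pos_iff.2 hv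
    have hscale : (fun _ : Fin n => v) = fun _ => ‖v‖ • (‖v‖⁻¹ • v) := by
      rw [smul_inv_smul₀ hv₀.ne']
    rw [hscale, M.map_smul_univ, norm_smul, mul_comm]
    simp only [Finset.prod_const, Finset.card_univ, Fintype.card_fin, norm_pow, norm_norm]
    gcongr
    exact h _ (by simp [norm_smul, hv₀.ne'])

lemma le_fderiv_fderiv_of_growth {f : E → ℝ} {c : ℝ} (hf : ThriceDifferentiableAt f x)
    (hgrowth : ∀ y, f x + c / 2 * ‖y - x‖ ^ 2 ≤ f y) (v : E) :
    c * ‖v‖ ^ 2 ≤ fderiv ℝ (fderiv ℝ f) x v v := by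
  have hsq : ∀ s : ℝ, HasDerivAt (fun s => c / 2 * ‖v‖ ^ 2 * s ^ 2) (c * ‖v‖ ^ 2 * s) s :=
    fun s => ((hasDerivAt_pow 2 s).const_mul _).congr_deriv (by simp; ring)
  have hlin : HasDerivAt (fun s => c * ‖v‖ ^ 2 * s) (c * ‖v‖ ^ 2) 0 := by
    simpa using (hasDerivAt_id (0 : ℝ)).const_mul (c * ‖v‖ ^ 2)
  refine sub_nonneg.1 (nonneg_of_isLocalMin_of_hasDerivAt
    (g := fun s => f (x + s • v) - c / 2 * ‖v‖ ^ 2 * s ^ 2)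
    (g₁ := fun s => fderiv ℝ f (x + s • v) v - c * ‖v‖ ^ 2 * s) ?_ ?_ ?_)
  · refine .of_forall fun s => ?_
    have h := hgrowth (x + s • v)
    rw [add_sub_cancel_left, norm_smul, mul_pow, Real.norm_eq_abs, sq_abs] at h
    simp only [zero_smul, add_zero, ne_eq, OfNat.ofNat_ne_zero, not_false_eq_true, zero_pow,
      mul_zero, sub_zero]
    linarith
  · have hdiff : ∀ᶠ s : ℝ in nhds 0, DifferentiableAt ℝ f (x + s • v) := by
      have hcont : Filter.Tendsto (fun s : ℝ => x + s • v) (nhds 0) (nhds x) := by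
        simpa using (hasDerivAt_add_smul x v 0).continuousAt.tendsto
      exact hcont.eventually ((hf.1.eventually (by simp)).mono fun y hy =>
        hy.differentiableAt two_ne_zero)
    filter_upwards [hdiff] with s hs
    exact (hs.hasFDerivAt.comp_hasDerivAt s (hasDerivAt_add_smul x v s)).sub (hsq s)
  · have hfx : HasFDerivAt (fderiv ℝ f) (fderiv ℝ (fderiv ℝ f) x) (x + (0 : ℝ) • v) := by
      simpa using hf.differentiableAt_fderiv.hasFDerivAt
    have h₁ : HasDerivAt (fun s : ℝ => fderiv ℝ f (x + s • v)) (fderiv ℝ (fderiv ℝ f) x v) 0 :=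
      hfx.comp_hasDerivAt 0 (hasDerivAt_add_smul x v 0)
    have h₂ : HasDerivAt (fun s : ℝ => fderiv ℝ f (x + s • v) v)
        (fderiv ℝ (fderiv ℝ f) x v v) 0 := by
      simpa using h₁.clm_apply (hasDerivAt_const (0 : ℝ) v)
    exact h₂.sub hlin

lemma taylor_two_le_of_norm_iteratedFDeriv_le {f : E → ℝ} {K : Set E} (hK : Convex ℝ K) {L : ℝ}
    (hf : ∀ x ∈ K, ThriceDifferentiableAt f x) (hL : ∀ x ∈ K, ‖iteratedFDeriv ℝ 3 f x‖ ≤ L)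
    {y : E} (hx : x ∈ K) (hy : y ∈ K) :
    f x + fderiv ℝ f x (y - x) + (iteratedFDeriv ℝ 2 f x fun _ => y - x) / 2
      ≤ f y + L * ‖y - x‖ ^ 3 / 6 := by
  have hseg : ∀ s ∈ Set.Icc (0 : ℝ) 1, x + s • (y - x) ∈ K := fun s hs =>
    hK.add_smul_sub_mem hx hy hs
  have hderiv : ∀ n ≤ 2, ∀ s ∈ Set.Icc (0 : ℝ) 1,
      HasDerivAt (fun s : ℝ => -iteratedFDeriv ℝ n f (x + s • (y - x)) fun _ => y - x)
        (-iteratedFDeriv ℝ (n + 1) f (x + s • (y - x)) fun _ => y - x) s := fun n hn s hs =>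
    ((hf _ (hseg s hs)).hasDerivAt_iteratedFDeriv_add_smul hn).neg
  have htaylor := le_taylor_two
    (g₁ := fun s => -iteratedFDeriv ℝ 1 f (x + s • (y - x)) fun _ => y - x)
    (g₂ := fun s => -iteratedFDeriv ℝ 2 f (x + s • (y - x)) fun _ => y - x)
    (hderiv 0 (by norm_num)) (hderiv 1 (by norm_num)) (hderiv 2 le_rfl) fun s hs =>
      (neg_le_abs _).trans (norm_iteratedFDeriv_apply_const_le (hL _ (hseg s hs)) (y - x))
  simp only [iteratedFDeriv_zero_apply, iteratedFDeriv_one_apply, one_smul, zero_smul, add_zero,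
    add_sub_cancel] at htaylor
  linarith

section Curve

variable {f : F → ℝ} {c c₁ c₂ c₃ : ℝ → F} {s : ℝ}

lemma ThriceDifferentiableAt.hasDerivAt_fderiv_comp {w : ℝ → F} {w' : F}
    (hf : ThriceDifferentiableAt f (c s)) (h₀ : HasDerivAt c (c₁ s) s) (hw : HasDerivAt w w' s) :
    HasDerivAt (fun s => fderiv ℝ f (c s) (w s))
      (fderiv ℝ (fderiv ℝ f) (c s) (c₁ s) (w s) + fderiv ℝ f (c s) w') s :=
  (hf.differentiableAt_fderiv.hasFDerivAt.comp_hasDerivAt s h₀).clm_apply hw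

lemma ThriceDifferentiableAt.hasDerivAt_fderiv_fderiv_comp
    (hf : ThriceDifferentiableAt f (c s)) (h₀ : HasDerivAt c (c₁ s) s)
    (h₁ : HasDerivAt c₁ (c₂ s) s) :
    HasDerivAt (fun s => fderiv ℝ (fderiv ℝ f) (c s) (c₁ s) (c₁ s))
      ((fderiv ℝ (fderiv ℝ (fderiv ℝ f)) (c s) (c₁ s) (c₁ s)
        + fderiv ℝ (fderiv ℝ f) (c s) (c₂ s)) (c₁ s)
        + fderiv ℝ (fderiv ℝ f) (c s) (c₁ s) (c₂ s)) s :=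
  ((hf.differentiableAt_fderiv_fderiv.hasFDerivAt.comp_hasDerivAt s h₀).clm_apply h₁).clm_apply h₁

lemma third_deriv_comp_le {x v₁ v₂ v₃ : F} {B₁ B₂ B₃ A₁ A₂ A₃ : ℝ}
    (hB₁ : ‖iteratedFDeriv ℝ 1 f x‖ ≤ B₁) (hB₂ : ‖iteratedFDeriv ℝ 2 f x‖ ≤ B₂)
    (hB₃ : ‖iteratedFDeriv ℝ 3 f x‖ ≤ B₃) (hA₁ : ‖v₁‖ ≤ A₁) (hA₂ : ‖v₂‖ ≤ A₂) (hA₃ : ‖v₃‖ ≤ A₃) :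
    (fderiv ℝ (fderiv ℝ (fderiv ℝ f)) x v₁ v₁ + fderiv ℝ (fderiv ℝ f) x v₂) v₁
        + fderiv ℝ (fderiv ℝ f) x v₁ v₂ + (fderiv ℝ (fderiv ℝ f) x v₁ v₂ + fderiv ℝ f x v₃)
      ≤ B₃ * A₁ ^ 3 + 3 * B₂ * A₂ * A₁ + B₁ * A₃ := by
  rw [norm_iteratedFDeriv_one] at hB₁
  rw [← norm_fderiv_fderiv] at hB₂
  rw [← norm_fderiv_fderiv_fderiv] at hB₃
  have first : fderiv ℝ f x v₃ ≤ B₁ * A₃ :=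
    (le_abs_self _).trans ((fderiv ℝ f x).le_of_opNorm_le_of_le hB₁ hA₃)
  have second : fderiv ℝ (fderiv ℝ f) x v₁ v₂ ≤ B₂ * A₁ * A₂ :=
    (le_abs_self _).trans ((fderiv ℝ (fderiv ℝ f) x).le_of_opNorm₂_le_of_le hB₂ hA₁ hA₂)
  have second' : fderiv ℝ (fderiv ℝ f) x v₂ v₁ ≤ B₂ * A₂ * A₁ :=
    (le_abs_self _).trans ((fderiv ℝ (fderiv ℝ f) x).le_of_opNorm₂_le_of_le hB₂ hA₂ hA₁)
  have third : fderiv ℝ (fderiv ℝ (fderiv ℝ f)) x v₁ v₁ v₁ ≤ B₃ * A₁ * A₁ * A₁ :=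
    (le_abs_self _).trans ((fderiv ℝ (fderiv ℝ (fderiv ℝ f)) x v₁).le_of_opNorm₂_le_of_le
      (ContinuousLinearMap.le_of_opNorm_le_of_le _ hB₃ hA₁) hA₁ hA₁)
  rw [add_apply]
  linarith

lemma comp_le_taylor_two {B₁ B₂ B₃ A₁ A₂ A₃ : ℝ}
    (hf : ∀ s ∈ Set.Icc (0 : ℝ) 1, ThriceDifferentiableAt f (c s))
    (hB₁ : ∀ s ∈ Set.Icc (0 : ℝ) 1, ‖iteratedFDeriv ℝ 1 f (c s)‖ ≤ B₁)
    (hB₂ : ∀ s ∈ Set.Icc (0 : ℝ) 1, ‖iteratedFDeriv ℝ 2 f (c s)‖ ≤ B₂)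
    (hB₃ : ∀ s ∈ Set.Icc (0 : ℝ) 1, ‖iteratedFDeriv ℝ 3 f (c s)‖ ≤ B₃)
    (h₀ : ∀ s ∈ Set.Icc (0 : ℝ) 1, HasDerivAt c (c₁ s) s)
    (h₁ : ∀ s ∈ Set.Icc (0 : ℝ) 1, HasDerivAt c₁ (c₂ s) s)
    (h₂ : ∀ s ∈ Set.Icc (0 : ℝ) 1, HasDerivAt c₂ (c₃ s) s)
    (hA₁ : ∀ s ∈ Set.Icc (0 : ℝ) 1, ‖c₁ s‖ ≤ A₁) (hA₂ : ∀ s ∈ Set.Icc (0 : ℝ) 1, ‖c₂ s‖ ≤ A₂)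
    (hA₃ : ∀ s ∈ Set.Icc (0 : ℝ) 1, ‖c₃ s‖ ≤ A₃) :
    f (c 1) ≤ f (c 0) + fderiv ℝ f (c 0) (c₁ 0)
      + (fderiv ℝ (fderiv ℝ f) (c 0) (c₁ 0) (c₁ 0) + fderiv ℝ f (c 0) (c₂ 0)) / 2
      + (B₃ * A₁ ^ 3 + 3 * B₂ * A₂ * A₁ + B₁ * A₃) / 6 :=
  le_taylor_two (g := fun s => f (c s))
    (fun s hs => (hf s hs).differentiableAt.hasFDerivAt.comp_hasDerivAt s (h₀ s hs))
    (fun s hs => (hf s hs).hasDerivAt_fderiv_comp (h₀ s hs) (h₁ s hs))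
    (fun s hs => ((hf s hs).hasDerivAt_fderiv_fderiv_comp (h₀ s hs) (h₁ s hs)).add
      ((hf s hs).hasDerivAt_fderiv_comp (h₀ s hs) (h₂ s hs)))
    fun s hs => third_deriv_comp_le (hB₁ s hs) (hB₂ s hs) (hB₃ s hs) (hA₁ s hs) (hA₂ s hs)
      (hA₃ s hs)

end Curve

end ThriceDifferentiable

/-! ### Quadratic approximation of the excess risk -/

/-- The Hessian of the excess risk under `θ₀` at the optimal decision, as a bilinear form in the
decision. -/
noncomputable def riskHess {d dₐ : ℕ} (J : Vec d → Vec dₐ → ℝ) (aopt : Vec d → Vec dₐ)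
    (θ₀ : Vec d) : Vec dₐ →L[ℝ] Vec dₐ →L[ℝ] ℝ :=
  fderiv ℝ (fderiv ℝ fun a => excessRisk J a θ₀) (aopt θ₀)

/-- The constant of the cubic error in the local quadratic lower bound on the risk: the terms come
from linearizing `aopt`, from moving the Hessian of the risk from `aopt θ` to `aopt θ₀` and from
`θ` to `θ₀`, and from Taylor's theorem, on a ball of radius `3 * La1 * ρ`. -/
def SmoothConstants.Lcubic (S : SmoothConstants) : ℝ :=
  4 * S.La1 * S.La2 * S.LR2 + 19 * S.La1 ^ 3 * S.LR3 + 8 * S.La1 ^ 2 * S.Lhess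

namespace SmoothDecision

section

set_option maxSynthPendingDepth 3

variable {d dₐ : ℕ} {J : Vec d → Vec dₐ → ℝ} {aopt : Vec d → Vec dₐ} {θ₀ θ : Vec d}
  {S : SmoothConstants}

lemma norm_sub_self_le (h : SmoothDecision J aopt θ₀ S) : ‖θ₀ - θ₀‖ ≤ S.r := by
  simpa using h.r_pos.le

lemma La1_nonneg (h : SmoothDecision J aopt θ₀ S) : 0 ≤ S.La1 :=
  (norm_nonneg _).trans (h.opt_bound₁ θ₀ h.norm_sub_self_le)

lemma La2_nonneg (h : SmoothDecision J aopt θ₀ S) : 0 ≤ S.La2 :=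
  (norm_nonneg _).trans (h.opt_bound₂ θ₀ h.norm_sub_self_le)

lemma La3_nonneg (h : SmoothDecision J aopt θ₀ S) (hd : 1 ≤ d) : 0 ≤ S.La3 :=
  (norm_nonneg _).trans (h.opt_bound₃ θ₀ h.norm_sub_self_le
    (EuclideanSpace.single ⟨0, hd⟩ 1) (by simp))

lemma opt_mem (h : SmoothDecision J aopt θ₀ S) : ‖aopt θ₀ - aopt θ₀‖ ≤ S.La1 * S.r := by
  simpa using mul_nonneg h.La1_nonneg h.r_pos.le

lemma LR1_nonneg (h : SmoothDecision J aopt θ₀ S) : 0 ≤ S.LR1 :=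
  (norm_nonneg _).trans (h.risk_bound₁ θ₀ (aopt θ₀) h.norm_sub_self_le h.opt_mem)

lemma LR2_nonneg (h : SmoothDecision J aopt θ₀ S) : 0 ≤ S.LR2 :=
  (norm_nonneg _).trans (h.risk_bound₂ θ₀ (aopt θ₀) h.norm_sub_self_le h.opt_mem)

lemma LR3_nonneg (h : SmoothDecision J aopt θ₀ S) : 0 ≤ S.LR3 :=
  (norm_nonneg _).trans (h.risk_bound₃ θ₀ (aopt θ₀) h.norm_sub_self_le h.opt_mem)

lemma Lhess_nonneg (h : SmoothDecision J aopt θ₀ S) (hd : 1 ≤ d) : 0 ≤ S.Lhess := by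
  have hnorm : ‖θ₀ + EuclideanSpace.single (⟨0, hd⟩ : Fin d) S.r - θ₀‖ = S.r := by
    simp [abs_of_pos h.r_pos]
  have hlip := (norm_nonneg _).trans
    (h.hess_lipschitz _ θ₀ (aopt θ₀) hnorm.le h.norm_sub_self_le h.opt_mem)
  rw [hnorm] at hlip
  exact nonneg_of_mul_nonneg_left hlip h.r_pos

lemma Lquad_nonneg (h : SmoothDecision J aopt θ₀ S) (hd : 1 ≤ d) : 0 ≤ S.Lquad := by
  have hLR1 := h.LR1_nonneg
  have hLR2 := h.LR2_nonneg
  have hLR3 := h.LR3_nonneg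
  have hLa1 := h.La1_nonneg
  have hLa2 := h.La2_nonneg
  have hLa3 := h.La3_nonneg hd
  unfold SmoothConstants.Lquad
  positivity

lemma excessRisk_opt (h : SmoothDecision J aopt θ₀ S) (hθ : ‖θ - θ₀‖ ≤ S.r) :
    excessRisk J (aopt θ) θ = 0 := by
  have hle := h.optimal θ hθ
  have hinf : ⨅ a, J θ a = J θ (aopt θ) :=
    le_antisymm (ciInf_le ⟨_, by rintro _ ⟨a, rfl⟩; exact hle a⟩ _) (le_ciInf hle)
  rw [excessRisk, hinf, sub_self]

lemma excessRisk_nonneg (h : SmoothDecision J aopt θ₀ S) (hθ : ‖θ - θ₀‖ ≤ S.r) (a : Vec dₐ) :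
    0 ≤ excessRisk J a θ :=
  (mul_nonneg (half_pos h.μ_pos).le (sq_nonneg _)).trans (h.growth θ hθ a)

lemma fderiv_risk_opt (h : SmoothDecision J aopt θ₀ S) (hθ : ‖θ - θ₀‖ ≤ S.r) :
    fderiv ℝ (fun a => excessRisk J a θ) (aopt θ) = 0 :=
  IsLocalMin.fderiv_eq_zero (.of_forall fun a => by
    simpa [h.excessRisk_opt hθ] using h.excessRisk_nonneg hθ a)

lemma norm_fderiv_opt_le (h : SmoothDecision J aopt θ₀ S) (hθ : ‖θ - θ₀‖ ≤ S.r) :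
    ‖fderiv ℝ aopt θ‖ ≤ S.La1 := by
  rw [← norm_iteratedFDeriv_one]
  exact h.opt_bound₁ θ hθ

lemma norm_opt_sub_le (h : SmoothDecision J aopt θ₀ S) (hθ : ‖θ - θ₀‖ ≤ S.r) :
    ‖aopt θ - aopt θ₀‖ ≤ S.La1 * ‖θ - θ₀‖ :=
  (convex_closedBall θ₀ S.r).norm_image_sub_le_of_norm_fderiv_le (𝕜 := ℝ)
    (fun x hx => (h.opt_diff x (mem_closedBall_iff_norm.1 hx)).differentiableAt)
    (fun _ hx => h.norm_fderiv_opt_le (mem_closedBall_iff_norm.1 hx))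
    (Metric.mem_closedBall_self h.r_pos.le) (mem_closedBall_iff_norm.2 hθ)

lemma opt_mem_of_norm_sub_le (h : SmoothDecision J aopt θ₀ S) (hθ : ‖θ - θ₀‖ ≤ S.r) :
    ‖aopt θ - aopt θ₀‖ ≤ S.La1 * S.r :=
  (h.norm_opt_sub_le hθ).trans (mul_le_mul_of_nonneg_left hθ h.La1_nonneg)

lemma norm_opt_sub_linear_le (h : SmoothDecision J aopt θ₀ S) (hθ : ‖θ - θ₀‖ ≤ S.r) :
    ‖aopt θ - aopt θ₀ - fderiv ℝ aopt θ₀ (θ - θ₀)‖ ≤ S.La2 * ‖θ - θ₀‖ ^ 2 := by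
  have hball : ∀ x ∈ Metric.closedBall θ₀ ‖θ - θ₀‖, ‖x - θ₀‖ ≤ S.r := fun x hx =>
    (mem_closedBall_iff_norm.1 hx).trans hθ
  have hconv := convex_closedBall θ₀ ‖θ - θ₀‖
  have hcenter : θ₀ ∈ Metric.closedBall θ₀ ‖θ - θ₀‖ := Metric.mem_closedBall_self (norm_nonneg _)
  have hfderiv : ∀ x ∈ Metric.closedBall θ₀ ‖θ - θ₀‖,
      ‖fderiv ℝ aopt x - fderiv ℝ aopt θ₀‖ ≤ S.La2 * ‖θ - θ₀‖ := fun x hx =>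
    (hconv.norm_image_sub_le_of_norm_fderiv_le (𝕜 := ℝ)
      (fun y hy => (h.opt_diff y (hball y hy)).differentiableAt_fderiv)
      (fun y hy => (norm_fderiv_fderiv aopt y).trans_le (h.opt_bound₂ y (hball y hy)))
      hcenter hx).trans (mul_le_mul_of_nonneg_left (mem_closedBall_iff_norm.1 hx) h.La2_nonneg)
  rw [sq, ← mul_assoc]
  exact hconv.norm_image_sub_le_of_norm_fderiv_le' (𝕜 := ℝ)
    (fun x hx => (h.opt_diff x (hball x hx)).differentiableAt) hfderiv hcenter
    (mem_closedBall_iff_norm.2 le_rfl)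

lemma norm_riskHess_le (h : SmoothDecision J aopt θ₀ S) : ‖riskHess J aopt θ₀‖ ≤ S.LR2 :=
  (norm_fderiv_fderiv _ _).trans_le (h.risk_bound₂ θ₀ _ h.norm_sub_self_le h.opt_mem)

lemma riskHess_comm (h : SmoothDecision J aopt θ₀ S) (x y : Vec dₐ) :
    riskHess J aopt θ₀ x y = riskHess J aopt θ₀ y x :=
  ((h.risk_diff θ₀ _ h.norm_sub_self_le h.opt_mem).1.isSymmSndFDerivAt (by simp)).eq x y

lemma le_riskHess (h : SmoothDecision J aopt θ₀ S) (v : Vec dₐ) :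
    S.μ * ‖v‖ ^ 2 ≤ riskHess J aopt θ₀ v v :=
  le_fderiv_fderiv_of_growth (h.risk_diff θ₀ _ h.norm_sub_self_le h.opt_mem)
    (fun a => by simpa [h.excessRisk_opt h.norm_sub_self_le] using h.growth θ₀ h.norm_sub_self_le a)
    v

lemma riskHess_nonneg (h : SmoothDecision J aopt θ₀ S) (v : Vec dₐ) :
    0 ≤ riskHess J aopt θ₀ v v :=
  (mul_nonneg h.μ_pos.le (sq_nonneg _)).trans (h.le_riskHess v)

lemma taskHessian_apply (h : SmoothDecision J aopt θ₀ S) (i j : Fin d) :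
    taskHessian J aopt θ₀ i j
      = riskHess J aopt θ₀ (fderiv ℝ aopt θ₀ (EuclideanSpace.single i 1))
        (fderiv ℝ aopt θ₀ (EuclideanSpace.single j 1)) := by
  have hrisk := h.risk_diff θ₀ _ h.norm_sub_self_le h.opt_mem
  have hopt := h.opt_diff θ₀ h.norm_sub_self_le
  have chain : (fderiv ℝ fun θ => excessRisk J (aopt θ) θ₀) =ᶠ[nhds θ₀]
      fun θ => (fderiv ℝ (fun a => excessRisk J a θ₀) (aopt θ)).comp (fderiv ℝ aopt θ) := by
    filter_upwards [hopt.1.continuousAt.tendsto.eventually (hrisk.1.eventually (by simp)),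
      hopt.1.eventually (by simp)] with θ hriskθ hoptθ
    exact fderiv_comp (g := fun a => excessRisk J a θ₀) θ
      (hriskθ.differentiableAt two_ne_zero) (hoptθ.differentiableAt two_ne_zero)
  have hderiv : HasFDerivAt (fun θ =>
      (fderiv ℝ (fun a => excessRisk J a θ₀) (aopt θ)).comp (fderiv ℝ aopt θ)) _ θ₀ :=
    (hrisk.differentiableAt_fderiv.hasFDerivAt.comp θ₀
      hopt.differentiableAt.hasFDerivAt).clm_comp hopt.differentiableAt_fderiv.hasFDerivAt
  rw [taskHessian, Matrix.of_apply, iteratedFDeriv_two_apply, chain.fderiv_eq, hderiv.fderiv]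
  simp [h.fderiv_risk_opt h.norm_sub_self_le, riskHess]

lemma inner_op_taskHessian (h : SmoothDecision J aopt θ₀ S) (x y : Vec d) :
    inner ℝ x (op (taskHessian J aopt θ₀) y)
      = riskHess J aopt θ₀ (fderiv ℝ aopt θ₀ x) (fderiv ℝ aopt θ₀ y) := by
  have hbasis : ∀ x : Vec d, x = ∑ i, x i • EuclideanSpace.single i (1 : ℝ) := fun x => by
    simpa using ((EuclideanSpace.basisFun (Fin d) ℝ).sum_repr x).symm
  conv_rhs => rw [hbasis x, hbasis y]
  simp only [map_sum, map_smul, sum_apply, smul_apply, smul_eq_mul, inner_op_eq_sum,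
    h.taskHessian_apply, Finset.mul_sum]
  rw [Finset.sum_comm]
  exact Finset.sum_congr rfl fun i _ => Finset.sum_congr rfl fun j _ => by ring

lemma posSemidef_taskHessian (h : SmoothDecision J aopt θ₀ S) :
    (taskHessian J aopt θ₀).PosSemidef := by
  refine Matrix.PosSemidef.of_dotProduct_mulVec_nonneg ?_ fun x => ?_
  · ext i j
    simp [h.taskHessian_apply, h.riskHess_comm]
  · have hnonneg := h.riskHess_nonneg (fderiv ℝ aopt θ₀ (WithLp.toLp 2 x))
    rw [← h.inner_op_taskHessian, Matrix.inner_toEuclideanCLM] at hnonneg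
    simpa using hnonneg

lemma trace_taskHessian_le (h : SmoothDecision J aopt θ₀ S) :
    (taskHessian J aopt θ₀).trace ≤ d * (S.LR2 * S.La1 ^ 2) := by
  have hcol : ∀ i, ‖fderiv ℝ aopt θ₀ (EuclideanSpace.single i 1)‖ ≤ S.La1 := fun i => by
    simpa using (fderiv ℝ aopt θ₀).le_of_opNorm_le (h.norm_fderiv_opt_le h.norm_sub_self_le)
      (EuclideanSpace.single i (1 : ℝ))
  have hdiag : ∀ i, taskHessian J aopt θ₀ i i ≤ S.LR2 * S.La1 ^ 2 := fun i => by
    rw [h.taskHessian_apply, sq, ← mul_assoc]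
    exact (le_abs_self _).trans
      ((riskHess J aopt θ₀).le_of_opNorm₂_le_of_le h.norm_riskHess_le (hcol i) (hcol i))
  calc (taskHessian J aopt θ₀).trace ≤ ∑ _i : Fin d, S.LR2 * S.La1 ^ 2 :=
        Finset.sum_le_sum fun i _ => hdiag i
    _ = d * (S.LR2 * S.La1 ^ 2) := by simp

lemma excessRisk_plugin_le (h : SmoothDecision J aopt θ₀ S) (hθ : ‖θ - θ₀‖ ≤ S.r) :
    excessRisk J (aopt θ) θ₀ ≤ inner ℝ (θ - θ₀) (op (taskHessian J aopt θ₀) (θ - θ₀)) / 2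
      + S.Lquad * ‖θ - θ₀‖ ^ 3 := by
  set η := θ - θ₀ with hη
  have hball : ∀ s ∈ Set.Icc (0 : ℝ) 1, ‖θ₀ + s • η - θ₀‖ ≤ S.r := fun s hs => by
    rw [add_sub_cancel_left, norm_smul, Real.norm_of_nonneg hs.1]
    exact (mul_le_of_le_one_left (norm_nonneg _) hs.2).trans hθ
  have hmem := fun s hs => h.opt_mem_of_norm_sub_le (hball s hs)
  have hcurve := fun s hs (n : ℕ) (hn : n ≤ 2) =>
    (h.opt_diff _ (hball s hs)).hasDerivAt_iteratedFDeriv_add_smul (v := η) hn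
  have htaylor := comp_le_taylor_two (f := fun a => excessRisk J a θ₀)
    (c := fun s => aopt (θ₀ + s • η))
    (fun s hs => h.risk_diff θ₀ _ h.norm_sub_self_le (hmem s hs))
    (fun s hs => h.risk_bound₁ θ₀ _ h.norm_sub_self_le (hmem s hs))
    (fun s hs => h.risk_bound₂ θ₀ _ h.norm_sub_self_le (hmem s hs))
    (fun s hs => h.risk_bound₃ θ₀ _ h.norm_sub_self_le (hmem s hs))
    (fun s hs => by simpa using hcurve s hs 0 (by norm_num))
    (fun s hs => hcurve s hs 1 (by norm_num))
    (fun s hs => hcurve s hs 2 le_rfl)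
    (fun s hs => norm_iteratedFDeriv_apply_const_le (h.opt_bound₁ _ (hball s hs)) η)
    (fun s hs => norm_iteratedFDeriv_apply_const_le (h.opt_bound₂ _ (hball s hs)) η)
    (fun s hs => norm_apply_const_le_of_unit _ (h.opt_bound₃ _ (hball s hs)) η)
  simp only [zero_smul, add_zero, one_smul, hη, add_sub_cancel, zero_apply, zero_add,
    h.fderiv_risk_opt h.norm_sub_self_le, h.excessRisk_opt h.norm_sub_self_le,
    iteratedFDeriv_one_apply] at htaylor
  rw [h.inner_op_taskHessian, riskHess, SmoothConstants.Lquad]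
  linarith

lemma half_fderiv_fderiv_le_excessRisk (h : SmoothDecision J aopt θ₀ S)
    (hθ : ‖θ - θ₀‖ ≤ S.r) {a : Vec dₐ} (ha : ‖a - aopt θ₀‖ ≤ S.La1 * S.r) :
    fderiv ℝ (fderiv ℝ fun a => excessRisk J a θ) (aopt θ) (a - aopt θ) (a - aopt θ) / 2
      ≤ excessRisk J a θ + S.LR3 * ‖a - aopt θ‖ ^ 3 / 6 := by
  have htaylor := taylor_two_le_of_norm_iteratedFDeriv_le
    (f := fun a => excessRisk J a θ) (convex_closedBall (aopt θ₀) (S.La1 * S.r))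
    (fun b hb => h.risk_diff θ b hθ (mem_closedBall_iff_norm.1 hb))
    (fun b hb => h.risk_bound₃ θ b hθ (mem_closedBall_iff_norm.1 hb))
    (mem_closedBall_iff_norm.2 (h.opt_mem_of_norm_sub_le hθ)) (mem_closedBall_iff_norm.2 ha)
  simpa only [h.excessRisk_opt hθ, h.fderiv_risk_opt hθ, zero_apply, zero_add,
    iteratedFDeriv_two_apply] using htaylor

lemma norm_iteratedFDeriv_two_risk_sub_le (h : SmoothDecision J aopt θ₀ S)
    (hθ : ‖θ - θ₀‖ ≤ S.r) :
    ‖iteratedFDeriv ℝ 2 (fun a => excessRisk J a θ) (aopt θ)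
        - iteratedFDeriv ℝ 2 (fun a => excessRisk J a θ₀) (aopt θ₀)‖
      ≤ (S.LR3 * S.La1 + S.Lhess) * ‖θ - θ₀‖ := by
  have move_decision : ‖iteratedFDeriv ℝ 2 (fun a => excessRisk J a θ) (aopt θ)
      - iteratedFDeriv ℝ 2 (fun a => excessRisk J a θ) (aopt θ₀)‖
        ≤ S.LR3 * ‖aopt θ - aopt θ₀‖ :=
    (convex_closedBall (aopt θ₀) (S.La1 * S.r)).norm_image_sub_le_of_norm_fderiv_le (𝕜 := ℝ)
      (fun b hb => (h.risk_diff θ b hθ (mem_closedBall_iff_norm.1 hb)).2)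
      (fun b hb => norm_fderiv_iteratedFDeriv.trans_le
        (h.risk_bound₃ θ b hθ (mem_closedBall_iff_norm.1 hb)))
      (mem_closedBall_iff_norm.2 h.opt_mem)
      (mem_closedBall_iff_norm.2 (h.opt_mem_of_norm_sub_le hθ))
  have move_model := h.hess_lipschitz θ θ₀ (aopt θ₀) hθ h.norm_sub_self_le h.opt_mem
  have hopt := mul_le_mul_of_nonneg_left (h.norm_opt_sub_le hθ) h.LR3_nonneg
  linarith [norm_sub_le_norm_sub_add_norm_sub
    (iteratedFDeriv ℝ 2 (fun a => excessRisk J a θ) (aopt θ))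
    (iteratedFDeriv ℝ 2 (fun a => excessRisk J a θ) (aopt θ₀))
    (iteratedFDeriv ℝ 2 (fun a => excessRisk J a θ₀) (aopt θ₀))]

lemma riskHess_le_fderiv_fderiv_add (h : SmoothDecision J aopt θ₀ S) (hθ : ‖θ - θ₀‖ ≤ S.r)
    (v : Vec dₐ) :
    riskHess J aopt θ₀ v v ≤ fderiv ℝ (fderiv ℝ fun a => excessRisk J a θ) (aopt θ) v v
      + (S.LR3 * S.La1 + S.Lhess) * ‖θ - θ₀‖ * ‖v‖ ^ 2 := by
  have hmove := (iteratedFDeriv ℝ 2 (fun a => excessRisk J a θ) (aopt θ)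
    - iteratedFDeriv ℝ 2 (fun a => excessRisk J a θ₀) (aopt θ₀)).le_of_opNorm_le
      (h.norm_iteratedFDeriv_two_risk_sub_le hθ) fun _ => v
  simp only [sub_apply, Finset.prod_const, Finset.card_univ, Fintype.card_fin,
    iteratedFDeriv_two_apply, Real.norm_eq_abs] at hmove
  rw [riskHess]
  linarith [neg_abs_le (fderiv ℝ (fderiv ℝ fun a => excessRisk J a θ) (aopt θ) v v
    - fderiv ℝ (fderiv ℝ fun a => excessRisk J a θ₀) (aopt θ₀) v v)]

lemma riskHess_le_add (h : SmoothDecision J aopt θ₀ S) (x v : Vec dₐ) :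
    riskHess J aopt θ₀ x x ≤ riskHess J aopt θ₀ v v + S.LR2 * ‖v - x‖ * ‖v + x‖ := by
  have polarization : riskHess J aopt θ₀ x x
      = riskHess J aopt θ₀ v v - riskHess J aopt θ₀ (v - x) (v + x) := by
    simp only [map_add, map_sub, sub_apply, h.riskHess_comm x v]
    ring
  have hbound := (riskHess J aopt θ₀).le_of_opNorm₂_le_of_le h.norm_riskHess_le
    (le_refl ‖v - x‖) (le_refl ‖v + x‖)
  linarith [neg_le_of_abs_le hbound]

lemma le_excessRisk_near (h : SmoothDecision J aopt θ₀ S) (hd : 1 ≤ d) {η : Vec d} {a : Vec dₐ}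
    {ρ : ℝ} (hρ : 4 * ρ ≤ S.r) (hη : ‖η‖ ≤ ρ) (ha : ‖a - aopt θ₀‖ ≤ 3 * S.La1 * ρ) :
    riskHess J aopt θ₀ (a - aopt θ₀ - fderiv ℝ aopt θ₀ η) (a - aopt θ₀ - fderiv ℝ aopt θ₀ η) / 2
      ≤ excessRisk J a (θ₀ + η) + S.Lcubic * ρ ^ 3 := by
  have hρ₀ : 0 ≤ ρ := (norm_nonneg _).trans hη
  have := h.La1_nonneg
  have := h.La2_nonneg
  have := h.LR2_nonneg
  have := h.LR3_nonneg
  have := h.Lhess_nonneg hd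
  obtain ⟨θ, rfl⟩ : ∃ θ, η = θ - θ₀ := ⟨θ₀ + η, by simp⟩
  rw [add_sub_cancel]
  have hθ : ‖θ - θ₀‖ ≤ S.r := by linarith
  set v := a - aopt θ with hv
  set x := a - aopt θ₀ - fderiv ℝ aopt θ₀ (θ - θ₀) with hx
  have hopt : ‖aopt θ - aopt θ₀‖ ≤ S.La1 * ρ := (h.norm_opt_sub_le hθ).trans (by gcongr)
  have hlin : ‖fderiv ℝ aopt θ₀ (θ - θ₀)‖ ≤ S.La1 * ρ :=
    (fderiv ℝ aopt θ₀).le_of_opNorm_le_of_le (h.norm_fderiv_opt_le h.norm_sub_self_le) hη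
  have hvnorm : ‖v‖ ≤ 4 * S.La1 * ρ := by
    rw [hv, ← sub_sub_sub_cancel_right a (aopt θ) (aopt θ₀)]
    exact (norm_sub_le _ _).trans (by linarith)
  have hsum : ‖v + x‖ ≤ 8 * S.La1 * ρ :=
    (norm_add_le _ _).trans (by linarith [norm_sub_le (a - aopt θ₀) (fderiv ℝ aopt θ₀ (θ - θ₀))])
  have hdiff : ‖v - x‖ ≤ S.La2 * ρ ^ 2 := by
    have hvx : v - x = -(aopt θ - aopt θ₀ - fderiv ℝ aopt θ₀ (θ - θ₀)) := by rw [hv, hx]; abel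
    rw [hvx, norm_neg]
    exact (h.norm_opt_sub_linear_le hθ).trans (by gcongr)
  have taylor := h.half_fderiv_fderiv_le_excessRisk hθ
    (ha.trans (by nlinarith : 3 * S.La1 * ρ ≤ S.La1 * S.r))
  have cubic : S.LR3 * ‖v‖ ^ 3 ≤ S.LR3 * (4 * S.La1 * ρ) ^ 3 := by gcongr
  have exchange := (h.riskHess_le_fderiv_fderiv_add hθ v).trans (add_le_add_right
    (by gcongr : (S.LR3 * S.La1 + S.Lhess) * ‖θ - θ₀‖ * ‖v‖ ^ 2
      ≤ (S.LR3 * S.La1 + S.Lhess) * ρ * (4 * S.La1 * ρ) ^ 2) _)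
  have linearize := (h.riskHess_le_add x v).trans (add_le_add_right
    (by gcongr : S.LR2 * ‖v - x‖ * ‖v + x‖ ≤ S.LR2 * (S.La2 * ρ ^ 2) * (8 * S.La1 * ρ)) _)
  have : 0 ≤ S.LR3 * S.La1 ^ 3 * ρ ^ 3 := by positivity
  rw [SmoothConstants.Lcubic]
  linarith

lemma le_excessRisk_far (h : SmoothDecision J aopt θ₀ S) {η : Vec d} {a : Vec dₐ} {ρ : ℝ}
    (hρ : 4 * ρ ≤ S.r) (hη : ‖η‖ ≤ ρ) (ha : 3 * S.La1 * ρ < ‖a - aopt θ₀‖) :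
    2 * S.μ * S.La1 ^ 2 * ρ ^ 2 ≤ excessRisk J a (θ₀ + η) := by
  have hρ₀ : 0 ≤ ρ := (norm_nonneg _).trans hη
  have := h.La1_nonneg
  obtain ⟨θ, rfl⟩ : ∃ θ, η = θ - θ₀ := ⟨θ₀ + η, by simp⟩
  rw [add_sub_cancel]
  have hθ : ‖θ - θ₀‖ ≤ S.r := by linarith
  have hopt : ‖aopt θ - aopt θ₀‖ ≤ S.La1 * ρ := (h.norm_opt_sub_le hθ).trans (by gcongr)
  have hdist : 2 * (S.La1 * ρ) ≤ ‖a - aopt θ‖ := by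
    have := norm_sub_norm_le (a - aopt θ₀) (aopt θ - aopt θ₀)
    rw [sub_sub_sub_cancel_right] at this
    linarith
  calc 2 * S.μ * S.La1 ^ 2 * ρ ^ 2 = S.μ / 2 * (2 * (S.La1 * ρ)) ^ 2 := by ring
    _ ≤ S.μ / 2 * ‖a - aopt θ‖ ^ 2 := by have := h.μ_pos; gcongr
    _ ≤ excessRisk J a θ := h.growth θ hθ a

end

end SmoothDecision

/-! ### The upper bound for certainty equivalence -/

section Upper

variable {Ω : Type*} [mΩ : MeasurableSpace Ω] {d dₐ dᵤ : ℕ}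

namespace Observations

variable {X : Observations Ω d dᵤ} {σ : ℝ≥0} {θ : Vec d} {P : Measure Ω} {T : ℕ}

/-- The noise accumulated up to the horizon `T` is sub-Gaussian with variance proxy `σ²`, relative
to the random covariance. -/
structure IsSubgaussianLaw (X : Observations Ω d dᵤ) (σ : ℝ≥0) (θ : Vec d) (P : Measure Ω)
    (T : ℕ) : Prop where
  prob : IsProbabilityMeasure P
  lintegral_exp_le : ∀ v, ∫⁻ ω, ENNReal.ofReal (Real.exp
    (inner ℝ v (X.noiseSum θ T ω) - σ ^ 2 / 2 * inner ℝ v (op (X.cov T ω) v))) ∂P ≤ 1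

lemma IsLaw.isSubgaussianLaw (h : X.IsLaw σ θ P) (T : ℕ) : X.IsSubgaussianLaw σ θ P T where
  prob := h.prob
  lintegral_exp_le v := (h.lintegral_exp v T).le

lemma IsSubgaussianLaw.isSubgaussianPair (h : X.IsSubgaussianLaw σ θ P T) :
    IsSubgaussianPair (X.noiseSum θ T)
      (fun ω v => (σ : ℝ) ^ 2 * inner ℝ v (op (X.cov T ω) v)) P where
  measurable_left := (X.measurable_noiseSum θ T).mono (X.ℱ.le T) le_rfl
  measurable_right := by
    have hz := X.measurable_z
    simp only [Function.uncurry_def, inner_op_cov_self]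
    fun_prop
  map_smul ω c v := by
    rw [map_smul, inner_smul_right, real_inner_smul_left]
    ring
  lintegral_exp_le v := by
    refine (h.lintegral_exp_le v).trans_eq' (lintegral_congr fun ω => ?_)
    rw [div_mul_eq_mul_div]

lemma IsSubgaussianLaw.measure_exists_lt_inner_noiseSum_sq_le (h : X.IsSubgaussianLaw σ θ P T)
    {E : Matrix (Fin d) (Fin d) ℝ} (hE : E.PosSemidef) {b δ : ℝ} (hb : 0 ≤ b) (hδ : 0 < δ)
    (hδ' : δ < 1) {ι : Type*} [Fintype ι] (v : ι → Vec d) :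
    P {ω | (∀ x, inner ℝ x (op (X.cov T ω) x) ≤ b * inner ℝ x (op E x)) ∧
        ∃ i, 2 * (σ ^ 2 * (b * inner ℝ (v i) (op E (v i)))) * Real.log (2 * Fintype.card ι / δ)
          < inner ℝ (v i) (X.noiseSum θ T ω) ^ 2} ≤ ENNReal.ofReal δ := by
  rcases isEmpty_or_nonempty ι with _ | _
  · simp
  have hι : (1 : ℝ) ≤ Fintype.card ι := by exact_mod_cast Fintype.card_pos
  set n := (Fintype.card ι : ℝ) with hn
  have hlog : 0 < Real.log (2 * n / δ) := Real.log_pos (by rw [lt_div_iff₀ hδ]; linarith)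
  set B : ι → Set Ω := fun i =>
    {ω | σ ^ 2 * inner ℝ (v i) (op (X.cov T ω) (v i))
          ≤ σ ^ 2 * (b * inner ℝ (v i) (op E (v i))) ∧
        2 * (σ ^ 2 * (b * inner ℝ (v i) (op E (v i)))) * Real.log (2 * n / δ)
          < inner ℝ (v i) (X.noiseSum θ T ω) ^ 2}
  have hB : ∀ i, P (B i) ≤ ENNReal.ofReal (δ / n) := fun i => by
    have hvar := inner_op_nonneg hE (v i)
    refine (h.isSubgaussianPair.measure_lt_inner_sq_le (v i) (by positivity) hlog).trans_eq ?_
    rw [Real.exp_neg, Real.exp_log (by positivity), inv_div, ← ENNReal.ofReal_ofNat 2,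
      ← ENNReal.ofReal_mul (by norm_num), mul_div_assoc', mul_div_mul_left _ _ two_ne_zero]
  calc _ ≤ P (⋃ i, B i) := by
        refine measure_mono ?_
        rintro ω ⟨hcov, i, hi⟩
        exact Set.mem_iUnion.2 ⟨i, mul_le_mul_of_nonneg_left (hcov (v i)) (sq_nonneg _), hi⟩
    _ ≤ ∑ i, P (B i) := measure_iUnion_fintype_le P B
    _ ≤ ∑ _ : ι, ENNReal.ofReal (δ / n) := Finset.sum_le_sum fun i _ => hB i
    _ = ENNReal.ofReal δ := by
      rw [Finset.sum_const, Finset.card_univ, nsmul_eq_mul, ← ENNReal.ofReal_natCast,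
        ← ENNReal.ofReal_mul (by positivity), ← hn, mul_div_cancel₀ _ (by positivity)]

lemma IsSubgaussianLaw.measure_lt_inner_op_inv_noiseSum_le (h : X.IsSubgaussianLaw σ θ P T)
    {E : Matrix (Fin d) (Fin d) ℝ} (hE : E.PosDef) {b δ : ℝ} (hb : 0 ≤ b) (hδ : 0 < δ)
    (hδ' : δ < 1) :
    P {ω | (∀ x, inner ℝ x (op (X.cov T ω) x) ≤ b * inner ℝ x (op E x)) ∧
        4 * (σ ^ 2 * b) * (d + Real.log (1 / δ))
          < inner ℝ (X.noiseSum θ T ω) (op E⁻¹ (X.noiseSum θ T ω))} ≤ ENNReal.ofReal δ := by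
  have := h.prob
  have hlog : 0 < Real.log (1 / δ) := Real.log_pos (by rwa [lt_div_iff₀ hδ, one_mul])
  refine (measure_mono ?_).trans ((h.isSubgaussianPair.measure_lt_inner_op_inv_le hE
    (b := σ ^ 2 * b) (by positivity) hlog).trans_eq ?_)
  · rintro ω ⟨hcov, hdev⟩
    refine ⟨fun x => ?_, by rwa [Fintype.card_fin]⟩
    rw [mul_assoc]
    exact mul_le_mul_of_nonneg_left (hcov x) (sq_nonneg _)
  · rw [Real.exp_neg, Real.exp_log (by positivity), inv_div, div_one]

lemma idealRisk_div (X : Observations Ω d dᵤ) (P : Measure Ω) (hT : 0 < T)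
    (H : Matrix (Fin d) (Fin d) ℝ) (hE : IsUnit (X.meanCov P T).det) :
    X.idealRisk H P T / T = (H * (X.meanCov P T)⁻¹).trace := by
  have hT' : (T : ℝ) ≠ 0 := by positivity
  have : Invertible (T : ℝ)⁻¹ := invertibleOfNonzero (inv_ne_zero hT')
  rw [idealRisk, Gam, Matrix.inv_smul _ _ hE, Matrix.mul_smul, Matrix.trace_smul, invOf_eq_inv,
    inv_inv, smul_eq_mul, mul_div_cancel_left₀ _ hT']

lemma PolicyRegular.lamMin_meanCov_pos [IsProbabilityMeasure P] {ε lam Tse Tcon Ccon α : ℝ}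
    {Gbar : ℕ → Matrix (Fin d) (Fin d) ℝ}
    (reg : X.PolicyRegular P ε lam Gbar Tse Tcon Ccon α) (hε : ε < 1 / 2) (hT : 0 < T)
    (hse : Tse ≤ T) (hcon : Tcon ≤ T) : 0 < lamMin (X.meanCov P T) := by
  have hε' : ENNReal.ofReal ε < 2⁻¹ := by
    rw [← ENNReal.ofReal_ofNat, ← ENNReal.ofReal_inv_of_pos (by norm_num)]
    exact ENNReal.ofReal_lt_ofReal_iff'.2 ⟨by linarith, by norm_num⟩
  set A : Set Ω :=
    {ω | ¬ (lam * T ≤ lamMin (X.cov T ω) ∧ LoewnerLE (X.cov T ω) ((T : ℝ) • Gbar T))}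
  set A' : Set Ω := {ω | ¬ (opNorm (X.cov T ω - X.meanCov P T)
    ≤ Ccon / (T : ℝ) ^ α * lamMin (X.meanCov P T))}
  obtain ⟨ω, hω⟩ : ∃ ω, ω ∉ A ∪ A' := by
    by_contra! hall
    have h₁ : P Set.univ ≤ ENNReal.ofReal ε + ENNReal.ofReal ε :=
      (measure_mono fun ω _ => hall ω).trans ((measure_union_le _ _).trans
        (add_le_add (reg.excited T hse) (reg.concentrated T hcon)))
    rw [measure_univ, ← ENNReal.inv_two_add_inv_two] at h₁
    exact (ENNReal.add_lt_add hε' hε').not_ge h₁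
  obtain ⟨⟨hexc, -⟩, hconc⟩ : (lam * T ≤ lamMin (X.cov T ω) ∧ _) ∧ _ := by
    simpa only [A, A', Set.mem_union, Set.mem_ofPred_eq, not_or, not_not] using hω
  by_contra! hneg
  have hCcon := reg.Ccon_pos
  have heq : X.cov T ω = X.meanCov P T := eq_of_opNorm_sub_nonpos
    (hconc.trans (mul_nonpos_of_nonneg_of_nonpos (by positivity) hneg))
  have hpos : 0 < lam * T := mul_pos reg.lam_pos (by positivity)
  exact (hpos.trans_le (heq ▸ hexc)).not_ge hneg

end Observations

section Constants

variable {δ : ℝ}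

lemma log_four_div (hδ : 0 < δ) : Real.log (4 / δ) = 2 * Real.log 2 + Real.log (1 / δ) := by
  rw [two_mul, ← Real.log_mul (by norm_num) (by norm_num),
    ← Real.log_mul (by norm_num) (by positivity)]
  congr 1
  ring

lemma add_log_four_div_le_logComplexity (hδ : 0 < δ) (hδ' : δ < 1) (hd : 1 ≤ d) {lam : ℝ}
    (hlam : 0 < lam) {G : Matrix (Fin d) (Fin d) ℝ} (hG : G.PosSemidef) :
    20 / 3 * (d + Real.log (4 / δ)) ≤ 16 * logComplexity δ lam G := by
  have hdet : 0 ≤ Real.log (lam⁻¹ • G + 1).det :=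
    Real.log_nonneg (one_le_det_add_one (hG.smul (inv_pos.2 hlam).le))
  have hlog : 0 ≤ Real.log (1 / δ) := Real.log_nonneg (by rw [le_div_iff₀ hδ]; linarith)
  have hd' : (1 : ℝ) ≤ d := by exact_mod_cast hd
  rw [log_four_div hδ]
  unfold logComplexity
  linarith [Real.log_two_lt_d9]

lemma add_log_four_div_le_mul_log (hδ : 0 < δ) (hδ' : δ < 1 / 2) (hd : 1 ≤ d) :
    20 / 3 * (d + Real.log (4 / δ)) ≤ 30 * (d * Real.log (d / δ)) := by
  have hd' : (1 : ℝ) ≤ d := by exact_mod_cast hd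
  have hlog : Real.log 2 ≤ Real.log (1 / δ) :=
    Real.log_le_log (by norm_num) (by rw [le_div_iff₀ hδ]; linarith)
  have hlog' : Real.log (1 / δ) ≤ Real.log (d / δ) :=
    Real.log_le_log (by positivity) (by gcongr)
  rw [log_four_div hδ]
  nlinarith [Real.log_two_gt_d9]

lemma two_mul_mul_log_le (hδ : 0 < δ) (hδ' : δ < 1 / 2) (hd : 1 ≤ d) {s q : ℝ} (hq : 0 ≤ q) :
    2 * (s ^ 2 * (5 / 4 * q)) * Real.log (2 * d / (δ / 4))
      ≤ 5 * s ^ 2 * Real.log (24 * d / δ) * q := by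
  have hd' : (1 : ℝ) ≤ d := by exact_mod_cast hd
  have hlog : 0 ≤ Real.log (24 * d / δ) := Real.log_nonneg ((one_le_div₀ hδ).2 (by linarith))
  have hlog' : Real.log (2 * d / (δ / 4)) ≤ Real.log (24 * d / δ) := by
    refine Real.log_le_log (by positivity) ?_
    rw [div_div_eq_mul_div]
    exact div_le_div_of_nonneg_right (by linarith) hδ.le
  calc 2 * (s ^ 2 * (5 / 4 * q)) * Real.log (2 * d / (δ / 4))
      = 5 / 2 * (s ^ 2 * q) * Real.log (2 * d / (δ / 4)) := by ring
    _ ≤ 5 / 2 * (s ^ 2 * q) * Real.log (24 * d / δ) := by gcongr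
    _ ≤ 5 * (s ^ 2 * q) * Real.log (24 * d / δ) := by gcongr; norm_num
    _ = 5 * s ^ 2 * Real.log (24 * d / δ) * q := by ring

lemma cube_le_of_sq_le {x c L m t : ℝ} (hx : 0 ≤ x) (hc : 0 ≤ c) (hL : 0 ≤ L) (hm : 0 ≤ m)
    (ht : 0 ≤ t) (h : x ^ 2 ≤ c ^ 2 * L / (m * t)) :
    x ^ 3 ≤ c ^ 3 / m ^ (3 / 2 : ℝ) * L ^ (3 / 2 : ℝ) / t ^ (3 / 2 : ℝ) := by
  have hcube : ∀ y : ℝ, 0 ≤ y → (y ^ 2) ^ (3 / 2 : ℝ) = y ^ 3 := fun y hy => by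
    rw [← Real.rpow_natCast, ← Real.rpow_natCast, ← Real.rpow_mul hy]
    norm_num
  calc x ^ 3 = (x ^ 2) ^ (3 / 2 : ℝ) := (hcube x hx).symm
    _ ≤ (c ^ 2 * L / (m * t)) ^ (3 / 2 : ℝ) := by gcongr
    _ = _ := by
      rw [Real.div_rpow (by positivity) (by positivity), Real.mul_rpow (by positivity) hL,
        Real.mul_rpow hm ht, hcube c hc]
      ring

lemma div_rpow_le_of_rpow_lt {C α t : ℝ} (hC : 0 ≤ C) (hα : 0 < α)
    (ht : (4 * C) ^ (1 / α) < t) : C / t ^ α ≤ 1 / 4 := by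
  have ht₀ : 0 < t := ht.trans_le' (by positivity)
  have h : 4 * C ≤ t ^ α := by
    have := Real.rpow_le_rpow (by positivity) ht.le hα.le
    rwa [← Real.rpow_mul (by positivity), one_div_mul_cancel hα.ne', Real.rpow_one] at this
  rw [div_le_iff₀ (by positivity)]
  linarith

end Constants

section Concentrated

variable {M E : Matrix (Fin d) (Fin d) ℝ} {ε : ℝ}

lemma norm_sq_le_of_inner_op_inv_le (hE : E.PosDef) (hcon : opNorm (M - E) ≤ ε * lamMin E)
    (hε : 0 ≤ ε) (hε' : ε ≤ 1 / 4) {m B : ℝ} (hm : 0 < m) (hM : m ≤ lamMin M) {x : Vec d}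
    (hx : inner ℝ (op M x) (op E⁻¹ (op M x)) ≤ B) : ‖x‖ ^ 2 ≤ 4 / 3 * B / m := by
  rw [le_div_iff₀' hm]
  calc m * ‖x‖ ^ 2 ≤ lamMin M * ‖x‖ ^ 2 := by gcongr
    _ ≤ inner ℝ x (op M x) := lamMin_mul_le M x
    _ ≤ 4 / 3 * inner ℝ (op M x) (op E⁻¹ (op M x)) := inner_op_le_inner_op_inv hE hcon hε hε' x
    _ ≤ 4 / 3 * B := by gcongr

lemma SmoothDecision.excessRisk_le_of_concentrated {J : Vec d → Vec dₐ → ℝ}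
    {aopt : Vec d → Vec dₐ} {θ₀ θ : Vec d} {S : SmoothConstants} (hS : SmoothDecision J aopt θ₀ S)
    {k : Fin d → Vec d} (hk : taskHessian J aopt θ₀ = ∑ i, Matrix.vecMulVec (k i) (k i))
    (hE : E.PosDef) (hlam : 0 < lamMin E) (hcon : opNorm (M - E) ≤ ε * lamMin E) {c : ℝ}
    (hdev : ∀ i, inner ℝ (op E⁻¹ (k i)) (op M (θ - θ₀)) ^ 2
      ≤ c * inner ℝ (op E⁻¹ (k i)) (op E (op E⁻¹ (k i)))) (hθ : ‖θ - θ₀‖ ≤ S.r) :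
    excessRisk J (aopt θ) θ₀ ≤ c * (taskHessian J aopt θ₀ * E⁻¹).trace
      + S.Lquad * ‖θ - θ₀‖ ^ 3 + (taskHessian J aopt θ₀).trace * ε ^ 2 * ‖θ - θ₀‖ ^ 2 := by
  have hplugin := inner_op_sum_vecMulVec_le_plugin hE hlam hcon k (θ - θ₀)
  rw [← trace_sum_vecMulVec, ← hk] at hplugin
  have hlead : ∑ i, inner ℝ (op E⁻¹ (k i)) (op M (θ - θ₀)) ^ 2
      ≤ c * (taskHessian J aopt θ₀ * E⁻¹).trace := by
    rw [hk, trace_sum_vecMulVec_mul, Finset.mul_sum]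
    refine Finset.sum_le_sum fun i _ => (hdev i).trans_eq ?_
    rw [op_op_inv hE.det_pos.ne'.isUnit, real_inner_comm]
  linarith [hS.excessRisk_plugin_le hθ]

lemma SmoothDecision.excessRisk_le_of_inner_op_inv_le (hd : 1 ≤ d) {σ : ℝ≥0}
    {J : Vec d → Vec dₐ → ℝ} {aopt : Vec d → Vec dₐ} {θ₀ θ : Vec d} {S : SmoothConstants}
    (hS : SmoothDecision J aopt θ₀ S) {T : ℕ} {δ lam Ccon α : ℝ} {G : Matrix (Fin d) (Fin d) ℝ}
    (hG : G.PosSemidef) (hδ : 0 < δ) (hδ' : δ < 1 / 2) (hlam : 0 < lam) (hC : 0 < Ccon)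
    (hα : 0 < α) (hTC : (4 * Ccon) ^ (1 / α) < T)
    (hTr : 16 * (σ : ℝ) ^ 2 * logComplexity δ lam G / (lam * S.r ^ 2) < T)
    {k : Fin d → Vec d} (hk : taskHessian J aopt θ₀ = ∑ i, Matrix.vecMulVec (k i) (k i))
    (hE : E.PosDef) (hlamE : 0 < lamMin E) (hexc : lam * T ≤ lamMin M)
    (hcon : opNorm (M - E) ≤ Ccon / (T : ℝ) ^ α * lamMin E) {c : ℝ}
    (hdev : ∀ i, inner ℝ (op E⁻¹ (k i)) (op M (θ - θ₀)) ^ 2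
      ≤ c * inner ℝ (op E⁻¹ (k i)) (op E (op E⁻¹ (k i))))
    (hinv : inner ℝ (op M (θ - θ₀)) (op E⁻¹ (op M (θ - θ₀)))
      ≤ 5 * σ ^ 2 * (d + Real.log (4 / δ))) :
    excessRisk J (aopt θ) θ₀ ≤ c * (taskHessian J aopt θ₀ * E⁻¹).trace
      + 64 * S.Lquad * (σ : ℝ) ^ 3 / lam ^ (3 / 2 : ℝ)
          * logComplexity δ lam G ^ (3 / 2 : ℝ) / (T : ℝ) ^ (3 / 2 : ℝ)
      + 30 * (σ : ℝ) ^ 2 * Ccon ^ 2 * d * (taskHessian J aopt θ₀).trace / lam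
          * Real.log (d / δ) / (T : ℝ) ^ (1 + 2 * α) := by
  have hT : (0 : ℝ) < T := hTC.trans_le' (by positivity)
  have hr := hS.r_pos
  set H := taskHessian J aopt θ₀
  set D := θ - θ₀
  set L := logComplexity δ lam G
  have hL := add_log_four_div_le_logComplexity hδ (by linarith) hd hlam hG
  have hlog : 0 ≤ Real.log (4 / δ) := Real.log_nonneg (by rw [le_div_iff₀ hδ]; linarith)
  have hL₀ : 0 ≤ L := by linarith [(Nat.cast_nonneg d : (0 : ℝ) ≤ d)]
  have hD : ‖D‖ ^ 2 ≤ (σ : ℝ) ^ 2 * (20 / 3 * (d + Real.log (4 / δ))) / (lam * T) :=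
    (norm_sq_le_of_inner_op_inv_le hE hcon (by positivity) (div_rpow_le_of_rpow_lt hC.le hα hTC)
      (by positivity) hexc hinv).trans_eq (by ring)
  have hDL : ‖D‖ ^ 2 ≤ (4 * (σ : ℝ)) ^ 2 * L / (lam * T) :=
    calc ‖D‖ ^ 2 ≤ (σ : ℝ) ^ 2 * (16 * L) / (lam * T) := hD.trans (by gcongr)
      _ = (4 * (σ : ℝ)) ^ 2 * L / (lam * T) := by ring
  have hDr : ‖D‖ ≤ S.r := by
    refine le_of_sq_le_sq (hDL.trans ?_) hr.le
    rw [div_lt_iff₀ (by positivity)] at hTr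
    rw [div_le_iff₀ (by positivity)]
    linarith
  have hcubic : S.Lquad * ‖D‖ ^ 3 ≤ 64 * S.Lquad * (σ : ℝ) ^ 3 / lam ^ (3 / 2 : ℝ)
      * L ^ (3 / 2 : ℝ) / (T : ℝ) ^ (3 / 2 : ℝ) :=
    (mul_le_mul_of_nonneg_left (cube_le_of_sq_le (norm_nonneg D) (by positivity) hL₀ hlam.le hT.le
      hDL) (hS.Lquad_nonneg hd)).trans_eq (by ring)
  have htrace : 0 ≤ H.trace := hS.posSemidef_taskHessian.trace_nonneg
  have hconc : H.trace * (Ccon / (T : ℝ) ^ α) ^ 2 * ‖D‖ ^ 2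
      ≤ 30 * (σ : ℝ) ^ 2 * Ccon ^ 2 * d * H.trace / lam * Real.log (d / δ)
        / (T : ℝ) ^ (1 + 2 * α) :=
    calc H.trace * (Ccon / (T : ℝ) ^ α) ^ 2 * ‖D‖ ^ 2
        ≤ H.trace * (Ccon / (T : ℝ) ^ α) ^ 2
          * ((σ : ℝ) ^ 2 * (30 * (d * Real.log (d / δ))) / (lam * T)) := by
          gcongr
          exact hD.trans (by gcongr ?_ * ?_ / _; exact add_log_four_div_le_mul_log hδ hδ' hd)
      _ = _ := by
          rw [Real.rpow_add hT, Real.rpow_one, mul_comm 2 α, Real.rpow_mul hT.le, Real.rpow_two]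
          field_simp
  linarith [hS.excessRisk_le_of_concentrated hk hE hlamE hcon hdev hDr]

end Concentrated

theorem SmoothDecision.measure_not_excessRisk_certaintyEquivalence_le (hd : 1 ≤ d) {σ : ℝ≥0}
    {J : Vec d → Vec dₐ → ℝ} {aopt : Vec d → Vec dₐ} {θ₀ : Vec d} {S : SmoothConstants}
    (hS : SmoothDecision J aopt θ₀ S) {X : Observations Ω d dᵤ} {P : Measure Ω} {T : ℕ}
    {δ lam Tse Tcon Ccon α : ℝ} {Gbar : ℕ → Matrix (Fin d) (Fin d) ℝ}
    {θhat : Traj d dᵤ T → Vec d} (hδ : 0 < δ) (hδ' : δ < 1 / 2)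
    (law : X.IsSubgaussianLaw σ θ₀ P T)
    (reg : X.PolicyRegular P (δ / 4) lam Gbar Tse Tcon Ccon α) (hls : IsLeastSquares θhat)
    (hTcon : Tcon ≤ T) (hTse : Tse ≤ T) (hTC : (4 * Ccon) ^ (1 / α) < T)
    (hTr : 16 * (σ : ℝ) ^ 2 * logComplexity δ lam (Gbar T) / (lam * S.r ^ 2) < T) :
    P {ω | ¬ (excessRisk J (aopt (θhat (X.traj T ω))) θ₀
          ≤ 5 * (σ : ℝ) ^ 2 * Real.log (24 * d / δ)
              * (X.idealRisk (taskHessian J aopt θ₀) P T / T)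
            + 64 * S.Lquad * (σ : ℝ) ^ 3 / lam ^ (3 / 2 : ℝ)
              * logComplexity δ lam (Gbar T) ^ (3 / 2 : ℝ) / (T : ℝ) ^ (3 / 2 : ℝ)
            + 30 * (σ : ℝ) ^ 2 * Ccon ^ 2 * d * (taskHessian J aopt θ₀).trace / lam
              * Real.log (d / δ) / (T : ℝ) ^ (1 + 2 * α))}
        ≤ ENNReal.ofReal δ := by
  have := law.prob
  have hC := reg.Ccon_pos
  have hT : (0 : ℝ) < T := hTC.trans_le' (by positivity)
  have hlamE : 0 < lamMin (X.meanCov P T) :=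
    reg.lamMin_meanCov_pos (by linarith) (by exact_mod_cast hT) hTse hTcon
  have hE := posDef_of_lamMin_pos (X.isHermitian_meanCov P T) hlamE
  obtain ⟨k, hk⟩ := exists_eq_sum_vecMulVec hS.posSemidef_taskHessian
  set E := X.meanCov P T
  have hδ₄ : 0 < δ / 4 := by positivity
  have hexc := reg.excited T hTse
  have hcon := reg.concentrated T hTcon
  have hdev := law.measure_exists_lt_inner_noiseSum_sq_le hE.posSemidef (b := 5 / 4)
    (by norm_num) hδ₄ (by linarith) fun i => op E⁻¹ (k i)
  have hinv := law.measure_lt_inner_op_inv_noiseSum_le hE (b := 5 / 4) (by norm_num) hδ₄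
    (by linarith)
  refine (measure_mono fun ω hω => ?_).trans <| (measure_union_le _ _).trans <|
    (add_le_add ((measure_union_le _ _).trans (add_le_add hexc hcon))
      ((measure_union_le _ _).trans (add_le_add hdev hinv))).trans_eq ?_
  · by_contra hgood
    simp only [Set.mem_union, not_or] at hgood
    obtain ⟨⟨hexc, hcon⟩, hdev, hinv⟩ := hgood
    replace hexc := (not_not.1 hexc).1
    replace hcon := not_not.1 hcon
    have hcov : ∀ x, inner ℝ x (op (X.cov T ω) x) ≤ 5 / 4 * inner ℝ x (op E x) := fun x => by
      have hε := div_rpow_le_of_rpow_lt hC.le reg.α_pos hTC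
      exact (inner_op_le_one_add_mul_inner_op hcon (by positivity) x).trans
        (mul_le_mul_of_nonneg_right (by linarith) (inner_op_nonneg hE.posSemidef x))
    simp only [Set.mem_ofPred_eq, not_and, not_exists, not_lt, one_div_div,
      ← hls.op_cov_sub_eq_noiseSum X θ₀ ω] at hdev hinv
    refine hω ?_
    rw [X.idealRisk_div P (by exact_mod_cast hT) _ hE.det_pos.ne'.isUnit]
    refine hS.excessRisk_le_of_inner_op_inv_le hd (reg.Gbar_psd T) hδ hδ' reg.lam_pos hC
      reg.α_pos hTC hTr hk hE hlamE hexc hcon (fun i => (hdev hcov i).trans ?_)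
      ((hinv hcov).trans_eq (by ring))
    rw [Fintype.card_fin]
    exact two_mul_mul_log_le hδ hδ' hd (inner_op_nonneg hE.posSemidef _)
  · rw [← ENNReal.ofReal_add hδ₄.le hδ₄.le, ← ENNReal.ofReal_add (by positivity) (by positivity)]
    congr 1
    ring

end Upper
/-! ### The van Trees inequality -/

lemma hasDerivAt_max_zero_pow (n : ℕ) (x : ℝ) :
    HasDerivAt (fun x : ℝ => max 0 x ^ (n + 2)) ((n + 2) * max 0 x ^ (n + 1)) x := by
  have hpow : ∀ x, HasDerivAt (fun x : ℝ => x ^ (n + 2)) ((n + 2) * x ^ (n + 1)) x := fun x => by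
    simpa using hasDerivAt_pow (n + 2) x
  rcases lt_trichotomy x 0 with hx | rfl | hx
  · rw [max_eq_left hx.le, zero_pow n.succ_ne_zero, mul_zero]
    refine (hasDerivAt_const x (0 : ℝ)).congr_of_eventuallyEq ?_
    filter_upwards [Iio_mem_nhds hx] with y hy
    rw [max_eq_left (le_of_lt hy), zero_pow (by omega)]
  · rw [← hasDerivWithinAt_univ, ← Set.Iic_union_Ici (a := (0 : ℝ)), max_self]
    refine HasDerivWithinAt.union ?_ ((hpow 0).hasDerivWithinAt.congr (fun y hy => ?_) (by simp))
    · rw [zero_pow n.succ_ne_zero, mul_zero]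
      refine (hasDerivWithinAt_const 0 _ (0 : ℝ)).congr (fun y hy => ?_) (by simp)
      rw [max_eq_left hy, zero_pow (by omega)]
    · rw [max_eq_right hy]
  · rw [max_eq_right hx.le]
    refine (hpow x).congr_of_eventuallyEq ?_
    filter_upwards [Ioi_mem_nhds hx] with y hy
    rw [max_eq_right (le_of_lt hy)]

section Bump

variable {E : Type*} [NormedAddCommGroup E]

/-- The profile `ρ² - ‖η‖²` of the prior on the ball of radius `ρ`, extended by `0`. Its cube is
the unnormalized prior density: a twice differentiable weight for which the information of the
prior is explicit. -/
def bump (ρ : ℝ) (η : E) : ℝ := max 0 (ρ ^ 2 - ‖η‖ ^ 2)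

lemma bump_nonneg (ρ : ℝ) (η : E) : 0 ≤ bump ρ η := le_max_left _ _

@[fun_prop]
lemma continuous_bump (ρ : ℝ) : Continuous fun η : E => bump ρ η := by
  unfold bump
  fun_prop

lemma norm_le_of_bump_ne_zero {ρ : ℝ} (hρ : 0 ≤ ρ) {η : E} (h : bump ρ η ≠ 0) : ‖η‖ ≤ ρ := by
  by_contra! hc
  exact h (max_eq_left (sub_nonpos.2 (pow_le_pow_left₀ hρ hc.le 2)))

variable [NormedSpace ℝ E] [FiniteDimensional ℝ E] {ρ : ℝ} (hρ : 0 ≤ ρ)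
include hρ

lemma hasCompactSupport_of_bump {f : E → ℝ} (hf : ∀ η, bump ρ η = 0 → f η = 0) :
    HasCompactSupport f :=
  HasCompactSupport.of_support_subset_isCompact (isCompact_closedBall 0 ρ) fun η hη => by
    rw [mem_closedBall_zero_iff]
    exact norm_le_of_bump_ne_zero hρ fun h => hη (hf η h)

lemma integrable_of_bump [MeasurableSpace E] [BorelSpace E] (μ : Measure E) [μ.IsAddHaarMeasure]
    {f : E → ℝ} (hc : Continuous f) (hf : ∀ η, bump ρ η = 0 → f η = 0) : Integrable f μ :=
  hc.integrable_of_hasCompactSupport (hasCompactSupport_of_bump hρ hf)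

end Bump

section Prior

variable {E : Type*} [NormedAddCommGroup E] [InnerProductSpace ℝ E]

lemma hasFDerivAt_bump_pow (ρ : ℝ) (n : ℕ) (η : E) :
    HasFDerivAt (fun η : E => bump ρ η ^ (n + 2))
      (innerSL ℝ (-(2 * (n + 2) * bump ρ η ^ (n + 1)) • η)) η := by
  have hsq : HasFDerivAt (fun η : E => ρ ^ 2 - ‖η‖ ^ 2) (-((2 : ℝ) • innerSL ℝ η)) η := by
    simpa [two_smul] using (hasStrictFDerivAt_norm_sq η).hasFDerivAt.const_sub (ρ ^ 2)
  refine ((hasDerivAt_max_zero_pow n _).comp_hasFDerivAt η hsq).congr_fderiv ?_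
  ext v
  simp only [bump, smul_apply, neg_apply, innerSL_apply_apply, real_inner_smul_left, smul_eq_mul]
  ring

variable [FiniteDimensional ℝ E] [MeasurableSpace E] [BorelSpace E] (μ : Measure E)
  [μ.IsAddHaarMeasure] {ι : Type*} [Fintype ι] (e : OrthonormalBasis ι ℝ E)

lemma integral_affine_apply_gradient (ℓ : E →L[ℝ] ℝ) (L : E →L[ℝ] E →L[ℝ] ℝ) {g : E → ℝ}
    {g' : E → E} (hgc : HasCompactSupport g) (hg' : Continuous g')
    (hg : ∀ η, HasFDerivAt g (innerSL ℝ (g' η)) η) :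
    ∫ η, (ℓ - L η) (g' η) ∂μ = (∑ j, L (e j) (e j)) * ∫ η, g η ∂μ := by
  have hgcont : Continuous g := continuous_iff_continuousAt.2 fun η => (hg η).continuousAt
  have hg'c : HasCompactSupport g' := by
    refine hgc.mono' fun η hη => ?_
    contrapose! hη
    have h := (hg η).unique ((hasFDerivAt_const 0 η).congr_of_eventuallyEq
      (notMem_tsupport_iff_eventuallyEq.1 hη))
    simpa using congrArg norm h
  have hint : ∀ j, Integrable (fun η => (ℓ - L η) (e j) * inner ℝ (g' η) (e j)) μ := fun j =>
    Continuous.integrable_of_hasCompactSupport (by fun_prop)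
      (hg'c.comp_left (g := fun x => inner ℝ x (e j)) (inner_zero_left _)).mul_left
  have hparts : ∀ j, ∫ η, (ℓ - L η) (e j) * inner ℝ (g' η) (e j) ∂μ
      = L (e j) (e j) * ∫ η, g η ∂μ := by
    intro j
    have h := integral_bilinear_hasLineDerivAt_right_eq_neg_left_of_integrable (μ := μ) (v := e j)
      (B := ContinuousLinearMap.mul ℝ ℝ) (f := fun η => (ℓ - L η) (e j))
      (f' := fun _ => -L (e j) (e j)) (g := g) (g' := fun η => inner ℝ (g' η) (e j))
      ((hgcont.integrable_of_hasCompactSupport hgc).const_mul _) (hint j)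
      (Continuous.integrable_of_hasCompactSupport (by fun_prop) hgc.mul_left)
      (fun η _ => by
        simpa using ((L.flip (e j)).hasFDerivAt.const_sub (ℓ (e j))).hasLineDerivAt (e j))
      (fun η _ => by simpa using (hg η).hasLineDerivAt (e j))
    simpa only [ContinuousLinearMap.mul_apply', neg_mul, integral_neg, neg_neg,
      integral_const_mul] using h
  rw [Finset.sum_mul, ← Finset.sum_congr rfl fun j _ => hparts j,
    ← integral_finsetSum _ fun j _ => hint j]
  refine integral_congr_ae (ae_of_all _ fun η => ?_)
  dsimp only
  conv_lhs => rw [← e.sum_repr' (g' η)]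
  simp only [map_sum, map_smul, smul_eq_mul, real_inner_comm, mul_comm]

variable {ρ : ℝ}

lemma integral_bump_pow_mul_apply_self (hρ : 0 ≤ ρ) (n : ℕ) (Q : E →L[ℝ] E →L[ℝ] ℝ) :
    2 * (n + 2) * ∫ η, bump ρ η ^ (n + 1) * Q η η ∂μ
      = (∑ j, Q (e j) (e j)) * ∫ η, bump ρ η ^ (n + 2) ∂μ := by
  rw [← integral_affine_apply_gradient μ e 0 Q
    (hasCompactSupport_of_bump hρ fun η h => by simp [h]) (by fun_prop)
    (hasFDerivAt_bump_pow ρ n), ← integral_const_mul]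
  refine integral_congr_ae (ae_of_all _ fun η => ?_)
  simp only [zero_sub, neg_apply, map_smul, smul_eq_mul]
  ring

lemma sq_mul_integral_bump_sq (hρ : 0 ≤ ρ) :
    ρ ^ 2 * ∫ η, bump ρ η ^ 2 ∂μ
      = (1 + Module.finrank ℝ E / 6) * ∫ η : E, bump ρ η ^ 3 ∂μ := by
  have hsplit : ∀ η : E, bump ρ η ^ 3 = ρ ^ 2 * bump ρ η ^ 2 - bump ρ η ^ 2 * ‖η‖ ^ 2 := by
    intro η
    rcases le_total (ρ ^ 2 - ‖η‖ ^ 2) 0 with h | h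
    · simp [bump, max_eq_left h]
    · simp only [bump, max_eq_right h]
      ring
  have hnorm : 2 * ((1 : ℕ) + 2) * ∫ η : E, bump ρ η ^ 2 * ‖η‖ ^ 2 ∂μ
      = Module.finrank ℝ E * ∫ η : E, bump ρ η ^ 3 ∂μ := by
    have h := integral_bump_pow_mul_apply_self μ (stdOrthonormalBasis ℝ E) hρ 1
      (innerSL ℝ : E →L[ℝ] E →L[ℝ] ℝ)
    have hinner : ∀ x : E, (innerSL ℝ : E →L[ℝ] E →L[ℝ] ℝ) x x = ‖x‖ ^ 2 :=
      fun x => real_inner_self_eq_norm_sq x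
    simpa [hinner] using h
  have hint : ∫ η : E, bump ρ η ^ 3 ∂μ
      = ρ ^ 2 * (∫ η, bump ρ η ^ 2 ∂μ) - ∫ η, bump ρ η ^ 2 * ‖η‖ ^ 2 ∂μ := by
    simp_rw [hsplit]
    rw [integral_sub (integrable_of_bump hρ μ (by fun_prop) fun η h => by simp [h])
      (integrable_of_bump hρ μ (by fun_prop) fun η h => by simp [h]), integral_const_mul]
  norm_num at hnorm
  linarith

lemma integral_bump_cube_pos (hρ : 0 < ρ) : 0 < ∫ η, bump ρ η ^ 3 ∂μ := by
  have hc : Continuous fun η : E => bump ρ η ^ 3 := by fun_prop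
  refine hc.integral_pos_of_hasCompactSupport_nonneg_nonzero
    (hasCompactSupport_of_bump hρ.le fun η h => by simp [h])
    (fun η => pow_nonneg (bump_nonneg ρ η) 3) (x := 0) ?_
  simp [bump, hρ.ne']

section Score

variable {F : Type*} [NormedAddCommGroup F] [NormedSpace ℝ F] {M : F →L[ℝ] F →L[ℝ] ℝ}
  {A G : E →L[ℝ] F} {p : E → ℝ} {ψ : E → E}

-- Integration by parts against the gradient `p * bump ^ 2 * (bump • ψ - 6 • η)` of `p * bump ^ 3`.
lemma integral_score_eq (hρ : 0 ≤ ρ) (q : F) (hψ : Continuous ψ)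
    (hp : ∀ η, HasFDerivAt p (p η • innerSL ℝ (ψ η)) η) :
    ∫ η, p η * (bump ρ η ^ 2 * M (q - A η) (G (bump ρ η • ψ η - (6 : ℝ) • η))) ∂μ
      = (∑ j, M (A (e j)) (G (e j))) * ∫ η, p η * bump ρ η ^ 3 ∂μ := by
  have hpc : Continuous p := continuous_iff_continuousAt.2 fun η => (hp η).continuousAt
  have h := integral_affine_apply_gradient μ e ((M q).comp G) (M.bilinearComp A G)
    (g := fun η => p η * bump ρ η ^ 3)
    (g' := fun η => (p η * bump ρ η ^ 2) • (bump ρ η • ψ η - (6 : ℝ) • η))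
    (hasCompactSupport_of_bump hρ fun η h => by simp [h]) (by fun_prop) fun η =>
      ((hp η).mul (hasFDerivAt_bump_pow ρ 1 η)).congr_fderiv <| by
        ext v
        simp
        ring
  simp only [ContinuousLinearMap.bilinearComp_apply] at h
  rw [← h]
  refine integral_congr_ae (ae_of_all _ fun η => ?_)
  simp only [sub_apply, ContinuousLinearMap.comp_apply, ContinuousLinearMap.bilinearComp_apply,
    map_sub, map_smul, smul_eq_mul]
  ring

lemma ofReal_sum_mul_lintegral_le (hρ : 0 ≤ ρ) (hM : ∀ x, 0 ≤ M x x)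
    (hM' : ∀ x y, M x y = M y x) (q : F) (hp₀ : ∀ η, 0 ≤ p η) (hψ : Continuous ψ)
    (hp : ∀ η, HasFDerivAt p (p η • innerSL ℝ (ψ η)) η) :
    ENNReal.ofReal (∑ j, M (A (e j)) (G (e j)))
        * ∫⁻ η, ENNReal.ofReal (p η) * ENNReal.ofReal (bump ρ η ^ 3) ∂μ
      ≤ ∫⁻ η, ENNReal.ofReal (p η) * ENNReal.ofReal (bump ρ η ^ 3)
          * ENNReal.ofReal (M (q - A η) (q - A η) / 2) ∂μ
        + ∫⁻ η, ENNReal.ofReal (p η) * ENNReal.ofReal (bump ρ η / 2)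
          * ENNReal.ofReal (M (G (bump ρ η • ψ η - (6 : ℝ) • η))
              (G (bump ρ η • ψ η - (6 : ℝ) • η))) ∂μ := by
  have hpc : Continuous p := continuous_iff_continuousAt.2 fun η => (hp η).continuousAt
  set w : E → E := fun η => bump ρ η • ψ η - (6 : ℝ) • η
  have hw : Continuous w := by fun_prop
  have hcube : ∀ η, 0 ≤ p η * bump ρ η ^ 3 := fun η =>
    mul_nonneg (hp₀ η) (pow_nonneg (bump_nonneg ρ η) 3)
  have hhalf : ∀ η, 0 ≤ p η * (bump ρ η / 2) := fun η =>
    mul_nonneg (hp₀ η) (div_nonneg (bump_nonneg ρ η) zero_le_two)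
  have hloss : ∀ η, 0 ≤ p η * bump ρ η ^ 3 * (M (q - A η) (q - A η) / 2) := fun η =>
    mul_nonneg (hcube η) (div_nonneg (hM _) zero_le_two)
  have hinfo : ∀ η, 0 ≤ p η * (bump ρ η / 2) * M (G (w η)) (G (w η)) := fun η =>
    mul_nonneg (hhalf η) (hM _)
  have hcauchy : ∀ η, p η * (bump ρ η ^ 2 * M (q - A η) (G (w η)))
      ≤ p η * bump ρ η ^ 3 * (M (q - A η) (q - A η) / 2)
        + p η * (bump ρ η / 2) * M (G (w η)) (G (w η)) := by
    intro η
    have h := mul_nonneg (hhalf η) (hM (bump ρ η • (q - A η) - G (w η)))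
    simp only [map_sub _ (bump ρ η • (q - A η)), sub_apply, map_smul, smul_apply, smul_eq_mul,
      hM' (G (w η)) (q - A η)] at h
    linarith
  simp_rw [← ENNReal.ofReal_mul (hp₀ _), ← ENNReal.ofReal_mul (hcube _),
    ← ENNReal.ofReal_mul (hhalf _)]
  have hint : ∀ {f : E → ℝ}, Continuous f → (∀ η, bump ρ η = 0 → f η = 0) → Integrable f μ :=
    fun hc hf => integrable_of_bump hρ μ hc hf
  rw [← lintegral_add_left (Continuous.measurable (by fun_prop)).ennreal_ofReal,
    ← ofReal_integral_eq_lintegral_ofReal (hint (by fun_prop) fun η h => by simp [h])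
      (ae_of_all _ hcube), ← ENNReal.ofReal_mul' (integral_nonneg hcube),
    ← integral_score_eq μ e hρ q hψ hp]
  rw [lintegral_congr fun η => (ENNReal.ofReal_add (hloss η) (hinfo η)).symm,
    ← ofReal_integral_eq_lintegral_ofReal (hint (by fun_prop) fun η h => by simp [h])
    (ae_of_all _ fun η => add_nonneg (hloss η) (hinfo η))]
  exact ENNReal.ofReal_le_ofReal (integral_mono (hint (by fun_prop) fun η h => by simp [h])
    (hint (by fun_prop) fun η h => by simp [h]) hcauchy)

lemma lintegral_bump_mul_eq (hρ : 0 < ρ) (hM : ∀ x, 0 ≤ M x x) {b : ℝ} (hb : 0 ≤ b) :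
    ∫⁻ η, ENNReal.ofReal (bump ρ η / 2)
        * ENNReal.ofReal (bump ρ η ^ 2 * b + 36 * M (G η) (G η)) ∂μ
      = ENNReal.ofReal (b / 2 + 9 / 2 * ((1 + Module.finrank ℝ E / 6) / ρ ^ 2)
          * ∑ j, M (G (e j)) (G (e j))) * ∫⁻ η, ENNReal.ofReal (bump ρ η ^ 3) ∂μ := by
  have hb3 : ∀ η : E, 0 ≤ bump ρ η ^ 3 := fun η => pow_nonneg (bump_nonneg ρ η) 3
  have hb1 : ∀ η : E, 0 ≤ bump ρ η / 2 := fun η => div_nonneg (bump_nonneg ρ η) zero_le_two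
  have hnonneg : ∀ η, 0 ≤ bump ρ η / 2 * (bump ρ η ^ 2 * b + 36 * M (G η) (G η)) := fun η =>
    mul_nonneg (hb1 η) (add_nonneg (mul_nonneg (sq_nonneg _) hb)
      (mul_nonneg (by norm_num) (hM _)))
  have hint : ∀ {f : E → ℝ}, Continuous f → (∀ η, bump ρ η = 0 → f η = 0) → Integrable f μ :=
    fun hc hf => integrable_of_bump hρ.le μ hc hf
  have hquad := integral_bump_pow_mul_apply_self μ e hρ.le 0 (M.bilinearComp G G)
  have hsq := sq_mul_integral_bump_sq μ hρ.le
  simp only [ContinuousLinearMap.bilinearComp_apply, CharP.cast_eq_zero, zero_add, pow_one] at hquad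
  simp_rw [← ENNReal.ofReal_mul (hb1 _)]
  rw [← ofReal_integral_eq_lintegral_ofReal (hint (by fun_prop) fun η h => by simp [h])
      (ae_of_all _ hnonneg),
    ← ofReal_integral_eq_lintegral_ofReal (hint (by fun_prop) fun η h => by simp [h])
      (ae_of_all _ hb3), ← ENNReal.ofReal_mul' (integral_nonneg hb3)]
  have hexpand : ∀ η, bump ρ η / 2 * (bump ρ η ^ 2 * b + 36 * M (G η) (G η))
      = b / 2 * bump ρ η ^ 3 + 18 * (bump ρ η * M (G η) (G η)) := fun η => by ring
  simp_rw [hexpand]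
  rw [integral_add (hint (by fun_prop) fun η h => by simp [h])
    (hint (by fun_prop) fun η h => by simp [h]), integral_const_mul, integral_const_mul]
  congr 1
  rw [eq_div_of_mul_eq (by positivity) ((mul_comm _ _).trans hsq)] at hquad
  linear_combination (9 / 2) * hquad

end Score

/-- The laws `Q η` have the densities `p η` with respect to `ν`, which depend smoothly on the
parameter `η`, and `ψ` is the gradient of the log-likelihood `η ↦ log (p η τ)`. It is written as
`∇ p = p • ψ`, which does not need `p` to be positive. -/
structure HasScore {𝒯 : Type*} [MeasurableSpace 𝒯] (Q : E → Measure 𝒯) (ν : Measure 𝒯)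
    (p : E → 𝒯 → ℝ) (ψ : E → 𝒯 → E) : Prop where
  law_eq : ∀ η, Q η = ν.withDensity fun τ => ENNReal.ofReal (p η τ)
  density_nonneg : ∀ η τ, 0 ≤ p η τ
  measurable_density : Measurable fun x : E × 𝒯 => p x.1 x.2
  measurable_score : Measurable fun x : E × 𝒯 => ψ x.1 x.2
  continuous_score : ∀ τ, Continuous fun η => ψ η τ
  hasFDerivAt_density : ∀ η τ, HasFDerivAt (fun η => p η τ) (p η τ • innerSL ℝ (ψ η τ)) η

namespace HasScore

variable {𝒯 : Type*} [MeasurableSpace 𝒯] {Q : E → Measure 𝒯} {ν : Measure 𝒯} [SFinite ν]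
  {p : E → 𝒯 → ℝ} {ψ : E → 𝒯 → E} (h : HasScore Q ν p ψ)
include h

omit [FiniteDimensional ℝ E] [BorelSpace E] in
lemma lintegral_lintegral_density_mul (κ : Measure E) [SFinite κ]
    {g : E → ℝ≥0∞} (hg : Measurable g) {f : E → 𝒯 → ℝ≥0∞}
    (hf : Measurable fun x : E × 𝒯 => f x.1 x.2) :
    ∫⁻ τ, ∫⁻ η, ENNReal.ofReal (p η τ) * g η * f η τ ∂κ ∂ν
      = ∫⁻ η, g η * ∫⁻ τ, f η τ ∂(Q η) ∂κ := by
  have hp : Measurable fun x : E × 𝒯 => ENNReal.ofReal (p x.1 x.2) :=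
    h.measurable_density.ennreal_ofReal
  have hm : Measurable (Function.uncurry fun τ η => ENNReal.ofReal (p η τ) * g η * f η τ) :=
    ((hp.mul (hg.comp measurable_fst)).mul hf).comp measurable_swap
  rw [lintegral_lintegral_swap hm.aemeasurable]
  refine lintegral_congr fun η => ?_
  have hpη : Measurable fun τ => ENNReal.ofReal (p η τ) := hp.comp measurable_prodMk_left
  have hfη : Measurable (f η) := hf.comp measurable_prodMk_left
  rw [h.law_eq, lintegral_withDensity_eq_lintegral_mul _ hpη hfη,
    ← lintegral_const_mul _ (hpη.mul hfη)]
  exact lintegral_congr fun τ => by simp only [Pi.mul_apply]; ring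

variable {F : Type*} [NormedAddCommGroup F] [NormedSpace ℝ F] {M : F →L[ℝ] F →L[ℝ] ℝ}
  (A G : E →L[ℝ] F)

variable [∀ η, IsProbabilityMeasure (Q η)] (hM : ∀ x, 0 ≤ M x x) {R : E → 𝒯 → ℝ≥0∞}
include hM

lemma ofReal_sum_mul_lintegral_bump_le (hρ : 0 ≤ ρ) (hM' : ∀ x y, M x y = M y x)
    (hR : Measurable fun x : E × 𝒯 => R x.1 x.2)
    (hRA : ∀ τ, (∃ q, ∀ η, ENNReal.ofReal (M (q - A η) (q - A η) / 2) ≤ R η τ)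
      ∨ ∀ η, ENNReal.ofReal (∑ j, M (A (e j)) (G (e j))) ≤ R η τ) :
    ENNReal.ofReal (∑ j, M (A (e j)) (G (e j))) * ∫⁻ η, ENNReal.ofReal (bump ρ η ^ 3) ∂μ
      ≤ ∫⁻ η, ENNReal.ofReal (bump ρ η ^ 3) * ∫⁻ τ, R η τ ∂(Q η) ∂μ
        + ∫⁻ η, ENNReal.ofReal (bump ρ η / 2)
          * ∫⁻ τ, ENNReal.ofReal (M (G (bump ρ η • ψ η τ - (6 : ℝ) • η))
              (G (bump ρ η • ψ η τ - (6 : ℝ) • η))) ∂(Q η) ∂μ := by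
  have hcube : Measurable fun η : E => ENNReal.ofReal (bump ρ η ^ 3) :=
    Measurable.ennreal_ofReal (Continuous.measurable (by fun_prop))
  have hhalf : Measurable fun η : E => ENNReal.ofReal (bump ρ η / 2) :=
    Measurable.ennreal_ofReal (Continuous.measurable (by fun_prop))
  set w : E → 𝒯 → E := fun η τ => bump ρ η • ψ η τ - (6 : ℝ) • η
  have hw : Measurable fun x : E × 𝒯 => ENNReal.ofReal (M (G (w x.1 x.2)) (G (w x.1 x.2))) := by
    have hwm : Measurable fun x : E × 𝒯 => w x.1 x.2 :=
      (((continuous_bump ρ).measurable.comp measurable_fst).smul h.measurable_score).sub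
        (measurable_fst.const_smul _)
    have hMG : Continuous fun x => M (G x) (G x) := by fun_prop
    exact (hMG.measurable.comp hwm).ennreal_ofReal
  have hpoint : ∀ τ, ENNReal.ofReal (∑ j, M (A (e j)) (G (e j)))
        * ∫⁻ η, ENNReal.ofReal (p η τ) * ENNReal.ofReal (bump ρ η ^ 3) ∂μ
      ≤ ∫⁻ η, ENNReal.ofReal (p η τ) * ENNReal.ofReal (bump ρ η ^ 3) * R η τ ∂μ
        + ∫⁻ η, ENNReal.ofReal (p η τ) * ENNReal.ofReal (bump ρ η / 2)
          * ENNReal.ofReal (M (G (w η τ)) (G (w η τ))) ∂μ := by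
    intro τ
    rcases hRA τ with ⟨q, hq⟩ | hfar
    · refine (ofReal_sum_mul_lintegral_le μ e hρ hM hM' q (h.density_nonneg · τ)
        (h.continuous_score τ) (h.hasFDerivAt_density · τ)).trans (add_le_add_left ?_ _)
      exact lintegral_mono fun η => mul_le_mul_right (hq η) _
    · refine le_add_of_le_left ?_
      rw [mul_comm, ← lintegral_mul_const' _ _ ENNReal.ofReal_ne_top]
      exact lintegral_mono fun η => mul_le_mul_right (hfar η) _
  have hmass : ∫⁻ τ, ∫⁻ η, ENNReal.ofReal (p η τ) * ENNReal.ofReal (bump ρ η ^ 3) ∂μ ∂ν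
      = ∫⁻ η, ENNReal.ofReal (bump ρ η ^ 3) ∂μ := by
    simpa using h.lintegral_lintegral_density_mul μ hcube (f := fun _ _ => 1) measurable_const
  have hmeas : Measurable fun τ =>
      ∫⁻ η, ENNReal.ofReal (p η τ) * ENNReal.ofReal (bump ρ η ^ 3) * R η τ ∂μ :=
    Measurable.lintegral_prod_left' ((h.measurable_density.ennreal_ofReal.mul
      (hcube.comp measurable_fst)).mul hR)
  rw [← hmass, ← lintegral_const_mul' _ _ ENNReal.ofReal_ne_top,
    ← h.lintegral_lintegral_density_mul μ hcube hR, ← h.lintegral_lintegral_density_mul μ hhalf hw,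
    ← lintegral_add_left hmeas]
  exact lintegral_mono hpoint

theorem vanTrees (hρ : 0 < ρ) (hM' : ∀ x y, M x y = M y x)
    (hR : Measurable fun x : E × 𝒯 => R x.1 x.2)
    (hRA : ∀ τ, (∃ q, ∀ η, ENNReal.ofReal (M (q - A η) (q - A η) / 2) ≤ R η τ)
      ∨ ∀ η, ENNReal.ofReal (∑ j, M (A (e j)) (G (e j))) ≤ R η τ)
    {V : ℝ≥0∞} (hV : ∀ η, ‖η‖ ≤ ρ → ∫⁻ τ, R η τ ∂(Q η) ≤ V) {b : ℝ} (hb₀ : 0 ≤ b)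
    (hb : ∀ η, ‖η‖ ≤ ρ → ∀ c x,
      ∫⁻ τ, ENNReal.ofReal (M (G (c • ψ η τ + x)) (G (c • ψ η τ + x))) ∂(Q η)
        ≤ ENNReal.ofReal (c ^ 2 * b + M (G x) (G x))) :
    ENNReal.ofReal (∑ j, M (A (e j)) (G (e j)))
      ≤ V + ENNReal.ofReal (b / 2 + 9 / 2 * ((1 + Module.finrank ℝ E / 6) / ρ ^ 2)
        * ∑ j, M (G (e j)) (G (e j))) := by
  have hcube : Measurable fun η : E => ENNReal.ofReal (bump ρ η ^ 3) :=
    Measurable.ennreal_ofReal (Continuous.measurable (by fun_prop))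
  have hB : ∫⁻ η : E, ENNReal.ofReal (bump ρ η ^ 3) = ENNReal.ofReal (∫ η : E, bump ρ η ^ 3) :=
    (ofReal_integral_eq_lintegral_ofReal (integrable_of_bump hρ.le volume (by fun_prop)
      fun η h => by simp [h]) (ae_of_all _ fun η => pow_nonneg (bump_nonneg ρ η) 3)).symm
  have hB₀ : ∫⁻ η : E, ENNReal.ofReal (bump ρ η ^ 3) ≠ 0 := by
    rw [hB]
    exact (ENNReal.ofReal_pos.2 (integral_bump_cube_pos volume hρ)).ne'
  have hloss : ∫⁻ η, ENNReal.ofReal (bump ρ η ^ 3) * ∫⁻ τ, R η τ ∂(Q η)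
      ≤ V * ∫⁻ η : E, ENNReal.ofReal (bump ρ η ^ 3) := by
    rw [mul_comm, ← lintegral_mul_const _ hcube]
    refine lintegral_mono fun η => ?_
    rcases eq_or_ne (bump ρ η) 0 with h0 | h0
    · simp [h0]
    · exact mul_le_mul_right (hV η (norm_le_of_bump_ne_zero hρ.le h0)) _
  have hinfo : ∫⁻ η, ENNReal.ofReal (bump ρ η / 2)
        * ∫⁻ τ, ENNReal.ofReal (M (G (bump ρ η • ψ η τ - (6 : ℝ) • η))
              (G (bump ρ η • ψ η τ - (6 : ℝ) • η))) ∂(Q η)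
      ≤ ENNReal.ofReal (b / 2 + 9 / 2 * ((1 + Module.finrank ℝ E / 6) / ρ ^ 2)
        * ∑ j, M (G (e j)) (G (e j))) * ∫⁻ η : E, ENNReal.ofReal (bump ρ η ^ 3) := by
    rw [← lintegral_bump_mul_eq volume e hρ hM hb₀]
    refine lintegral_mono fun η => ?_
    rcases eq_or_ne (bump ρ η) 0 with h0 | h0
    · simp [h0]
    · have hη := hb η (norm_le_of_bump_ne_zero hρ.le h0) (bump ρ η) (-((6 : ℝ) • η))
      have hM36 : M (G (-((6 : ℝ) • η))) (G (-((6 : ℝ) • η))) = 36 * M (G η) (G η) := by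
        simp only [map_neg, map_smul, neg_apply, smul_apply, smul_eq_mul]
        ring
      simp only [← sub_eq_add_neg, hM36] at hη
      exact mul_le_mul_right hη _
  refine (ENNReal.mul_le_mul_iff_left hB₀ (hB ▸ ENNReal.ofReal_ne_top)).1 ?_
  rw [add_mul]
  exact (h.ofReal_sum_mul_lintegral_bump_le volume e A G hM hρ.le hM' hR hRA).trans
    (add_le_add hloss hinfo)

end HasScore

end Prior
/-! ### The likelihood of a trajectory -/

lemma lintegral_gaussianReal_shift {v : ℝ≥0} (hv : v ≠ 0) (a : ℝ) {f : ℝ → ℝ≥0∞}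
    (hf : Measurable f) :
    ∫⁻ w, f (a + w) ∂(gaussianReal 0 v)
      = ∫⁻ w, f w * ENNReal.ofReal (Real.exp (a * w / v - a ^ 2 / (2 * v)))
          ∂(gaussianReal 0 v) := by
  have hshift : ∫⁻ w, f (a + w) ∂(gaussianReal 0 v) = ∫⁻ w, f w ∂(gaussianReal a v) := by
    rw [← lintegral_map hf (measurable_const_add a), gaussianReal_map_const_add, zero_add]
  have : (0 : ℝ) < v := by positivity
  rw [hshift, gaussianReal_of_var_ne_zero _ hv, gaussianReal_of_var_ne_zero _ hv,
    lintegral_withDensity_eq_lintegral_mul _ (measurable_gaussianPDF _ _) hf,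
    lintegral_withDensity_eq_lintegral_mul _ (measurable_gaussianPDF _ _) (by fun_prop)]
  refine lintegral_congr fun w => ?_
  simp only [Pi.mul_apply, gaussianPDF, gaussianPDFReal]
  rw [mul_comm (f w), ← mul_assoc, ← ENNReal.ofReal_mul (by positivity),
    mul_assoc (√(2 * Real.pi * v))⁻¹, ← Real.exp_add]
  congr 4
  field_simp
  ring

section Likelihood

variable {Ω : Type*} [mΩ : MeasurableSpace Ω] {d dᵤ T : ℕ} (σ : ℝ≥0) (θ₀ η : Vec d)

/-- The likelihood ratio of the trajectory for the model `θ₀ + η` against the model `θ₀`. -/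
noncomputable def likelihoodRatio (τ : Traj d dᵤ T) : ℝ :=
  Real.exp (∑ t, (inner ℝ η (τ t).2.1 * ((τ t).2.2 - inner ℝ θ₀ (τ t).2.1) / σ ^ 2
    - inner ℝ η (τ t).2.1 ^ 2 / (2 * σ ^ 2)))

/-- The score of the trajectory at the model `θ`: the gradient in `θ` of its log-likelihood. -/
noncomputable def trajScore (θ : Vec d) (τ : Traj d dᵤ T) : Vec d :=
  ((σ : ℝ) ^ 2)⁻¹ • ∑ t, ((τ t).2.2 - inner ℝ θ (τ t).2.1) • (τ t).2.1

lemma measurable_likelihoodRatio :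
    Measurable fun p : Vec d × Traj d dᵤ T => likelihoodRatio σ θ₀ p.1 p.2 := by
  unfold likelihoodRatio
  fun_prop

lemma measurable_likelihoodRatio_right :
    Measurable fun τ : Traj d dᵤ T => likelihoodRatio σ θ₀ η τ := by
  unfold likelihoodRatio
  fun_prop

lemma measurable_trajScore :
    Measurable fun p : Vec d × Traj d dᵤ T => trajScore σ p.1 p.2 := by
  unfold trajScore
  fun_prop

lemma likelihoodRatio_snoc (τ : Traj d dᵤ T) (u : Vec dᵤ) (z : Vec d) (y : ℝ) :
    likelihoodRatio σ θ₀ η (Fin.snoc τ (u, z, y) : Traj d dᵤ (T + 1))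
      = likelihoodRatio σ θ₀ η τ * Real.exp (inner ℝ η z * (y - inner ℝ θ₀ z) / σ ^ 2
          - inner ℝ η z ^ 2 / (2 * σ ^ 2)) := by
  simp only [likelihoodRatio, Fin.sum_univ_castSucc, Fin.snoc_castSucc, Fin.snoc_last,
    Real.exp_add]

variable {σ} in
lemma hasFDerivAt_likelihoodRatio (hσ : σ ≠ 0) (τ : Traj d dᵤ T) :
    HasFDerivAt (fun η => likelihoodRatio σ θ₀ η τ)
      (likelihoodRatio σ θ₀ η τ • innerSL ℝ (trajScore σ (θ₀ + η) τ)) η := by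
  have hσ' : (σ : ℝ) ≠ 0 := by positivity
  have hinner (z : Vec d) : HasFDerivAt (fun η : Vec d => inner ℝ η z) (innerSL ℝ z) η := by
    simpa [real_inner_comm] using (innerSL ℝ z).hasFDerivAt (x := η)
  have hterm (z : Vec d) (y : ℝ) : HasFDerivAt
      (fun η : Vec d => inner ℝ η z * (y - inner ℝ θ₀ z) / σ ^ 2 - inner ℝ η z ^ 2 / (2 * σ ^ 2))
      (((σ : ℝ) ^ 2)⁻¹ • (y - inner ℝ (θ₀ + η) z) • innerSL ℝ z) η := by
    refine ((((hinner z).mul_const _).mul_const ((σ : ℝ) ^ 2)⁻¹).sub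
      (((hinner z).pow 2).mul_const (2 * (σ : ℝ) ^ 2)⁻¹)).congr_fderiv ?_
    ext v
    simp only [sub_apply, smul_apply, innerSL_apply_apply, smul_eq_mul, inner_add_left]
    field_simp
    ring
  refine ((HasFDerivAt.fun_sum fun t (_ : t ∈ Finset.univ) =>
    hterm (τ t).2.1 (τ t).2.2).exp).congr_fderiv ?_
  simp only [likelihoodRatio, trajScore, map_smul, map_sum, Finset.smul_sum]

lemma measurable_snoc :
    Measurable fun p : Traj d dᵤ T × (Vec dᵤ × Vec d × ℝ) =>
      (Fin.snoc p.1 p.2 : Traj d dᵤ (T + 1)) := by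
  refine measurable_pi_lambda _ fun i => ?_
  refine Fin.lastCases ?_ (fun j => ?_) i
  · simpa using measurable_snd
  · simp only [Fin.snoc_castSucc]
    fun_prop

/-- The mean of `F` over the next step of the trajectory `τ` under the model `θ`, where `κ` is the
conditional law of the next input and covariate. -/
noncomputable def stepLIntegral (κ : Kernel (Traj d dᵤ T) (Vec dᵤ × Vec d)) (θ : Vec d)
    (F : Traj d dᵤ (T + 1) → ℝ≥0∞) (τ : Traj d dᵤ T) : ℝ≥0∞ :=
  ∫⁻ x, ∫⁻ w, F (Fin.snoc τ (x.1, x.2, inner ℝ θ x.2 + w)) ∂(gaussianReal 0 (σ ^ 2)) ∂(κ τ)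

section Step

variable (κ : Kernel (Traj d dᵤ T) (Vec dᵤ × Vec d)) (θ : Vec d)
  {F : Traj d dᵤ (T + 1) → ℝ≥0∞} (hF : Measurable F)

include hF

lemma measurable_comp_snoc : Measurable fun p : (Traj d dᵤ T × Vec dᵤ × Vec d) × ℝ =>
    F (Fin.snoc p.1.1 (p.1.2.1, p.1.2.2, inner ℝ θ p.1.2.2 + p.2)) :=
  hF.comp (measurable_snoc.comp (f := fun p : (Traj d dᵤ T × Vec dᵤ × Vec d) × ℝ =>
    (p.1.1, (p.1.2.1, p.1.2.2, inner ℝ θ p.1.2.2 + p.2))) (by fun_prop))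

lemma measurable_stepLIntegral [IsSFiniteKernel κ] : Measurable (stepLIntegral σ κ θ F) :=
  (measurable_comp_snoc θ hF).lintegral_prod_right'.lintegral_kernel_prod_right'

variable {σ} in
lemma stepLIntegral_add_mul_likelihoodRatio (hσ : σ ≠ 0) (τ : Traj d dᵤ T) :
    stepLIntegral σ κ (θ₀ + η) F τ * ENNReal.ofReal (likelihoodRatio σ θ₀ η τ)
      = stepLIntegral σ κ θ₀ (fun τ => F τ * ENNReal.ofReal (likelihoodRatio σ θ₀ η τ)) τ := by
  unfold stepLIntegral
  rw [← lintegral_mul_const' _ _ ENNReal.ofReal_ne_top]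
  refine lintegral_congr fun x => ?_
  have hshift := lintegral_gaussianReal_shift (pow_ne_zero 2 hσ) (inner ℝ η x.2)
    ((measurable_comp_snoc θ₀ hF).comp (measurable_prodMk_left (x := (τ, x))))
  simp only [Function.comp_apply, ← add_assoc, ← inner_add_left] at hshift
  rw [hshift, ← lintegral_mul_const' _ _ ENNReal.ofReal_ne_top]
  refine lintegral_congr fun w => ?_
  dsimp only
  rw [likelihoodRatio_snoc, ENNReal.ofReal_mul' (Real.exp_pos _).le, mul_assoc,
    mul_comm (ENNReal.ofReal (likelihoodRatio _ _ _ _)), add_sub_cancel_left, NNReal.coe_pow]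

end Step

namespace Observations

variable {X : Observations Ω d dᵤ} {P : Vec d → Measure Ω} {σ}

lemma traj_succ (X : Observations Ω d dᵤ) (T : ℕ) (ω : Ω) :
    X.traj (T + 1) ω = Fin.snoc (X.traj T ω) (X.u T ω, X.z T ω, X.y T ω) := by
  funext i
  refine Fin.lastCases ?_ (fun j => ?_) i <;> simp [traj]

lemma IsLaw.lintegral_traj_succ {P : Measure Ω} {θ : Vec d} (h : X.IsLaw σ θ P)
    {κ : Kernel (Traj d dᵤ T) (Vec dᵤ × Vec d)} [IsSFiniteKernel κ]
    (hκ : P.map (fun ω => (X.traj T ω, (X.u T ω, X.z T ω))) = (P.map (X.traj T)) ⊗ₘ κ)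
    {F : Traj d dᵤ (T + 1) → ℝ≥0∞} (hF : Measurable F) :
    ∫⁻ ω, F (X.traj (T + 1) ω) ∂P = ∫⁻ ω, stepLIntegral σ κ θ F (X.traj T ω) ∂P := by
  have := h.prob
  have hstate : Measurable[X.ℱ T] fun ω => (X.traj T ω, (X.u T ω, X.z T ω)) :=
    (X.measurable_traj T).prodMk ((X.u_meas T).prodMk (X.z_meas T))
  have hFm := measurable_comp_snoc θ hF
  calc ∫⁻ ω, F (X.traj (T + 1) ω) ∂P
      = ∫⁻ ω, ∫⁻ w, F (Fin.snoc (X.traj T ω) (X.u T ω, X.z T ω, inner ℝ θ (X.z T ω) + w))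
          ∂(gaussianReal 0 (σ ^ 2)) ∂P := by
        rw [← h.lintegral_noise T hstate hFm]
        simp only [X.traj_succ, noise, add_sub_cancel]
    _ = ∫⁻ p, ∫⁻ w, F (Fin.snoc p.1 (p.2.1, p.2.2, inner ℝ θ p.2.2 + w))
          ∂(gaussianReal 0 (σ ^ 2)) ∂(P.map (X.traj T) ⊗ₘ κ) := by
        rw [← hκ, lintegral_map hFm.lintegral_prod_right' (hstate.mono (X.ℱ.le T) le_rfl)]
    _ = ∫⁻ ω, stepLIntegral σ κ θ F (X.traj T ω) ∂P := by
        rw [Measure.lintegral_compProd hFm.lintegral_prod_right', ← lintegral_map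
          (measurable_stepLIntegral σ κ θ hF) ((X.measurable_traj T).mono (X.ℱ.le T) le_rfl)]
        rfl

theorem SameExploration.lintegral_traj_add (hexp : X.SameExploration P) (hσ : σ ≠ 0)
    (hlaw : ∀ θ, X.IsLaw σ θ (P θ)) (T : ℕ) {F : Traj d dᵤ T → ℝ≥0∞} (hF : Measurable F) :
    ∫⁻ ω, F (X.traj T ω) ∂(P (θ₀ + η))
      = ∫⁻ ω, F (X.traj T ω) * ENNReal.ofReal (likelihoodRatio σ θ₀ η (X.traj T ω)) ∂(P θ₀) := by
  have hprob := fun θ => (hlaw θ).prob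
  induction T with
  | zero =>
    have htraj (ω) : X.traj 0 ω = default := Subsingleton.elim _ _
    simp [htraj, likelihoodRatio]
  | succ T ih =>
    obtain ⟨κ, _, hκ⟩ := hexp T
    rw [(hlaw _).lintegral_traj_succ (hκ _) hF, ih (measurable_stepLIntegral σ κ _ hF),
      (hlaw θ₀).lintegral_traj_succ (hκ _)
        (F := fun τ => F τ * ENNReal.ofReal (likelihoodRatio σ θ₀ η τ))
        (hF.mul (measurable_likelihoodRatio_right σ θ₀ η).ennreal_ofReal)]
    exact lintegral_congr fun ω => stepLIntegral_add_mul_likelihoodRatio θ₀ η κ hF hσ _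

theorem SameExploration.hasScore (hexp : X.SameExploration P) (hσ : σ ≠ 0)
    (hlaw : ∀ θ, X.IsLaw σ θ (P θ)) (T : ℕ) :
    HasScore (fun η => (P (θ₀ + η)).map (X.traj T)) ((P θ₀).map (X.traj T))
      (fun η τ => likelihoodRatio σ θ₀ η τ) (fun η τ => trajScore σ (θ₀ + η) τ) where
  law_eq η := by
    have htraj := (X.measurable_traj T).mono (X.ℱ.le T) le_rfl
    have hlr := (measurable_likelihoodRatio_right (dᵤ := dᵤ) (T := T) σ θ₀ η).ennreal_ofReal
    refine Measure.ext_of_lintegral _ fun F hF => ?_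
    rw [lintegral_withDensity_eq_lintegral_mul _ hlr hF, lintegral_map hF htraj,
      lintegral_map (hlr.mul hF) htraj, hexp.lintegral_traj_add θ₀ η hσ hlaw T hF]
    simp only [Pi.mul_apply, mul_comm]
  density_nonneg η τ := (Real.exp_pos _).le
  measurable_density := measurable_likelihoodRatio σ θ₀
  measurable_score := (measurable_trajScore σ).comp (f := fun p : Vec d × Traj d dᵤ T =>
    (θ₀ + p.1, p.2)) (by fun_prop)
  continuous_score τ := by
    unfold trajScore
    fun_prop
  hasFDerivAt_density η τ := hasFDerivAt_likelihoodRatio θ₀ η hσ τ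

lemma trajScore_traj (X : Observations Ω d dᵤ) (σ : ℝ≥0) (θ : Vec d) (T : ℕ) (ω : Ω) :
    trajScore σ θ (X.traj T ω) = ((σ : ℝ) ^ 2)⁻¹ • X.noiseSum θ T ω := by
  rw [noiseSum, Finset.sum_range]
  rfl

variable {P : Measure Ω} {θ : Vec d}

lemma IsLaw.lintegral_inner_score_sq (h : X.IsLaw σ θ P) (hσ : σ ≠ 0)
    (hz : ∀ t < T, MemLp (X.z t) 2 P) (v : Vec d) (c : ℝ) (x : Vec d) :
    ∫⁻ ω, ENNReal.ofReal (inner ℝ v (c • trajScore σ θ (X.traj T ω) + x) ^ 2) ∂P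
      = ENNReal.ofReal (c ^ 2 / σ ^ 2 * inner ℝ v (op (X.meanCov P T) v) + inner ℝ v x ^ 2) := by
  have hσ' : (σ : ℝ) ≠ 0 := by positivity
  set a : ℝ := c / (σ : ℝ) ^ 2 with ha
  have hscore (ω) : inner ℝ v (c • trajScore σ θ (X.traj T ω) + x)
      = inner ℝ v x + inner ℝ (a • v) (X.noiseSum θ T ω) := by
    rw [inner_add_right, trajScore_traj, smul_smul, inner_smul_right, real_inner_smul_left, ha,
      div_eq_mul_inv, add_comm]
  have hcov : ∫⁻ ω, ENNReal.ofReal (inner ℝ (a • v) (op (X.cov T ω) (a • v))) ∂P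
      = ENNReal.ofReal (a ^ 2 * inner ℝ v (op (X.meanCov P T) v)) := by
    rw [← ofReal_integral_eq_lintegral_ofReal (X.integrable_inner_op_cov hz _ _)
      (ae_of_all _ fun ω => X.inner_op_cov_self_nonneg _ T ω), ← X.inner_op_meanCov hz, map_smul,
      real_inner_smul_left, real_inner_smul_right, ← mul_assoc, sq]
  have hmean := X.inner_op_meanCov_self_nonneg hz v
  simp_rw [hscore]
  rw [h.lintegral_sq, hcov, ← ENNReal.ofReal_mul (by positivity),
    ← ENNReal.ofReal_add (by positivity) (by positivity), ha]
  congr 1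
  field_simp
  ring

lemma IsLaw.lintegral_sum_inner_score_sq (h : X.IsLaw σ θ P) (hσ : σ ≠ 0)
    (hz : ∀ t < T, MemLp (X.z t) 2 P) {ι : Type*} [Fintype ι] (v : ι → Vec d) (c : ℝ)
    (x : Vec d) :
    ∫⁻ ω, ENNReal.ofReal (∑ i, inner ℝ (v i) (c • trajScore σ θ (X.traj T ω) + x) ^ 2) ∂P
      = ENNReal.ofReal (c ^ 2 / σ ^ 2 * ∑ i, inner ℝ (v i) (op (X.meanCov P T) (v i))
          + ∑ i, inner ℝ (v i) x ^ 2) := by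
  have htraj := (X.measurable_traj T).mono (X.ℱ.le T) le_rfl
  have hscore : Measurable fun ω => trajScore σ θ (X.traj T ω) :=
    (measurable_trajScore σ).comp (f := fun ω => (θ, X.traj T ω)) (by fun_prop)
  have hmean (i) := X.inner_op_meanCov_self_nonneg hz (v i)
  simp_rw [ENNReal.ofReal_sum_of_nonneg fun i (_ : i ∈ Finset.univ) =>
    sq_nonneg (inner ℝ (v i) _)]
  rw [lintegral_finsetSum _ fun i _ => by fun_prop, Finset.mul_sum, ← Finset.sum_add_distrib,
    ENNReal.ofReal_sum_of_nonneg fun i _ => by have := hmean i; positivity]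
  exact Finset.sum_congr rfl fun i _ => h.lintegral_inner_score_sq hσ hz (v i) c x

end Observations

end Likelihood

/-! ### The Bayesian lower bound -/

section TraceInverse

variable {n : Type*} [Fintype n] [DecidableEq n] {H Γ : Matrix n n ℝ}

lemma trace_mul_inv_nonneg (hH : H.PosSemidef) (hΓ : Γ.PosDef) : 0 ≤ (H * Γ⁻¹).trace := by
  obtain ⟨k, rfl⟩ := exists_eq_sum_vecMulVec hH
  rw [trace_sum_vecMulVec_mul]
  exact Finset.sum_nonneg fun i _ => inner_op_nonneg hΓ.inv.posSemidef _

lemma inner_op_inv_self_le (hΓ : IsUnit Γ.det) {lam : ℝ} (hlam : 0 < lam)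
    (hle : ∀ x, lam * ‖x‖ ^ 2 ≤ inner ℝ x (op Γ x)) (x : EuclideanSpace ℝ n) :
    inner ℝ x (op Γ⁻¹ x) ≤ ‖x‖ ^ 2 / lam := by
  have hcs := real_inner_le_norm x (op Γ⁻¹ x)
  have hexc := hle (op Γ⁻¹ x)
  rw [op_op_inv hΓ, real_inner_comm] at hexc
  rw [le_div_iff₀ hlam]
  nlinarith [sq_nonneg (‖x‖ - lam * ‖op Γ⁻¹ x‖)]

lemma trace_mul_inv_le (hH : H.PosSemidef) (hΓ : IsUnit Γ.det) {lam : ℝ} (hlam : 0 < lam)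
    (hle : ∀ x, lam * ‖x‖ ^ 2 ≤ inner ℝ x (op Γ x)) : (H * Γ⁻¹).trace ≤ H.trace / lam := by
  obtain ⟨k, rfl⟩ := exists_eq_sum_vecMulVec hH
  rw [trace_sum_vecMulVec_mul, trace_sum_vecMulVec, Finset.sum_div]
  exact Finset.sum_le_sum fun i _ => inner_op_inv_self_le hΓ hlam hle (k i)

end TraceInverse

section Bayes

variable {Ω : Type*} [mΩ : MeasurableSpace Ω] {d dₐ dᵤ T : ℕ} {J : Vec d → Vec dₐ → ℝ}
  {aopt : Vec d → Vec dₐ} {θ₀ : Vec d} {S : SmoothConstants} {X : Observations Ω d dᵤ}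
  {P : Vec d → Measure Ω} {σ : ℝ≥0}

/-- The loss of the decision `a` under the model `θ₀ + η` in the quadratic approximation around
`θ₀`. Far from `aopt θ₀`, where the approximation is not valid, it is replaced with the constant
that quadratic growth provides. -/
noncomputable def localLoss (J : Vec d → Vec dₐ → ℝ) (aopt : Vec d → Vec dₐ) (θ₀ : Vec d)
    (S : SmoothConstants) (ρ : ℝ) (η : Vec d) (a : Vec dₐ) : ℝ≥0∞ :=
  if ‖a - aopt θ₀‖ ≤ 3 * S.La1 * ρ then
    ENNReal.ofReal (riskHess J aopt θ₀ (a - aopt θ₀ - fderiv ℝ aopt θ₀ η)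
      (a - aopt θ₀ - fderiv ℝ aopt θ₀ η) / 2)
  else ENNReal.ofReal (2 * S.μ * S.La1 ^ 2 * ρ ^ 2)

lemma measurable_localLoss (J : Vec d → Vec dₐ → ℝ) (aopt : Vec d → Vec dₐ) (θ₀ : Vec d)
    (S : SmoothConstants) (ρ : ℝ) :
    Measurable fun p : Vec d × Vec dₐ => localLoss J aopt θ₀ S ρ p.1 p.2 := by
  refine Measurable.ite (measurableSet_le (by fun_prop) measurable_const) ?_ measurable_const
  exact (Continuous.measurable (by fun_prop)).ennreal_ofReal

/-- The direction `s⁻¹ A Γ⁻¹` to which the van Trees inequality is applied, where `A` is the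
derivative of `aopt` at `θ₀`. With the information matrix `s Γ` it is the efficient one. -/
noncomputable def efficientDirection (aopt : Vec d → Vec dₐ) (θ₀ : Vec d)
    (Γ : Matrix (Fin d) (Fin d) ℝ) (s : ℝ) : Vec d →L[ℝ] Vec dₐ :=
  s⁻¹ • (fderiv ℝ aopt θ₀).comp (op Γ⁻¹)

lemma measurable_riskHess_trajScore (J : Vec d → Vec dₐ → ℝ) (aopt : Vec d → Vec dₐ) (θ₀ : Vec d)
    (K : Vec d →L[ℝ] Vec dₐ) (σ : ℝ≥0) (θ : Vec d) (c : ℝ) (x : Vec d) :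
    Measurable fun τ : Traj d dᵤ T => ENNReal.ofReal
      (riskHess J aopt θ₀ (K (c • trajScore σ θ τ + x)) (K (c • trajScore σ θ τ + x))) := by
  have hscore : Measurable fun τ : Traj d dᵤ T => trajScore σ θ τ :=
    (measurable_trajScore σ).comp (f := fun τ => (θ, τ)) (by fun_prop)
  have hquad : Continuous fun y => riskHess J aopt θ₀ (K (c • y + x)) (K (c • y + x)) := by
    fun_prop
  exact (hquad.measurable.comp (f := fun τ => trajScore σ θ τ) hscore).ennreal_ofReal

namespace SmoothDecision

lemma Lcubic_nonneg (h : SmoothDecision J aopt θ₀ S) (hd : 1 ≤ d) : 0 ≤ S.Lcubic := by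
  have := h.La1_nonneg
  have := h.La2_nonneg
  have := h.LR2_nonneg
  have := h.LR3_nonneg
  have := h.Lhess_nonneg hd
  unfold SmoothConstants.Lcubic
  positivity

lemma localLoss_le (h : SmoothDecision J aopt θ₀ S) (hd : 1 ≤ d) {ρ : ℝ} (hρ : 4 * ρ ≤ S.r)
    {η : Vec d} (hη : ‖η‖ ≤ ρ) (a : Vec dₐ) :
    localLoss J aopt θ₀ S ρ η a
      ≤ ENNReal.ofReal (excessRisk J a (θ₀ + η)) + ENNReal.ofReal (S.Lcubic * ρ ^ 3) := by
  unfold localLoss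
  split_ifs with hnear
  · exact (ENNReal.ofReal_le_ofReal (h.le_excessRisk_near hd hρ hη hnear)).trans
      ENNReal.ofReal_add_le
  · exact (ENNReal.ofReal_le_ofReal (h.le_excessRisk_far hρ hη (not_le.1 hnear))).trans
      le_self_add

lemma lintegral_localLoss_le (h : SmoothDecision J aopt θ₀ S) (hd : 1 ≤ d) {ρ : ℝ}
    (hρ : 4 * ρ ≤ S.r) {η : Vec d} (hη : ‖η‖ ≤ ρ) {𝓧 : Type*} [MeasurableSpace 𝓧] (Q : Measure 𝓧)
    [IsProbabilityMeasure Q] (f : 𝓧 → Vec dₐ) :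
    ∫⁻ x, localLoss J aopt θ₀ S ρ η (f x) ∂Q
      ≤ ∫⁻ x, ENNReal.ofReal (excessRisk J (f x) (θ₀ + η)) ∂Q
        + ENNReal.ofReal (S.Lcubic * ρ ^ 3) :=
  calc ∫⁻ x, localLoss J aopt θ₀ S ρ η (f x) ∂Q
      ≤ ∫⁻ x, (ENNReal.ofReal (excessRisk J (f x) (θ₀ + η))
          + ENNReal.ofReal (S.Lcubic * ρ ^ 3)) ∂Q :=
        lintegral_mono fun x => h.localLoss_le hd hρ hη _
    _ = _ := by
        rw [lintegral_add_right _ measurable_const, lintegral_const, measure_univ, mul_one]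

lemma sum_riskHess_efficientDirection (h : SmoothDecision J aopt θ₀ S)
    (Γ : Matrix (Fin d) (Fin d) ℝ) (s : ℝ) :
    ∑ j, riskHess J aopt θ₀ (fderiv ℝ aopt θ₀ (EuclideanSpace.basisFun (Fin d) ℝ j))
        (efficientDirection aopt θ₀ Γ s (EuclideanSpace.basisFun (Fin d) ℝ j))
      = s⁻¹ * (taskHessian J aopt θ₀ * Γ⁻¹).trace := by
  rw [Matrix.trace, Finset.mul_sum]
  refine Finset.sum_congr rfl fun j _ => ?_
  have hentry (N : Matrix (Fin d) (Fin d) ℝ) : N.diag j = inner ℝ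
      (EuclideanSpace.basisFun (Fin d) ℝ j) (op N (EuclideanSpace.basisFun (Fin d) ℝ j)) := by
    simp [inner_op_eq_sum]
  rw [hentry, op_mul_apply, h.inner_op_taskHessian]
  simp only [efficientDirection, smul_apply, ContinuousLinearMap.comp_apply, map_smul, smul_eq_mul]

lemma riskHess_efficientDirection (h : SmoothDecision J aopt θ₀ S)
    {Γ : Matrix (Fin d) (Fin d) ℝ} (hΓ : Γ.IsHermitian) {k : Fin d → Vec d}
    (hk : taskHessian J aopt θ₀ = ∑ i, Matrix.vecMulVec (k i) (k i)) (s : ℝ) (x : Vec d) :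
    riskHess J aopt θ₀ (efficientDirection aopt θ₀ Γ s x) (efficientDirection aopt θ₀ Γ s x)
      = s⁻¹ ^ 2 * ∑ i, inner ℝ (op Γ⁻¹ (k i)) x ^ 2 := by
  have hsq : riskHess J aopt θ₀ (fderiv ℝ aopt θ₀ (op Γ⁻¹ x)) (fderiv ℝ aopt θ₀ (op Γ⁻¹ x))
      = ∑ i, inner ℝ (op Γ⁻¹ (k i)) x ^ 2 := by
    rw [← h.inner_op_taskHessian, hk, inner_op_sum_vecMulVec]
    exact Finset.sum_congr rfl fun i _ => by rw [← inner_op_comm hΓ.inv, sq]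
  simp only [efficientDirection, smul_apply, ContinuousLinearMap.comp_apply, map_smul, smul_eq_mul,
    hsq]
  ring

lemma sum_riskHess_efficientDirection_self (h : SmoothDecision J aopt θ₀ S)
    {Γ : Matrix (Fin d) (Fin d) ℝ} (hΓ : Γ.IsHermitian) {k : Fin d → Vec d}
    (hk : taskHessian J aopt θ₀ = ∑ i, Matrix.vecMulVec (k i) (k i)) (s : ℝ) :
    ∑ j, riskHess J aopt θ₀
        (efficientDirection aopt θ₀ Γ s (EuclideanSpace.basisFun (Fin d) ℝ j))
        (efficientDirection aopt θ₀ Γ s (EuclideanSpace.basisFun (Fin d) ℝ j))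
      = s⁻¹ ^ 2 * ∑ i, ‖op Γ⁻¹ (k i)‖ ^ 2 := by
  simp only [h.riskHess_efficientDirection hΓ hk, ← Finset.mul_sum]
  rw [Finset.sum_comm]
  simp only [OrthonormalBasis.sum_sq_inner_left]

lemma lintegral_riskHess_efficientDirection_le (h : SmoothDecision J aopt θ₀ S)
    {Γ : Matrix (Fin d) (Fin d) ℝ} (hΓ : Γ.PosDef) {θ : Vec d} {Q : Measure Ω}
    (law : X.IsLaw σ θ Q) (hσ : σ ≠ 0) (hz : ∀ t < T, MemLp (X.z t) 2 Q) {B : ℝ}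
    (hcov : ∀ x, inner ℝ x (op (X.meanCov Q T) x) / σ ^ 2 ≤ B * inner ℝ x (op Γ x))
    (s c : ℝ) (x : Vec d) :
    ∫⁻ ω, ENNReal.ofReal (riskHess J aopt θ₀
        (efficientDirection aopt θ₀ Γ s (c • trajScore σ θ (X.traj T ω) + x))
        (efficientDirection aopt θ₀ Γ s (c • trajScore σ θ (X.traj T ω) + x))) ∂Q
      ≤ ENNReal.ofReal (c ^ 2 * (s⁻¹ ^ 2 * (B * (taskHessian J aopt θ₀ * Γ⁻¹).trace))
        + riskHess J aopt θ₀ (efficientDirection aopt θ₀ Γ s x)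
          (efficientDirection aopt θ₀ Γ s x)) := by
  obtain ⟨k, hk⟩ := exists_eq_sum_vecMulVec h.posSemidef_taskHessian
  have hdet := hΓ.det_pos.ne'.isUnit
  have information : (∑ i, inner ℝ (op Γ⁻¹ (k i)) (op (X.meanCov Q T) (op Γ⁻¹ (k i)))) / σ ^ 2
      ≤ B * (taskHessian J aopt θ₀ * Γ⁻¹).trace := by
    rw [hk, trace_sum_vecMulVec_mul, Finset.sum_div, Finset.mul_sum]
    refine Finset.sum_le_sum fun i _ => (hcov _).trans_eq ?_
    rw [op_op_inv hdet, real_inner_comm]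
  simp only [h.riskHess_efficientDirection hΓ.isHermitian hk,
    ENNReal.ofReal_mul (sq_nonneg s⁻¹)]
  rw [lintegral_const_mul' _ _ ENNReal.ofReal_ne_top, law.lintegral_sum_inner_score_sq hσ hz,
    ← ENNReal.ofReal_mul (sq_nonneg _)]
  refine ENNReal.ofReal_le_ofReal ?_
  rw [mul_add, mul_left_comm (c ^ 2)]
  gcongr s⁻¹ ^ 2 * ?_ + _
  rw [div_mul_eq_mul_div, mul_div_assoc]
  gcongr

lemma add_prior_information_le (h : SmoothDecision J aopt θ₀ S)
    {Γ : Matrix (Fin d) (Fin d) ℝ} (hΓ : Γ.PosDef) {ρ s B B' : ℝ} (hs : 0 < s) (hBs : B + B' ≤ s)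
    (hprior : ∀ x, 9 * (1 + d / 6) / ρ ^ 2 * ‖x‖ ^ 2 ≤ B' * inner ℝ x (op Γ x)) :
    s⁻¹ ^ 2 * (B * (taskHessian J aopt θ₀ * Γ⁻¹).trace) / 2
        + 9 / 2 * ((1 + d / 6) / ρ ^ 2) * ∑ j, riskHess J aopt θ₀
          (efficientDirection aopt θ₀ Γ s (EuclideanSpace.basisFun (Fin d) ℝ j))
          (efficientDirection aopt θ₀ Γ s (EuclideanSpace.basisFun (Fin d) ℝ j))
      ≤ s⁻¹ * (taskHessian J aopt θ₀ * Γ⁻¹).trace / 2 := by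
  have hΦ := trace_mul_inv_nonneg h.posSemidef_taskHessian hΓ
  obtain ⟨k, hk⟩ := exists_eq_sum_vecMulVec h.posSemidef_taskHessian
  have hsum : 9 * (1 + d / 6) / ρ ^ 2 * ∑ i, ‖op Γ⁻¹ (k i)‖ ^ 2
      ≤ B' * (taskHessian J aopt θ₀ * Γ⁻¹).trace := by
    rw [hk, trace_sum_vecMulVec_mul, Finset.mul_sum, Finset.mul_sum]
    refine Finset.sum_le_sum fun i _ => (hprior _).trans_eq ?_
    rw [op_op_inv hΓ.det_pos.ne'.isUnit, real_inner_comm]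
  rw [h.sum_riskHess_efficientDirection_self hΓ.isHermitian hk]
  set Φ := (taskHessian J aopt θ₀ * Γ⁻¹).trace
  calc s⁻¹ ^ 2 * (B * Φ) / 2
        + 9 / 2 * ((1 + d / 6) / ρ ^ 2) * (s⁻¹ ^ 2 * ∑ i, ‖op Γ⁻¹ (k i)‖ ^ 2)
      = s⁻¹ ^ 2 / 2 * (B * Φ + 9 * (1 + d / 6) / ρ ^ 2 * ∑ i, ‖op Γ⁻¹ (k i)‖ ^ 2) := by ring
    _ ≤ s⁻¹ ^ 2 / 2 * (B * Φ + B' * Φ) := by gcongr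
    _ = s⁻¹ ^ 2 / 2 * ((B + B') * Φ) := by ring
    _ ≤ s⁻¹ ^ 2 / 2 * (s * Φ) := by gcongr
    _ = s⁻¹ * Φ / 2 := by field_simp

theorem ofReal_le_of_lintegral_excessRisk_le (h : SmoothDecision J aopt θ₀ S) (hd : 1 ≤ d)
    (hσ : σ ≠ 0) (hlaw : ∀ θ, X.IsLaw σ θ (P θ)) (hexp : X.SameExploration P)
    {Γ : Matrix (Fin d) (Fin d) ℝ} (hΓ : Γ.PosDef) {ρ s B B' : ℝ} (hρ : 0 < ρ)
    (hρr : 4 * ρ ≤ S.r) (hs : 0 < s) (hB : 0 ≤ B) (hBs : B + B' ≤ s)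
    (hz : ∀ η : Vec d, ‖η‖ ≤ ρ → ∀ t < T, MemLp (X.z t) 2 (P (θ₀ + η)))
    (hcov : ∀ η : Vec d, ‖η‖ ≤ ρ → ∀ x,
      inner ℝ x (op (X.meanCov (P (θ₀ + η)) T) x) / σ ^ 2 ≤ B * inner ℝ x (op Γ x))
    (hprior : ∀ x, 9 * (1 + d / 6) / ρ ^ 2 * ‖x‖ ^ 2 ≤ B' * inner ℝ x (op Γ x))
    (hfar : s⁻¹ * (taskHessian J aopt θ₀ * Γ⁻¹).trace ≤ 2 * S.μ * S.La1 ^ 2 * ρ ^ 2)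
    {dec : Traj d dᵤ T → Vec dₐ} (hdec : Measurable dec) {V : ℝ≥0∞}
    (hV : ∀ η : Vec d, ‖η‖ ≤ ρ →
      ∫⁻ ω, ENNReal.ofReal (excessRisk J (dec (X.traj T ω)) (θ₀ + η)) ∂(P (θ₀ + η)) ≤ V) :
    ENNReal.ofReal (s⁻¹ * (taskHessian J aopt θ₀ * Γ⁻¹).trace / 2 - S.Lcubic * ρ ^ 3) ≤ V := by
  have hprob := fun θ => (hlaw θ).prob
  have htraj := (X.measurable_traj T).mono (X.ℱ.le T) le_rfl
  have (η : Vec d) : IsProbabilityMeasure ((P (θ₀ + η)).map (X.traj T)) :=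
    Measure.isProbabilityMeasure_map htraj.aemeasurable
  have hΦ := trace_mul_inv_nonneg h.posSemidef_taskHessian hΓ
  have hLcubic := h.Lcubic_nonneg hd
  have hloss : Measurable fun p : Vec d × Traj d dᵤ T =>
      localLoss J aopt θ₀ S ρ p.1 (dec p.2) :=
    (measurable_localLoss J aopt θ₀ S ρ).comp (f := fun p : Vec d × Traj d dᵤ T => (p.1, dec p.2))
      (by fun_prop)
  have vanTrees := (hexp.hasScore θ₀ hσ hlaw T).vanTrees (EuclideanSpace.basisFun (Fin d) ℝ)
    (fderiv ℝ aopt θ₀) (efficientDirection aopt θ₀ Γ s) h.riskHess_nonneg hρ h.riskHess_comm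
    (R := fun η τ => localLoss J aopt θ₀ S ρ η (dec τ)) hloss
    (V := V + ENNReal.ofReal (S.Lcubic * ρ ^ 3))
    (b := s⁻¹ ^ 2 * (B * (taskHessian J aopt θ₀ * Γ⁻¹).trace)) ?_ ?_ (by positivity) ?_
  · rw [h.sum_riskHess_efficientDirection, finrank_euclideanSpace_fin] at vanTrees
    have hle := vanTrees.trans (add_le_add_right
      (ENNReal.ofReal_le_ofReal (h.add_prior_information_le hΓ hs hBs hprior)) _)
    rw [add_assoc, ← ENNReal.ofReal_add (by positivity) (by positivity), ← tsub_le_iff_right,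
      ← ENNReal.ofReal_sub _ (by positivity)] at hle
    exact (ENNReal.ofReal_le_ofReal (by linarith)).trans hle
  · intro τ
    by_cases hnear : ‖dec τ - aopt θ₀‖ ≤ 3 * S.La1 * ρ
    · exact Or.inl ⟨dec τ - aopt θ₀, fun η => by rw [localLoss, if_pos hnear]⟩
    · refine Or.inr fun η => ?_
      rw [h.sum_riskHess_efficientDirection, localLoss, if_neg hnear]
      exact ENNReal.ofReal_le_ofReal hfar
  · intro η hη
    have hlossη : Measurable fun τ => localLoss J aopt θ₀ S ρ η (dec τ) :=
      hloss.comp (f := fun τ => (η, τ)) measurable_prodMk_left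
    rw [lintegral_map hlossη htraj]
    exact (h.lintegral_localLoss_le hd hρr hη _ _).trans (add_le_add_left (hV η hη) _)
  · intro η hη c x
    rw [lintegral_map (measurable_riskHess_trajScore J aopt θ₀ _ σ (θ₀ + η) c x) htraj]
    exact h.lintegral_riskHess_efficientDirection_le hΓ (hlaw _) hσ (hz η hη) (hcov η hη) s c x

end SmoothDecision

end Bayes

/-! ### The local minimax lower bound -/

section Horizon

variable {a p q : ℝ} {m n : ℕ}

lemma pow_rpow_eq_pow (hp : 0 ≤ p) (hmn : m * q = n) : (p ^ m) ^ q = p ^ n := by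
  rw [← Real.rpow_natCast, ← Real.rpow_mul hp, hmn, Real.rpow_natCast]

lemma le_pow_of_rpow_le_pow (ha : 0 ≤ a) (hp : 0 ≤ p) (hq : 0 < q) (hmn : m * q = n)
    (h : a ^ q ≤ p ^ n) : a ≤ p ^ m := by
  rwa [← pow_rpow_eq_pow hp hmn, Real.rpow_le_rpow_iff ha (by positivity) hq] at h

lemma le_mul_rpow_of_div_rpow_le {c lam t α : ℝ} (hc : 0 ≤ c) (hlam : 0 < lam) (ht : 0 ≤ t)
    (hα : 0 < α) (h : (c / lam ^ (1 - α)) ^ (1 / α) ≤ lam * t) : c ≤ lam * t ^ α := by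
  rw [one_div, Real.rpow_inv_le_iff_of_pos (by positivity) (by positivity) hα,
    div_le_iff₀ (by positivity), Real.mul_rpow hlam.le ht, mul_right_comm, ← Real.rpow_add hlam,
    add_sub_cancel, Real.rpow_one] at h
  exact h

lemma sqrt_div_pow_le {R : ℝ} (hp : 0 < p) (hR : 0 < R) (h : a / R ^ 2 ≤ p ^ 10) :
    √a / p ^ 5 ≤ R := by
  rw [div_le_iff₀ (by positivity)] at h ⊢
  exact Real.sqrt_le_iff.2 ⟨by positivity, by linarith⟩

lemma sqrt_div_pow_sq (ha : 0 ≤ a) : (√a / p ^ 5) ^ 2 = a / p ^ 10 := by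
  rw [div_pow, Real.sq_sqrt ha, ← pow_mul]

lemma prior_information_le {d : ℕ} {σ : ℝ} (hd : 1 ≤ d) (hσ : 0 < σ) (hσp : 3 * σ ≤ p) :
    9 * (1 + d / 6) / (√(5 * d) / p ^ 5) ^ 2 ≤ p ^ 12 / (4 * σ ^ 2) := by
  have hd' : (1 : ℝ) ≤ d := by exact_mod_cast hd
  have hp : 0 < p := by linarith
  have hsq : (3 * σ) ^ 2 ≤ p ^ 2 := pow_le_pow_left₀ (by positivity) hσp 2
  rw [sqrt_div_pow_sq (by positivity), div_div_eq_mul_div,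
    div_le_div_iff₀ (by positivity) (by positivity)]
  calc 9 * (1 + (d : ℝ) / 6) * p ^ 10 * (4 * σ ^ 2)
      = p ^ 10 * (4 * (1 + d / 6) * (3 * σ) ^ 2) := by ring
    _ ≤ p ^ 10 * (4 * (1 + d / 6) * p ^ 2) := by gcongr
    _ ≤ p ^ 10 * (5 * d * p ^ 2) := by gcongr ?_ * (?_ * ?_); linarith
    _ = p ^ 12 * (5 * d) := by ring

end Horizon

section Minimax

variable {Ω : Type*} [mΩ : MeasurableSpace Ω] {d dₐ dᵤ T : ℕ} {J : Vec d → Vec dₐ → ℝ}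
  {aopt : Vec d → Vec dₐ} {θ₀ : Vec d} {S : SmoothConstants} {X : Observations Ω d dᵤ}
  {P : Vec d → Measure Ω} {Q : Measure Ω} {σ : ℝ≥0} {lam rcov Lcov Ccov ccov α p : ℝ}

lemma le_inner_op_of_le_lamMin {M : Matrix (Fin d) (Fin d) ℝ} (h : lam ≤ lamMin M) (x : Vec d) :
    lam * ‖x‖ ^ 2 ≤ inner ℝ x (op M x) :=
  (mul_le_mul_of_nonneg_right h (sq_nonneg _)).trans (lamMin_mul_le _ x)

namespace Observations

lemma posDef_Gam (X : Observations Ω d dᵤ) (h : 0 < lamMin (X.Gam Q T)) : (X.Gam Q T).PosDef := by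
  refine posDef_of_lamMin_pos ?_ h
  rw [Gam, Matrix.IsHermitian, Matrix.conjTranspose_smul, X.isHermitian_meanCov Q T]
  simp

lemma inner_op_Gam (X : Observations Ω d dᵤ) (x : Vec d) :
    inner ℝ x (op (X.Gam Q T) x) = (T : ℝ)⁻¹ * inner ℝ x (op (X.meanCov Q T) x) := by
  rw [Gam, op_smul_apply, real_inner_smul_right]

lemma SmoothResponse.inner_op_meanCov_le (h : X.SmoothResponse P θ₀ T lam rcov Lcov Ccov ccov α)
    (hT : 0 < T) {θ : Vec d} (hθ : ‖θ - θ₀‖ ≤ rcov)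
    (hsmall : Lcov * ‖θ - θ₀‖ + Ccov / (T : ℝ) ^ α ≤ lam / 4) (x : Vec d) :
    inner ℝ x (op (X.meanCov (P θ) T) x)
      ≤ T * (ccov + 1 / 4) * inner ℝ x (op (X.Gam (P θ₀) T) x) := by
  have hT' : (0 : ℝ) < T := by exact_mod_cast hT
  have hexc := le_inner_op_of_le_lamMin h.excited x
  have hresp := inner_op_le_of_loewnerLE (h.response θ hθ) x
  rw [inner_op_Gam, inv_mul_le_iff₀ hT', op_add_apply, op_smul_apply, op_smul_apply,
    op_one_apply, inner_add_right, real_inner_smul_right, real_inner_smul_right,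
    real_inner_self_eq_norm_sq] at hresp
  have hdrift := mul_le_mul_of_nonneg_right hsmall (sq_nonneg ‖x‖)
  refine hresp.trans ?_
  rw [mul_assoc]
  exact mul_le_mul_of_nonneg_left (by linarith) hT'.le

end Observations

namespace SmoothDecision

lemma μ_le_LR2_or (h : SmoothDecision J aopt θ₀ S) : S.μ ≤ S.LR2 ∨ taskHessian J aopt θ₀ = 0 := by
  by_cases hA : ∃ v, fderiv ℝ aopt θ₀ v ≠ 0
  · obtain ⟨v, hv⟩ := hA
    set a := fderiv ℝ aopt θ₀ v
    have hlower := h.le_riskHess a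
    have hupper : riskHess J aopt θ₀ a a ≤ S.LR2 * ‖a‖ * ‖a‖ :=
      (le_abs_self _).trans ((riskHess J aopt θ₀).le_of_opNorm₂_le_of_le h.norm_riskHess_le
        le_rfl le_rfl)
    exact Or.inl (le_of_mul_le_mul_right (by linarith) (pow_pos (norm_pos_iff.2 hv) 2))
  · push Not at hA
    refine Or.inr ?_
    ext i j
    rw [h.taskHessian_apply, hA]
    simp

lemma idealRisk_le (h : SmoothDecision J aopt θ₀ S) (hlam : 0 < lam)
    (hexc : lam ≤ lamMin (X.Gam Q T)) :
    X.idealRisk (taskHessian J aopt θ₀) Q T ≤ d * (S.LR2 * S.La1 ^ 2) / lam :=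
  have hdet := (X.posDef_Gam (hlam.trans_le hexc)).det_pos.ne'.isUnit
  (trace_mul_inv_le h.posSemidef_taskHessian hdet hlam (le_inner_op_of_le_lamMin hexc)).trans
    (by gcongr; exact h.trace_taskHessian_le)

lemma idealRisk_nonneg (h : SmoothDecision J aopt θ₀ S) (hlam : 0 < lamMin (X.Gam Q T)) :
    0 ≤ X.idealRisk (taskHessian J aopt θ₀) Q T :=
  trace_mul_inv_nonneg h.posSemidef_taskHessian (X.posDef_Gam hlam)

lemma sq_div_mul_idealRisk_le (h : SmoothDecision J aopt θ₀ S) (hlam : 0 < lam)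
    (hexc : lam ≤ lamMin (X.Gam Q T)) (hc : 0 ≤ ccov) (hpT : lam * T = p ^ 12) :
    (σ : ℝ) ^ 2 / (1 + 2 * ccov) * (X.idealRisk (taskHessian J aopt θ₀) Q T / T)
      ≤ (σ : ℝ) ^ 2 * (d * (S.LR2 * S.La1 ^ 2) / p ^ 12) := by
  have hΦ := h.idealRisk_nonneg (hlam.trans_le hexc)
  rw [← hpT, ← div_div]
  gcongr
  · exact div_le_self (by positivity) (by linarith)
  · exact h.idealRisk_le hlam hexc

lemma inv_mul_idealRisk_le (h : SmoothDecision J aopt θ₀ S) (hlam : 0 < lam)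
    (hexc : lam ≤ lamMin (X.Gam Q T)) (hT : 0 < T) (hσ : σ ≠ 0) (hc : 0 ≤ ccov) {ρ : ℝ}
    (hfar : d * ((σ : ℝ) ^ 2 * S.LR2) ≤ lam * T * (S.μ * ρ ^ 2)) :
    (T * (ccov + 1 / 2) / (σ : ℝ) ^ 2)⁻¹ * X.idealRisk (taskHessian J aopt θ₀) Q T
      ≤ 2 * S.μ * S.La1 ^ 2 * ρ ^ 2 := by
  have hT' : (0 : ℝ) < T := by exact_mod_cast hT
  have hΦ := h.idealRisk_nonneg (hlam.trans_le hexc)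
  have hinv : (T * (ccov + 1 / 2) / (σ : ℝ) ^ 2)⁻¹ ≤ 2 * (σ : ℝ) ^ 2 / T := by
    rw [inv_div, div_le_div_iff₀ (by positivity) hT']
    have : 0 ≤ (σ : ℝ) ^ 2 * T * ccov := by positivity
    linarith
  calc (T * (ccov + 1 / 2) / (σ : ℝ) ^ 2)⁻¹ * X.idealRisk (taskHessian J aopt θ₀) Q T
      ≤ 2 * (σ : ℝ) ^ 2 / T * (d * (S.LR2 * S.La1 ^ 2) / lam) := by
        gcongr
        exact h.idealRisk_le hlam hexc
    _ = 2 * S.La1 ^ 2 * (d * ((σ : ℝ) ^ 2 * S.LR2)) / (lam * T) := by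
        field_simp
    _ ≤ 2 * S.La1 ^ 2 * (lam * T * (S.μ * ρ ^ 2)) / (lam * T) := by gcongr
    _ = 2 * S.μ * S.La1 ^ 2 * ρ ^ 2 := by
        field_simp

-- The information is split as `T (ccov + 1/2) / σ² = T (ccov + 1/4) / σ² + T / (4 σ²)`: the data
-- use the first part and the prior of radius `ρ` the second.
theorem ofReal_le_iSup_of_radius (h : SmoothDecision J aopt θ₀ S) (hd : 1 ≤ d)
    (hlaw : ∀ θ, X.IsLaw σ θ (P θ)) (hexp : X.SameExploration P) (hT : 0 < T) (hσ : σ ≠ 0)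
    (hresp : X.SmoothResponse P θ₀ T lam rcov Lcov Ccov ccov α) {ρ : ℝ} (hρ : 0 < ρ)
    (hρr : 4 * ρ ≤ S.r) (hρrcov : ρ ≤ rcov) (hdrift : Lcov * ρ + Ccov / (T : ℝ) ^ α ≤ lam / 4)
    (hprior : 9 * (1 + d / 6) / ρ ^ 2 ≤ lam * T / (4 * σ ^ 2))
    (hfar : d * ((σ : ℝ) ^ 2 * S.LR2) ≤ lam * T * (S.μ * ρ ^ 2))
    {dec : Traj d dᵤ T → Vec dₐ} (hdec : Measurable dec) :
    ENNReal.ofReal ((σ : ℝ) ^ 2 / (1 + 2 * ccov)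
        * (X.idealRisk (taskHessian J aopt θ₀) (P θ₀) T / T) - S.Lcubic * ρ ^ 3)
      ≤ ⨆ θ ∈ {θ | ‖θ - θ₀‖ ≤ ρ},
          ∫⁻ ω, ENNReal.ofReal (excessRisk J (dec (X.traj T ω)) θ) ∂(P θ) := by
  have hc := hresp.ccov_pos
  have : (0 : ℝ) < T := by exact_mod_cast hT
  have : (0 : ℝ) < σ := by positivity
  have hexc := le_inner_op_of_le_lamMin hresp.excited
  have hball (η : Vec d) (hη : ‖η‖ ≤ ρ) : ‖θ₀ + η - θ₀‖ ≤ ρ := by rwa [add_sub_cancel_left]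
  have bayes := h.ofReal_le_of_lintegral_excessRisk_le (P := P) (X := X) (T := T) hd hσ hlaw hexp
    (X.posDef_Gam (hresp.lam_pos.trans_le hresp.excited)) (s := T * (ccov + 1 / 2) / σ ^ 2)
    (B := T * (ccov + 1 / 4) / σ ^ 2) (B' := T / (4 * σ ^ 2))
    hρ hρr (by positivity) (by positivity) (le_of_eq (by ring))
    (fun η hη => hresp.square_integrable _ ((hball η hη).trans hρrcov)) ?_ ?_
    (h.inv_mul_idealRisk_le hresp.lam_pos hresp.excited hT hσ hc.le hfar) hdec
    (fun η hη => le_biSup (s := {θ | ‖θ - θ₀‖ ≤ ρ})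
      (fun θ => ∫⁻ ω, ENNReal.ofReal (excessRisk J (dec (X.traj T ω)) θ) ∂(P θ)) (hball η hη))
  · refine le_trans (le_of_eq ?_) bayes
    congr 2
    rw [Observations.idealRisk]
    field_simp
    ring
  · intro η hη x
    rw [div_mul_eq_mul_div]
    refine div_le_div_of_nonneg_right (hresp.inner_op_meanCov_le hT ((hball η hη).trans hρrcov)
      (le_trans ?_ hdrift) x) (by positivity)
    have := hresp.Lcov_pos
    gcongr
    exact hball η hη
  · intro x
    calc 9 * (1 + d / 6) / ρ ^ 2 * ‖x‖ ^ 2 ≤ lam * T / (4 * σ ^ 2) * ‖x‖ ^ 2 := by gcongr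
      _ = T / (4 * σ ^ 2) * (lam * ‖x‖ ^ 2) := by ring
      _ ≤ T / (4 * σ ^ 2) * inner ℝ x (op (X.Gam (P θ₀) T) x) := by
        gcongr
        exact hexc x

theorem ofReal_le_iSup_of_pow (h : SmoothDecision J aopt θ₀ S) (hd : 1 ≤ d)
    (hlaw : ∀ θ, X.IsLaw σ θ (P θ)) (hexp : X.SameExploration P) (hT : 0 < T) (hσ : σ ≠ 0)
    (hresp : X.SmoothResponse P θ₀ T lam rcov Lcov Ccov ccov α)
    (hpT : lam * T = p ^ 12) (hσp : 3 * σ ≤ p)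
    (hr : 80 * d / S.r ^ 2 ≤ p ^ 10) (hμ : (σ : ℝ) ^ 2 * S.LR2 / (5 * S.μ) ≤ p ^ 2)
    (hL : 8 * Lcov * √(5 * d) / lam ≤ p ^ 5) (hC : 8 * Ccov ≤ lam * (T : ℝ) ^ α)
    (hrc : 5 * d / rcov ^ 2 ≤ p ^ 10) {dec : Traj d dᵤ T → Vec dₐ} (hdec : Measurable dec) :
    ENNReal.ofReal ((σ : ℝ) ^ 2 / (1 + 2 * ccov)
        * (X.idealRisk (taskHessian J aopt θ₀) (P θ₀) T / T)
        - S.Lcubic * (√(5 * d) / p ^ 5) ^ 3)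
      ≤ ⨆ θ ∈ {θ | ‖θ - θ₀‖ ≤ √(5 * d) / p ^ 5},
          ∫⁻ ω, ENNReal.ofReal (excessRisk J (dec (X.traj T ω)) θ) ∂(P θ) := by
  have hlam := hresp.lam_pos
  have hμ₀ := h.μ_pos
  have hσ' : (0 : ℝ) < σ := by positivity
  have hp : 0 < p := by linarith
  refine h.ofReal_le_iSup_of_radius hd hlaw hexp hT hσ hresp (by positivity) ?_
    (sqrt_div_pow_le hp hresp.rcov_pos hrc) ?_ ?_ ?_ hdec
  · have h80 : √(80 * d) = 4 * √(5 * d) := by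
      rw [show (80 : ℝ) * d = 4 ^ 2 * (5 * d) by ring, Real.sqrt_mul (by norm_num),
        Real.sqrt_sq (by norm_num)]
    rw [← mul_div_assoc, ← h80]
    exact sqrt_div_pow_le hp h.r_pos hr
  · have hLρ : Lcov * (√(5 * d) / p ^ 5) ≤ lam / 8 := by
      rw [div_le_iff₀ hlam] at hL
      rw [← mul_div_assoc, div_le_iff₀ (by positivity)]
      linarith
    have hCT : Ccov / (T : ℝ) ^ α ≤ lam / 8 := by
      rw [div_le_iff₀ (by positivity)]
      linarith
    linarith
  · rw [hpT]
    exact prior_information_le hd hσ' hσp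
  · rw [div_le_iff₀ (by positivity)] at hμ
    rw [hpT, sqrt_div_pow_sq (by positivity)]
    calc d * ((σ : ℝ) ^ 2 * S.LR2) ≤ d * (p ^ 2 * (5 * S.μ)) := by gcongr
      _ = p ^ 12 * (S.μ * (5 * d / p ^ 10)) := by field_simp

lemma sq_div_mul_idealRisk_le_lowerConst (h : SmoothDecision J aopt θ₀ S) (hd : 1 ≤ d)
    (hlam : 0 < lam) (hexc : lam ≤ lamMin (X.Gam Q T)) (hc : 0 ≤ ccov) (hp : 0 < p)
    (hpT : lam * T = p ^ 12) (hσp : p ≤ 3 * σ) :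
    (σ : ℝ) ^ 2 / (1 + 2 * ccov) * (X.idealRisk (taskHessian J aopt θ₀) Q T / T)
      ≤ 1000 * lowerConst d σ S / p ^ 15 := by
  have hLa1 := h.La1_nonneg
  have hLa2 := h.La2_nonneg
  have hLR2 := h.LR2_nonneg
  have hLR3 := h.LR3_nonneg
  have hLhess := h.Lhess_nonneg hd
  have hμ := h.μ_pos
  rcases h.μ_le_LR2_or with hle | h0
  · have hcond : 1 ≤ (S.LR2 / S.μ) ^ (3 / 2 : ℝ) :=
      Real.one_le_rpow ((one_le_div hμ).2 hle) (by norm_num)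
    have hcube : p ^ 3 ≤ 1000 * (σ : ℝ) ^ 3 := by
      have := pow_le_pow_left₀ hp.le hσp 3
      have : (0 : ℝ) ≤ (σ : ℝ) ^ 3 := by positivity
      linarith
    calc (σ : ℝ) ^ 2 / (1 + 2 * ccov) * (X.idealRisk (taskHessian J aopt θ₀) Q T / T)
        ≤ (σ : ℝ) ^ 2 * (d * (S.LR2 * S.La1 ^ 2) / p ^ 12) :=
          h.sq_div_mul_idealRisk_le hlam hexc hc hpT
      _ = d * (S.LR2 * S.La1 ^ 2) * (σ : ℝ) ^ 2 * p ^ 3 / p ^ 15 := by field_simp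
      _ ≤ d * (S.LR2 * S.La1 ^ 2) * (σ : ℝ) ^ 2 * (1000 * (σ : ℝ) ^ 3) / p ^ 15 := by gcongr
      _ = 1000 * (d * (σ : ℝ) ^ 5 * S.La1 ^ 2 * S.LR2 * 1) / p ^ 15 := by ring
      _ ≤ 1000 * (d * (σ : ℝ) ^ 5 * S.La1 ^ 2 * S.LR2 * (S.LR2 / S.μ) ^ (3 / 2 : ℝ)) / p ^ 15 := by
          gcongr
      _ ≤ 1000 * lowerConst d σ S / p ^ 15 := by
          gcongr
          exact le_add_of_nonneg_left (by positivity)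
  · have : 0 ≤ lowerConst d σ S := by unfold lowerConst; positivity
    simp only [Observations.idealRisk, h0, Matrix.zero_mul, Matrix.trace_zero, zero_div, mul_zero]
    positivity

lemma Lcubic_mul_radius_cube_le (h : SmoothDecision J aopt θ₀ S) (hd : 1 ≤ d) (hp : 0 ≤ p) :
    S.Lcubic * (√(5 * d) / p ^ 5) ^ 3 ≤ 1000 * lowerConst d σ S / p ^ 15 := by
  have hLa1 := h.La1_nonneg
  have hLa2 := h.La2_nonneg
  have hLR2 := h.LR2_nonneg
  have hLR3 := h.LR3_nonneg
  have hLhess := h.Lhess_nonneg hd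
  have hμ := h.μ_pos
  have hLcubic := h.Lcubic_nonneg hd
  have hsqrt : √(5 * d) ^ 3 ≤ 12 * (d : ℝ) ^ (3 / 2 : ℝ) := by
    have h5 : √(5 : ℝ) ≤ 9 / 4 := Real.sqrt_le_iff.2 (by norm_num)
    have hd3 : (d : ℝ) ^ (3 / 2 : ℝ) = √d ^ 3 := by
      rw [Real.sqrt_eq_rpow, ← Real.rpow_mul_natCast (by positivity)]
      norm_num
    rw [Real.sqrt_mul (by norm_num), mul_pow, hd3]
    gcongr
    exact (pow_le_pow_left₀ (by positivity) h5 3).trans (by norm_num)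
  rw [div_pow, ← pow_mul, ← mul_div_assoc]
  refine div_le_div_of_nonneg_right ?_ (by positivity)
  calc S.Lcubic * √(5 * d) ^ 3 ≤ S.Lcubic * (12 * (d : ℝ) ^ (3 / 2 : ℝ)) := by gcongr
    _ = 12 * S.Lcubic * (d : ℝ) ^ (3 / 2 : ℝ) := by ring
    _ ≤ 1000 * (S.La1 * S.La2 * S.LR2 + S.La1 ^ 3 * S.LR3 + S.La1 ^ 2 * S.Lhess)
        * (d : ℝ) ^ (3 / 2 : ℝ) := by
        refine mul_le_mul_of_nonneg_right ?_ (by positivity)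
        have : 0 ≤ S.La1 * S.La2 * S.LR2 := by positivity
        have : 0 ≤ S.La1 ^ 3 * S.LR3 := by positivity
        have : 0 ≤ S.La1 ^ 2 * S.Lhess := by positivity
        unfold SmoothConstants.Lcubic
        linarith
    _ ≤ 1000 * lowerConst d σ S := by
        rw [mul_assoc, lowerConst]
        gcongr
        exact le_add_of_nonneg_right (by positivity)

theorem ofReal_le_minimaxRisk_of_pow (h : SmoothDecision J aopt θ₀ S) (hd : 1 ≤ d)
    (hlaw : ∀ θ, X.IsLaw σ θ (P θ)) (hexp : X.SameExploration P) (hT : 0 < T)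
    (hresp : X.SmoothResponse P θ₀ T lam rcov Lcov Ccov ccov α) (hp : 0 < p)
    (hpT : lam * T = p ^ 12)
    (hr : 80 * d / S.r ^ 2 ≤ p ^ 10) (hμ : (σ : ℝ) ^ 2 * S.LR2 / (5 * S.μ) ≤ p ^ 2)
    (hL : 8 * Lcov * √(5 * d) / lam ≤ p ^ 5) (hC : 8 * Ccov ≤ lam * (T : ℝ) ^ α)
    (hrc : 5 * d / rcov ^ 2 ≤ p ^ 10) :
    ENNReal.ofReal ((σ : ℝ) ^ 2 / (1 + 2 * ccov)
          * (X.idealRisk (taskHessian J aopt θ₀) (P θ₀) T / T)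
        - 1000 * lowerConst d σ S / p ^ 15)
      ≤ X.minimaxRisk P J T {θ | ‖θ - θ₀‖ ≤ √(5 * d) / p ^ 5} := by
  have hcubic := h.Lcubic_mul_radius_cube_le (σ := σ) hd hp.le
  rcases le_or_gt p (3 * σ) with hσp | hσp
  · rw [ENNReal.ofReal_of_nonpos (sub_nonpos.2 (h.sq_div_mul_idealRisk_le_lowerConst hd
      hresp.lam_pos hresp.excited hresp.ccov_pos.le hp hpT hσp))]
    exact zero_le
  rcases eq_or_ne σ 0 with rfl | hσ
  · have hLcubic := h.Lcubic_nonneg hd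
    rw [ENNReal.ofReal_of_nonpos]
    · exact zero_le
    · simpa using le_trans (by positivity) hcubic
  · exact le_iInf₂ fun dec hdec => (ENNReal.ofReal_le_ofReal (sub_le_sub_left hcubic _)).trans
      (h.ofReal_le_iSup_of_pow hd hlaw hexp hT hσ hresp hpT hσp.le hr hμ hL hC hrc hdec)

theorem ofReal_le_minimaxRisk (h : SmoothDecision J aopt θ₀ S) (hd : 1 ≤ d)
    (hlaw : ∀ θ, X.IsLaw σ θ (P θ)) (hexp : X.SameExploration P)
    (hresp : X.SmoothResponse P θ₀ T lam rcov Lcov Ccov ccov α)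
    (hr : (80 * d / S.r ^ 2) ^ (6 / 5 : ℝ) ≤ lam * T)
    (hμ : ((σ : ℝ) ^ 2 * S.LR2 / (5 * S.μ)) ^ 6 ≤ lam * T)
    (hL : (8 * Lcov * √(5 * d) / lam) ^ (12 / 5 : ℝ) ≤ lam * T)
    (hC : (8 * Ccov / lam ^ (1 - α)) ^ (1 / α) ≤ lam * T)
    (hrc : (5 * d / rcov ^ 2) ^ (6 / 5 : ℝ) ≤ lam * T) :
    ENNReal.ofReal ((σ : ℝ) ^ 2 / (1 + 2 * ccov)
          * (X.idealRisk (taskHessian J aopt θ₀) (P θ₀) T / T)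
        - 1000 * lowerConst d σ S / (lam * T) ^ (5 / 4 : ℝ))
      ≤ X.minimaxRisk P J T {θ | ‖θ - θ₀‖ ^ 2 ≤ 5 * d / (lam * T) ^ (5 / 6 : ℝ)} := by
  have hlam := hresp.lam_pos
  have hLcov := hresp.Lcov_pos
  have hCcov := hresp.Ccov_pos
  have hr₀ := h.r_pos
  have hx : 0 < lam * T := lt_of_lt_of_le (by positivity) hr
  have hT : (0 : ℝ) < T := pos_of_mul_pos_right hx hlam.le
  have hC' := le_mul_rpow_of_div_rpow_le (by positivity) hlam hT.le hresp.α_pos hC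
  obtain ⟨p, hp, hpT⟩ : ∃ p : ℝ, 0 < p ∧ lam * T = p ^ 12 :=
    ⟨(lam * T) ^ (12 : ℝ)⁻¹, by positivity, by
      rw [← Real.rpow_mul_natCast hx.le]
      norm_num⟩
  rw [hpT] at hr hμ hL hrc ⊢
  have hball : {θ : Vec d | ‖θ - θ₀‖ ^ 2 ≤ 5 * d / p ^ 10} = {θ | ‖θ - θ₀‖ ≤ √(5 * d) / p ^ 5} := by
    ext θ
    rw [Set.mem_ofPred_eq, Set.mem_ofPred_eq, ← sqrt_div_pow_sq (by positivity),
      pow_le_pow_iff_left₀ (norm_nonneg _) (by positivity) two_ne_zero]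
  rw [pow_rpow_eq_pow (n := 15) hp.le (by norm_num), pow_rpow_eq_pow (n := 10) hp.le (by norm_num),
    hball]
  refine h.ofReal_le_minimaxRisk_of_pow hd hlaw hexp (by exact_mod_cast hT) hresp hp hpT ?_ ?_ ?_
    hC' ?_
  · exact le_pow_of_rpow_le_pow (by positivity) hp.le (by norm_num) (by norm_num) hr
  · refine le_of_pow_le_pow_left₀ (n := 6) (by norm_num) (by positivity) ?_
    rwa [← pow_mul]
  · exact le_pow_of_rpow_le_pow (by positivity) hp.le (by norm_num) (by norm_num) hL
  · exact le_pow_of_rpow_le_pow (by positivity) hp.le (by norm_num) (by norm_num) hrc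

end SmoothDecision

end Minimax

end MDM

theorem theorem1_general :
    ∃ c₁ c₂ c₃ c₄ : ℝ, 0 < c₁ ∧ 0 < c₂ ∧ 0 < c₃ ∧ 0 < c₄ ∧
    ∀ (d dₐ dᵤ : ℕ) (_ : 1 ≤ d) (σ : ℝ≥0)
      (J : MDM.Vec d → MDM.Vec dₐ → ℝ) (aopt : MDM.Vec d → MDM.Vec dₐ) (θ₀ : MDM.Vec d)
      (S : MDM.SmoothConstants) (_ : MDM.SmoothDecision J aopt θ₀ S)
      (Ω : Type*) (_ : MeasurableSpace Ω) (X : MDM.Observations Ω d dᵤ)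
      (P : MDM.Vec d → Measure Ω) (T : ℕ),
    (∀ (δ lam Tse Tcon Ccon α : ℝ) (Gbar : ℕ → Matrix (Fin d) (Fin d) ℝ)
        (θhat : MDM.Traj d dᵤ T → MDM.Vec d),
      0 < δ → δ < 1 / 2 →
      X.IsSubgaussianLaw σ θ₀ (P θ₀) T →
      X.PolicyRegular (P θ₀) (δ / 4) lam Gbar Tse Tcon Ccon α →
      MDM.IsLeastSquares θhat →
      Tcon < T → Tse < T → (4 * Ccon) ^ (1 / α) < T →
      c₁ * (σ : ℝ) ^ 2 * MDM.logComplexity δ lam (Gbar T) / (lam * S.r ^ 2) < T →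
      (P θ₀) {ω | ¬ (MDM.excessRisk J (aopt (θhat (X.traj T ω))) θ₀
          ≤ 5 * (σ : ℝ) ^ 2 * Real.log (24 * d / δ)
              * (X.idealRisk (MDM.taskHessian J aopt θ₀) (P θ₀) T / T)
            + c₂ * S.Lquad * (σ : ℝ) ^ 3 / lam ^ (3 / 2 : ℝ)
              * MDM.logComplexity δ lam (Gbar T) ^ (3 / 2 : ℝ) / (T : ℝ) ^ (3 / 2 : ℝ)
            + c₃ * (σ : ℝ) ^ 2 * Ccon ^ 2 * d * (MDM.taskHessian J aopt θ₀).trace / lam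
              * Real.log (d / δ) / (T : ℝ) ^ (1 + 2 * α))}
        ≤ ENNReal.ofReal δ)
    ∧
    (∀ lam rcov Lcov Ccov ccov α : ℝ,
      (∀ θ, X.IsLaw σ θ (P θ)) →
      X.SameExploration P →
      X.SmoothResponse P θ₀ T lam rcov Lcov Ccov ccov α →
      (80 * d / S.r ^ 2) ^ (6 / 5 : ℝ) ≤ lam * T →
      ((σ : ℝ) ^ 2 * S.LR2 / (5 * S.μ)) ^ 6 ≤ lam * T →
      (8 * Lcov * √(5 * d) / lam) ^ (12 / 5 : ℝ) ≤ lam * T →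
      (8 * Ccov / lam ^ (1 - α)) ^ (1 / α) ≤ lam * T →
      (5 * d / rcov ^ 2) ^ (6 / 5 : ℝ) ≤ lam * T →
      ENNReal.ofReal
          ((σ : ℝ) ^ 2 / (1 + 2 * ccov)
              * (X.idealRisk (MDM.taskHessian J aopt θ₀) (P θ₀) T / T)
            - c₄ * MDM.lowerConst d σ S / (lam * T) ^ (5 / 4 : ℝ))
        ≤ X.minimaxRisk P J T {θ | ‖θ - θ₀‖ ^ 2 ≤ 5 * d / (lam * T) ^ (5 / 6 : ℝ)}) := by
  refine ⟨16, 64, 30, 1000, by norm_num, by norm_num, by norm_num, by norm_num, ?_⟩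
  intro d dₐ dᵤ hd σ J aopt θ₀ S hS Ω _ X P T
  refine ⟨?_, ?_⟩
  · intro δ lam Tse Tcon Ccon α Gbar θhat hδ hδ' law reg hls hTcon hTse hTC hTr
    exact hS.measure_not_excessRisk_certaintyEquivalence_le hd hδ hδ' law reg hls hTcon.le hTse.le
      hTC hTr
  · intro lam rcov Lcov Ccov ccov α law hexp hresp hr hμ hL hC hrc
    exact hS.ofReal_le_minimaxRisk hd law hexp hresp hr hμ hL hC hrc

theorem theorem1 :
    ∃ c₁ c₂ c₃ c₄ : ℝ, 0 < c₁ ∧ 0 < c₂ ∧ 0 < c₃ ∧ 0 < c₄ ∧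
    ∀ (d dₐ dᵤ : ℕ) (_ : 1 ≤ d) (σ : ℝ≥0) (γ : ℝ)
      (J : MDM.Vec d → MDM.Vec dₐ → ℝ) (aopt : MDM.Vec d → MDM.Vec dₐ) (θ₀ : MDM.Vec d)
      (S : MDM.SmoothConstants) (_ : MDM.SmoothDecision J aopt θ₀ S)
      (Ω : Type*) (_ : MeasurableSpace Ω) (X : MDM.Observations Ω d dᵤ)
      (P : MDM.Vec d → Measure Ω) (T : ℕ),
    -- upper bound for certainty equivalence
    (∀ (δ lam Tse Tcon Ccon α : ℝ) (Gbar : ℕ → Matrix (Fin d) (Fin d) ℝ)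
        (θhat : MDM.Traj d dᵤ T → MDM.Vec d),
      0 < δ → δ < 1 / 2 →
      X.IsLaw σ θ₀ (P θ₀) →
      X.PowerBound (P θ₀) T γ →
      X.PolicyRegular (P θ₀) (δ / 4) lam Gbar Tse Tcon Ccon α →
      MDM.IsLeastSquares θhat →
      Tcon < T → Tse < T → (4 * Ccon) ^ (1 / α) < T →
      c₁ * (σ : ℝ) ^ 2 * MDM.logComplexity δ lam (Gbar T) / (lam * S.r ^ 2) < T →
      (P θ₀) {ω | ¬ (MDM.excessRisk J (aopt (θhat (X.traj T ω))) θ₀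
          ≤ 5 * (σ : ℝ) ^ 2 * Real.log (24 * d / δ)
              * (X.idealRisk (MDM.taskHessian J aopt θ₀) (P θ₀) T / T)
            + c₂ * S.Lquad * (σ : ℝ) ^ 3 / lam ^ (3 / 2 : ℝ)
              * MDM.logComplexity δ lam (Gbar T) ^ (3 / 2 : ℝ) / (T : ℝ) ^ (3 / 2 : ℝ)
            + c₃ * (σ : ℝ) ^ 2 * Ccon ^ 2 * d * (MDM.taskHessian J aopt θ₀).trace / lam
              * Real.log (d / δ) / (T : ℝ) ^ (1 + 2 * α))}
        ≤ ENNReal.ofReal δ)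
    ∧
    -- lower bound for every decision rule
    (∀ lam rcov Lcov Ccov ccov α : ℝ,
      (∀ θ, X.IsLaw σ θ (P θ)) →
      X.SameExploration P →
      (∀ θ, X.PowerBound (P θ) T γ) →
      X.SmoothResponse P θ₀ T lam rcov Lcov Ccov ccov α →
      (80 * d / S.r ^ 2) ^ (6 / 5 : ℝ) ≤ lam * T →
      ((σ : ℝ) ^ 2 * S.LR2 / (5 * S.μ)) ^ 6 ≤ lam * T →
      (8 * Lcov * √(5 * d) / lam) ^ (12 / 5 : ℝ) ≤ lam * T →
      (8 * Ccov / lam ^ (1 - α)) ^ (1 / α) ≤ lam * T →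
      (5 * d / rcov ^ 2) ^ (6 / 5 : ℝ) ≤ lam * T →
      ENNReal.ofReal
          ((σ : ℝ) ^ 2 / (1 + 2 * ccov)
              * (X.idealRisk (MDM.taskHessian J aopt θ₀) (P θ₀) T / T)
            - c₄ * MDM.lowerConst d σ S / (lam * T) ^ (5 / 4 : ℝ))
        ≤ X.minimaxRisk P J T {θ | ‖θ - θ₀‖ ^ 2 ≤ 5 * d / (lam * T) ^ (5 / 6 : ℝ)}) := by
  obtain ⟨c₁, c₂, c₃, c₄, hc₁, hc₂, hc₃, hc₄, h⟩ := theorem1_general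
  refine ⟨c₁, c₂, c₃, c₄, hc₁, hc₂, hc₃, hc₄, fun d dₐ dᵤ hd σ γ J aopt θ₀ S hS Ω _ X P T => ?_⟩
  obtain ⟨upper, lower⟩ := h d dₐ dᵤ hd σ J aopt θ₀ S hS Ω _ X P T
  exact ⟨fun δ lam Tse Tcon Ccon α Gbar θhat hδ hδ' law _ =>
      upper δ lam Tse Tcon Ccon α Gbar θhat hδ hδ' (law.isSubgaussianLaw T),
    fun lam rcov Lcov Ccov ccov α law hexp _ => lower lam rcov Lcov Ccov ccov α law hexp⟩
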